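/- Let $k$ be a quadratic number field with discriminant $d$. An extension $M/k$ of number fields is called unramified if no finite prime of $k$ ramifies in $M$ (there is no condition at the infinite places), and it is called an $H_8$-extension if it is Galois with $\operatorname{Gal}(M/k)$ isomorphic to the quaternion group $H_8$ of order $8$. Then the following assertions are equivalent: 1. There exists an unramified $H_8$-extension $M/k$ such that $M/\mathbb{Q}$ is normal. 2. There is a factorization $d = d_1 d_2 d_3$ in which $d_1, d_2, d_3$ are pairwise coprime integers, each of which is the discriminant of a quadratic number field (so $d_i \neq 1$), such that $$\Big(\frac{d_1d_2}{p_3}\Big) = \Big(\frac{d_2d_3}{p_1}\Big) = \Big(\frac{d_3d_1}{p_2}\Big) = +1$$ for all primes $p_1 \mid d_1$, $p_2 \mid d_2$, $p_3 \mid d_3$. Here $(a/p)$ is the Legendre symbol if $p$ is an odd prime, and $(a/2)$ is the Kronecker symbol, that is, $0$ if $a$ is even, $+1$ if $a \equiv \pm 1 \bmod 8$, and $-1$ if $a \equiv \pm 3 \bmod 8$. -/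

import Mathlib

universe u

/-- An extension `M / k` of number fields is unramified if no finite prime ramifies in it: every
nonzero prime ideal of `𝓞 M` is unramified over `𝓞 k`. Infinite places are not restricted. -/
def IsUnramifiedAtFinitePrimes (k M : Type*) [Field k] [NumberField k] [Field M] [NumberField M]
    [Algebra k M] : Prop :=
  ∀ (P : Ideal (NumberField.RingOfIntegers M)) [P.IsMaximal],
    Algebra.IsUnramifiedAt (NumberField.RingOfIntegers k) P

/-- `M / k` is an unramified `H₈`-extension: normal, with Galois group isomorphic to the quaternion
group of order `8`, and unramified at all finite primes. -/
structure IsUnramifiedH8Extension (k M : Type*) [Field k] [NumberField k] [Field M] [NumberField M]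
    [Algebra k M] : Prop where
  isGalois : IsGalois k M
  galoisGroup : Nonempty ((M ≃ₐ[k] M) ≃* QuaternionGroup 2)
  unramified : IsUnramifiedAtFinitePrimes k M

/-- `D` is the discriminant of some quadratic number field (in particular `D ≠ 1`). -/
def IsQuadraticDiscriminant (D : ℤ) : Prop :=
  ∃ (F : Type) (_ : Field F) (_ : NumberField F),
    Module.finrank ℚ F = 2 ∧ NumberField.discr F = D

/-- The Kronecker symbol `(a / p)` at a prime number `p`: the Legendre symbol if `p` is odd, and
`(a / 2) = 0, 1, -1` according as `a` is even, `a ≡ ±1 mod 8`, `a ≡ ±3 mod 8`. -/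
def kroneckerSymbol (a : ℤ) (p : ℕ) [Fact p.Prime] : ℤ :=
  if p = 2 then ZMod.χ₈ (a : ZMod 8) else legendreSym p a

/-- `d = d₁ d₂ d₃` is an `H₈`-factorization of `d` into three pairwise coprime discriminants of
quadratic number fields. -/
structure IsH8Factorization (d d₁ d₂ d₃ : ℤ) : Prop where
  prod_eq : d = d₁ * d₂ * d₃
  discr₁ : IsQuadraticDiscriminant d₁
  discr₂ : IsQuadraticDiscriminant d₂
  discr₃ : IsQuadraticDiscriminant d₃
  coprime₁₂ : IsCoprime d₁ d₂
  coprime₂₃ : IsCoprime d₂ d₃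
  coprime₃₁ : IsCoprime d₃ d₁
  symbol₃ : ∀ (p : ℕ) [Fact p.Prime], (p : ℤ) ∣ d₃ → kroneckerSymbol (d₁ * d₂) p = 1
  symbol₁ : ∀ (p : ℕ) [Fact p.Prime], (p : ℤ) ∣ d₁ → kroneckerSymbol (d₂ * d₃) p = 1
  symbol₂ : ∀ (p : ℕ) [Fact p.Prime], (p : ℤ) ∣ d₂ → kroneckerSymbol (d₃ * d₁) p = 1

/-! Necessity. Put G = Gal(M/ℚ) and N = Gal(M/k) ≅ H₈. As M/k is unramified, every inertia subgroup
of G meets N trivially, hence has order at most 2, and by Minkowski's theorem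
(`closure_inertia_eq_top`) the resulting involutions generate G. This is strong enough group theory
to determine the action of G on N: conjugation is trivial modulo the centre of N, and each inertia
involution commutes with exactly one of i, j, ij. Multiplying the three conjugation signs by the
character of k gives three quadratic characters (`exists_characters`) whose product is the character
of k and such that each involution is detected by exactly one of them. They cut out three quadratic
fields; a prime ramifies in at most one of these, so the discriminants are coprime, and their
product is d. A Frobenius element above p ∣ d₁ normalizes an inertia group of order 2, so it
commutes with its involution; this forces it to fix √(d₂d₃), which is the condition on the symbol.

Sufficiency. The discriminants are replaced by squarefree radicands a, b, c with a ≡ b ≡ 1 mod 4.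
The extension is M = ℚ(√a, √b, √c, θ) with θ² = δαβγ, where α ∈ ℚ(√a), β ∈ ℚ(√b), γ ∈ ℚ(√(ab)) have
norms t, ta, tc and δ is rational. With these norms the conjugates of θ² differ from θ² by squares
in ℚ(√a, √b, √c), so M is normal, and the lifts of the automorphisms of this field over k obey the
quaternion relations (`nonempty_galois_mulEquiv`). The existence of α, β, γ (`exists_norms`) is a
matter of Legendre's theorem: t = |a|q with a suitable prime q from Dirichlet's theorem, local
solvability at a, b, c comes from the symbols, and quadratic reciprocity takes care of q and of the
signs.

The factor δ remains free, and `exists_twist` uses it to remove ramification at 2 and at the odd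
primes not dividing abc. At odd primes it corrects the parity of valuations. At 2, the fact that a
Frobenius element preserves the class of αβγ up to squares and c shows that some multiple by ±1 or
±2 is a square modulo 4. At odd primes dividing abc no choice is needed: M/ℚ is tame there, and
`map_eq_self_of_inertia` shows that the ramification is already absorbed by √a, √b or √c. So the
inertia groups of M/k are trivial. -/

/-! ### Legendre's theorem on ternary quadratic forms. -/

/-- The zeros of `a x² + b y² - c z²` modulo a prime contain the kernel of a linear form. -/
lemma exists_linear_form_dvd_ternary {p : ℕ} [Fact p.Prime] {a b c : ℤ}
    (hsq : Squarefree (a * b * c)) (hp : (p : ℤ) ∣ a * b * c)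
    (h₁ : (p : ℤ) ∣ a → IsSquare ((b * c : ℤ) : ZMod p))
    (h₂ : (p : ℤ) ∣ b → IsSquare ((a * c : ℤ) : ZMod p))
    (h₃ : (p : ℤ) ∣ c → IsSquare ((-(a * b) : ℤ) : ZMod p)) :
    ∃ u v w : ZMod p, ∀ x y z : ZMod p, u * x + v * y + w * z = 0 →
      (a : ZMod p) * x ^ 2 + b * y ^ 2 - c * z ^ 2 = 0 := by
  have hpp : Prime (p : ℤ) := Nat.prime_iff_prime_int.mp Fact.out
  have key : ∀ m n k : ℤ, m * n * k = a * b * c → (p : ℤ) ∣ m → (n : ZMod p) ≠ 0 := by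
    intro m n k hmn hm h0
    rw [ZMod.intCast_zmod_eq_zero_iff_dvd] at h0
    refine hpp.not_isUnit (hsq p ?_)
    rw [← hmn]
    exact dvd_mul_of_dvd_left (mul_dvd_mul hm h0) _
  rcases hpp.dvd_or_dvd hp with hab | hc
  · rcases hpp.dvd_or_dvd hab with ha | hb
    · obtain ⟨r, hr⟩ := h₁ ha
      have hb := key a b c rfl ha
      rw [← ZMod.intCast_zmod_eq_zero_iff_dvd] at ha
      -- Modulo p ∣ a, the form times b is (by)² − bcz² = (by − rz)(by + rz).
      refine ⟨0, b, -r, fun x y z h ↦ ?_⟩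
      push_cast at hr
      have : (b : ZMod p) * (a * x ^ 2 + b * y ^ 2 - c * z ^ 2) = 0 := by
        rw [ha]
        linear_combination (b * y + r * z) * h - z ^ 2 * hr
      exact (mul_eq_zero.mp this).resolve_left hb
    · obtain ⟨r, hr⟩ := h₂ hb
      have ha := key b a c (by ring) hb
      rw [← ZMod.intCast_zmod_eq_zero_iff_dvd] at hb
      refine ⟨a, 0, -r, fun x y z h ↦ ?_⟩
      push_cast at hr
      have : (a : ZMod p) * (a * x ^ 2 + b * y ^ 2 - c * z ^ 2) = 0 := by
        rw [hb]
        linear_combination (a * x + r * z) * h - z ^ 2 * hr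
      exact (mul_eq_zero.mp this).resolve_left ha
  · obtain ⟨r, hr⟩ := h₃ hc
    have ha := key c a b (by ring) hc
    rw [← ZMod.intCast_zmod_eq_zero_iff_dvd] at hc
    refine ⟨a, -r, 0, fun x y z h ↦ ?_⟩
    push_cast at hr
    have : (a : ZMod p) * (a * x ^ 2 + b * y ^ 2 - c * z ^ 2) = 0 := by
      rw [hc]
      linear_combination (a * x + r * y) * h - y ^ 2 * hr
    exact (mul_eq_zero.mp this).resolve_left ha

/-- A short vector on which `a x² + b y² - c z²` is divisible by `a b c`. -/
lemma exists_short_dvd_ternary {a b c : ℕ} (hsq : Squarefree (a * b * c))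
    (h₁ : ∀ (p : ℕ) [Fact p.Prime], p ∣ a → IsSquare ((b * c : ℤ) : ZMod p))
    (h₂ : ∀ (p : ℕ) [Fact p.Prime], p ∣ b → IsSquare ((a * c : ℤ) : ZMod p))
    (h₃ : ∀ (p : ℕ) [Fact p.Prime], p ∣ c → IsSquare ((-(a * b) : ℤ) : ZMod p)) :
    ∃ x y z : ℤ, (x, y, z) ≠ 0 ∧ x ^ 2 ≤ b * c ∧ y ^ 2 ≤ a * c ∧ z ^ 2 ≤ a * b ∧
      (a * b * c : ℤ) ∣ a * x ^ 2 + b * y ^ 2 - c * z ^ 2 := by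
  classical
  have hsq' : Squarefree ((a : ℤ) * b * c) := by exact_mod_cast Int.squarefree_natCast.mpr hsq
  have hN0 : a * b * c ≠ 0 := hsq.ne_zero
  let ι := {p // p ∈ (a * b * c).primeFactors}
  have hι : ∀ p : ι, Fact (p : ℕ).Prime := fun p ↦ ⟨Nat.prime_of_mem_primeFactors p.2⟩
  have hdvd : ∀ p : ι, (p : ℕ) ∣ a * b * c := fun p ↦ Nat.dvd_of_mem_primeFactors p.2
  have hex : ∀ p : ι, ∃ u v w : ZMod (p : ℕ), ∀ x y z : ZMod (p : ℕ), u * x + v * y + w * z = 0 →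
      ((a : ℤ) : ZMod p) * x ^ 2 + (b : ℤ) * y ^ 2 - (c : ℤ) * z ^ 2 = 0 := fun p ↦
    exists_linear_form_dvd_ternary hsq' (by exact_mod_cast hdvd p)
      (fun h ↦ h₁ p (by exact_mod_cast h)) (fun h ↦ h₂ p (by exact_mod_cast h))
      (fun h ↦ h₃ p (by exact_mod_cast h))
  choose u v w huvw using hex
  -- Pigeonhole: the square of the number of points of this box exceeds (bc)(ac)(ab) = (abc)², while
  -- the linear forms take at most abc values.
  let D := Fin (Nat.sqrt (b * c) + 1) × Fin (Nat.sqrt (a * c) + 1) × Fin (Nat.sqrt (a * b) + 1)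
  let f : D → (∀ p : ι, ZMod (p : ℕ)) := fun t p ↦
    u p * ((t.1 : ℕ) : ZMod p) + v p * ((t.2.1 : ℕ) : ZMod p) + w p * ((t.2.2 : ℕ) : ZMod p)
  have hcard : Fintype.card (∀ p : ι, ZMod (p : ℕ)) < Fintype.card D := by
    have e₁ : Fintype.card (∀ p : ι, ZMod (p : ℕ)) = a * b * c := by
      rw [Fintype.card_pi]
      simp only [ZMod.card]
      exact (Finset.prod_coe_sort (a * b * c).primeFactors (fun p ↦ p)).trans
        (Nat.prod_primeFactors_of_squarefree hsq)
    have e₂ : Fintype.card D =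
        (Nat.sqrt (b * c) + 1) * ((Nat.sqrt (a * c) + 1) * (Nat.sqrt (a * b) + 1)) := by
      simp [D]
    rw [e₁, e₂]
    have k₁ := Nat.lt_succ_sqrt' (b * c)
    have k₂ := Nat.lt_succ_sqrt' (a * c)
    have k₃ := Nat.lt_succ_sqrt' (a * b)
    refine lt_of_pow_lt_pow_left₀ 2 (by positivity) ?_
    calc (a * b * c) ^ 2 = (b * c) * ((a * c) * (a * b)) := by ring
      _ < (Nat.sqrt (b * c)).succ ^ 2 * ((Nat.sqrt (a * c)).succ ^ 2 *
          (Nat.sqrt (a * b)).succ ^ 2) :=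
        mul_lt_mul'' k₁ (mul_lt_mul'' k₂ k₃ (Nat.zero_le _) (Nat.zero_le _)) (Nat.zero_le _)
          (Nat.zero_le _)
      _ = _ := by simp only [Nat.succ_eq_add_one]; ring
  obtain ⟨s, t, hst, hf⟩ := Fintype.exists_ne_map_eq_of_card_lt f hcard
  have bound : ∀ {n : ℕ} (i j : Fin (Nat.sqrt n + 1)), ((i : ℤ) - j) ^ 2 ≤ n := by
    intro n i j
    have hi : (i : ℤ) ≤ Nat.sqrt n := by exact_mod_cast Nat.lt_succ_iff.mp i.2
    have hj : (j : ℤ) ≤ Nat.sqrt n := by exact_mod_cast Nat.lt_succ_iff.mp j.2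
    have hs : ((Nat.sqrt n : ℤ)) ^ 2 ≤ n := by exact_mod_cast Nat.sqrt_le' n
    refine le_trans (sq_le_sq.mpr ?_) hs
    rw [abs_of_nonneg (Int.natCast_nonneg (Nat.sqrt n)), abs_le]
    constructor <;> [linarith [Int.natCast_nonneg (i : ℕ)]; linarith [Int.natCast_nonneg (j : ℕ)]]
  refine ⟨s.1 - t.1, s.2.1 - t.2.1, s.2.2 - t.2.2, ?_, ?_, ?_, ?_, ?_⟩
  · intro h
    simp only [Prod.mk_eq_zero, sub_eq_zero, Nat.cast_inj] at h
    exact hst (Prod.ext (Fin.ext h.1) (Prod.ext (Fin.ext h.2.1) (Fin.ext h.2.2)))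
  · exact_mod_cast bound s.1 t.1
  · exact_mod_cast bound s.2.1 t.2.1
  · exact_mod_cast bound s.2.2 t.2.2
  · have : (a * b * c : ℤ) = ∏ p ∈ (a * b * c).primeFactors, (p : ℤ) := by
      rw [← Nat.cast_prod, Nat.prod_primeFactors_of_squarefree hsq]
      push_cast
      ring
    rw [this]
    refine Finset.prod_dvd_of_coprime ?_ ?_
    · intro p hp q hq hpq
      exact Nat.isCoprime_iff_coprime.mpr ((Nat.coprime_primes (Nat.prime_of_mem_primeFactors hp)
        (Nat.prime_of_mem_primeFactors hq)).mpr hpq)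
    · intro p hp
      have := hι ⟨p, hp⟩
      rw [← ZMod.intCast_zmod_eq_zero_iff_dvd]
      have hfp := congrFun hf ⟨p, hp⟩
      have := huvw ⟨p, hp⟩ ((s.1 : ℕ) - (t.1 : ℕ) : ZMod p) ((s.2.1 : ℕ) - (t.2.1 : ℕ) : ZMod p)
        ((s.2.2 : ℕ) - (t.2.2 : ℕ) : ZMod p) (by
          simp only [f] at hfp
          linear_combination hfp)
      push_cast at this ⊢
      exact this

/-- **Legendre's theorem** on ternary quadratic forms, for positive coefficients. -/
theorem exists_ternary_zero_of_pos {a b c : ℕ} (hsq : Squarefree (a * b * c))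
    (h₁ : ∀ (p : ℕ) [Fact p.Prime], p ∣ a → IsSquare ((b * c : ℤ) : ZMod p))
    (h₂ : ∀ (p : ℕ) [Fact p.Prime], p ∣ b → IsSquare ((a * c : ℤ) : ZMod p))
    (h₃ : ∀ (p : ℕ) [Fact p.Prime], p ∣ c → IsSquare ((-(a * b) : ℤ) : ZMod p)) :
    ∃ x y z : ℤ, (x, y, z) ≠ 0 ∧ a * x ^ 2 + b * y ^ 2 = c * z ^ 2 := by
  have hN0 : a * b * c ≠ 0 := hsq.ne_zero
  have ha : 0 < a := Nat.pos_of_ne_zero (by rintro rfl; simp at hN0)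
  have hb : 0 < b := Nat.pos_of_ne_zero (by rintro rfl; simp at hN0)
  have hc : 0 < c := Nat.pos_of_ne_zero (by rintro rfl; simp at hN0)
  have sq_one : ∀ {n : ℕ} {x : ℤ}, Squarefree n → x ^ 2 = n → n = 1 := by
    intro n x hn hx
    have : x.natAbs * x.natAbs ∣ n := by
      rw [← Int.natAbs_mul, ← sq, hx]; simp
    have h1 := Nat.isUnit_iff.mp (hn _ this)
    have : (n : ℤ) = 1 := by rw [← hx, ← Int.natAbs_sq, h1]; norm_num
    exact_mod_cast this
  -- Only here can a bound on the short vector be attained in a harmful way, namely z² = ab with the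
  -- quotient k equal to −1. In this case c has to be a sum of two squares.
  by_cases hab : a = 1 ∧ b = 1
  · obtain ⟨rfl, rfl⟩ := hab
    have hsc : Squarefree c := by simpa using hsq
    have : IsSquare (-1 : ZMod c) := by
      rw [ZMod.isSquare_neg_one_iff_forall_mem_primeFactors_mod_four_ne_three hsc]
      intro q hq
      have := Fact.mk (Nat.prime_of_mem_primeFactors hq)
      have := h₃ q (Nat.dvd_of_mem_primeFactors hq)
      rw [← ZMod.exists_sq_eq_neg_one_iff (p := q)]
      simpa using this
    obtain ⟨x, y, h⟩ := Nat.eq_sq_add_sq_of_isSquare_mod_neg_one this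
    exact ⟨x, y, 1, by simp, by push_cast [h]; ring⟩
  obtain ⟨x, y, z, h0, hx, hy, hz, k, hk⟩ := exists_short_dvd_ternary hsq h₁ h₂ h₃
  have hA : (0 : ℤ) < a := by exact_mod_cast ha
  have hB : (0 : ℤ) < b := by exact_mod_cast hb
  have hC : (0 : ℤ) < c := by exact_mod_cast hc
  have hP : (0 : ℤ) < a * b * c := by positivity
  have hx' : a * x ^ 2 ≤ (a * b * c : ℤ) := by nlinarith
  have hy' : b * y ^ 2 ≤ (a * b * c : ℤ) := by nlinarith
  have hz' : c * z ^ 2 ≤ (a * b * c : ℤ) := by nlinarith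
  have hx0 : 0 ≤ a * x ^ 2 := by positivity
  have hy0 : 0 ≤ b * y ^ 2 := by positivity
  have hz0 : 0 ≤ c * z ^ 2 := by positivity
  have hab' : Squarefree (a * b) := hsq.squarefree_of_dvd ⟨c, rfl⟩
  have hbc' : Squarefree (b * c) := hsq.squarefree_of_dvd ⟨a, by ring⟩
  have hac' : Squarefree (a * c) := hsq.squarefree_of_dvd ⟨b, by ring⟩
  have hk1 : -1 < k := by
    by_contra hcon
    have hk' : k ≤ -1 := by omega
    have h1 : c * z ^ 2 = (a * b * c : ℤ) := by nlinarith
    have h2 : z ^ 2 = ((a * b : ℕ) : ℤ) := by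
      push_cast
      have := mul_left_cancel₀ hC.ne' (h1.trans (show (a * b * c : ℤ) = c * (a * b) by ring))
      exact this
    exact hab (mul_eq_one.mp (sq_one hab' h2))
  have hk2 : k < 2 := by
    by_contra hcon
    have hk' : 2 ≤ k := by omega
    have hx2 : a * x ^ 2 = (a * b * c : ℤ) := by nlinarith
    have hy2 : b * y ^ 2 = (a * b * c : ℤ) := by nlinarith
    have h1 : x ^ 2 = ((b * c : ℕ) : ℤ) := by
      push_cast
      exact mul_left_cancel₀ hA.ne' (hx2.trans (show (a * b * c : ℤ) = a * (b * c) by ring))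
    have h2 : y ^ 2 = ((a * c : ℕ) : ℤ) := by
      push_cast
      exact mul_left_cancel₀ hB.ne' (hy2.trans (show (a * b * c : ℤ) = b * (a * c) by ring))
    exact hab ⟨(mul_eq_one.mp (sq_one hac' h2)).1, (mul_eq_one.mp (sq_one hbc' h1)).1⟩
  obtain rfl | rfl : k = 0 ∨ k = 1 := by omega
  · exact ⟨x, y, z, h0, by linarith⟩
  -- The identity a(xz + by)² + b(yz − ax)² = (ax² + by²)(z² + ab) turns the value abc into a zero.
  · refine ⟨x * z + b * y, y * z - a * x, z ^ 2 + a * b, ?_, ?_⟩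
    · intro h
      simp only [Prod.mk_eq_zero] at h
      nlinarith [h.2.2, sq_nonneg z, mul_pos hA hB]
    · linear_combination (z ^ 2 + a * b : ℤ) * hk

/-- **Legendre's theorem** on ternary quadratic forms. -/
theorem exists_ternary_zero {a b c : ℤ} (hsq : Squarefree (a * b * c))
    (hpos : ¬ (0 < a ∧ 0 < b ∧ 0 < c)) (hneg : ¬ (a < 0 ∧ b < 0 ∧ c < 0))
    (h₁ : ∀ (p : ℕ) [Fact p.Prime], (p : ℤ) ∣ a → IsSquare ((-(b * c) : ℤ) : ZMod p))
    (h₂ : ∀ (p : ℕ) [Fact p.Prime], (p : ℤ) ∣ b → IsSquare ((-(a * c) : ℤ) : ZMod p))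
    (h₃ : ∀ (p : ℕ) [Fact p.Prime], (p : ℤ) ∣ c → IsSquare ((-(a * b) : ℤ) : ZMod p)) :
    ∃ x y z : ℤ, (x, y, z) ≠ 0 ∧ a * x ^ 2 + b * y ^ 2 + c * z ^ 2 = 0 := by
  have main : ∀ {a b c : ℤ}, Squarefree (a * b * c) → 0 < a → 0 < b → c < 0 →
      (∀ (p : ℕ) [Fact p.Prime], (p : ℤ) ∣ a → IsSquare ((-(b * c) : ℤ) : ZMod p)) →
      (∀ (p : ℕ) [Fact p.Prime], (p : ℤ) ∣ b → IsSquare ((-(a * c) : ℤ) : ZMod p)) →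
      (∀ (p : ℕ) [Fact p.Prime], (p : ℤ) ∣ c → IsSquare ((-(a * b) : ℤ) : ZMod p)) →
      ∃ x y z : ℤ, (x, y, z) ≠ 0 ∧ a * x ^ 2 + b * y ^ 2 + c * z ^ 2 = 0 := by
    intro a b c hsq ha hb hc h₁ h₂ h₃
    lift a to ℕ using ha.le
    lift b to ℕ using hb.le
    obtain ⟨c, rfl⟩ : ∃ n : ℕ, c = -n := ⟨c.natAbs, by omega⟩
    have hs : Squarefree (a * b * c) := by
      rw [← Int.squarefree_natCast]
      refine hsq.squarefree_of_dvd ⟨-1, by push_cast; ring⟩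
    obtain ⟨x, y, z, h0, h⟩ := exists_ternary_zero_of_pos hs
      (fun p _ hp ↦ by simpa using h₁ p (by exact_mod_cast hp))
      (fun p _ hp ↦ by simpa using h₂ p (by exact_mod_cast hp))
      (fun p _ hp ↦ by simpa using h₃ p (by simpa using (by exact_mod_cast hp : (p : ℤ) ∣ c)))
    exact ⟨x, y, z, h0, by linarith⟩
  have hperm : ∀ {a b c : ℤ}, Squarefree (a * b * c) → ¬ (0 < a ∧ 0 < b ∧ 0 < c) → 0 < a →
      (0 < b ∨ 0 < c) → b ≠ 0 → c ≠ 0 →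
      (∀ (p : ℕ) [Fact p.Prime], (p : ℤ) ∣ a → IsSquare ((-(b * c) : ℤ) : ZMod p)) →
      (∀ (p : ℕ) [Fact p.Prime], (p : ℤ) ∣ b → IsSquare ((-(a * c) : ℤ) : ZMod p)) →
      (∀ (p : ℕ) [Fact p.Prime], (p : ℤ) ∣ c → IsSquare ((-(a * b) : ℤ) : ZMod p)) →
      ∃ x y z : ℤ, (x, y, z) ≠ 0 ∧ a * x ^ 2 + b * y ^ 2 + c * z ^ 2 = 0 := by
    intro a b c hsq hpos ha hbc hb0 hc0 h₁ h₂ h₃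
    rcases hbc with hb | hc
    · exact main hsq ha hb (by omega) h₁ h₂ h₃
    · obtain ⟨x, z, y, h0, h⟩ := main (a := a) (b := c) (c := b)
        (by convert hsq using 1; ring) ha hc (by omega)
        (fun p _ hp ↦ by simpa [mul_comm] using h₁ p hp) h₃ h₂
      refine ⟨x, y, z, fun h' ↦ h0 ?_, by linarith⟩
      simp only [Prod.mk_eq_zero] at h' ⊢
      tauto
  have htwo : ∀ {a b c : ℤ}, Squarefree (a * b * c) → ¬ (0 < a ∧ 0 < b ∧ 0 < c) →
      (0 < a ∧ 0 < b ∨ 0 < a ∧ 0 < c ∨ 0 < b ∧ 0 < c) → a ≠ 0 → b ≠ 0 → c ≠ 0 →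
      (∀ (p : ℕ) [Fact p.Prime], (p : ℤ) ∣ a → IsSquare ((-(b * c) : ℤ) : ZMod p)) →
      (∀ (p : ℕ) [Fact p.Prime], (p : ℤ) ∣ b → IsSquare ((-(a * c) : ℤ) : ZMod p)) →
      (∀ (p : ℕ) [Fact p.Prime], (p : ℤ) ∣ c → IsSquare ((-(a * b) : ℤ) : ZMod p)) →
      ∃ x y z : ℤ, (x, y, z) ≠ 0 ∧ a * x ^ 2 + b * y ^ 2 + c * z ^ 2 = 0 := by
    intro a b c hsq hpos h ha0 hb0 hc0 h₁ h₂ h₃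
    by_cases ha : 0 < a
    · exact hperm hsq hpos ha (by tauto) hb0 hc0 h₁ h₂ h₃
    · have hb : 0 < b := by tauto
      have hc : 0 < c := by tauto
      obtain ⟨y, z, x, h0, h⟩ := main (a := b) (b := c) (c := a)
        (by convert hsq using 1; ring) hb hc (by omega)
        (fun p _ hp ↦ by simpa [mul_comm] using h₂ p hp)
        (fun p _ hp ↦ by simpa [mul_comm] using h₃ p hp) h₁
      refine ⟨x, y, z, fun h' ↦ h0 ?_, by linarith⟩
      simp only [Prod.mk_eq_zero] at h' ⊢
      tauto
  have h0 := hsq.ne_zero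
  have ha0 : a ≠ 0 := by rintro rfl; simp at h0
  have hb0 : b ≠ 0 := by rintro rfl; simp at h0
  have hc0 : c ≠ 0 := by rintro rfl; simp at h0
  -- Two of the coefficients have the same sign; after a global change of sign they are positive.
  by_cases h : 0 < a ∧ 0 < b ∨ 0 < a ∧ 0 < c ∨ 0 < b ∧ 0 < c
  · exact htwo hsq hpos h ha0 hb0 hc0 h₁ h₂ h₃
  · obtain ⟨x, y, z, hxyz, h⟩ := htwo (a := -a) (b := -b) (c := -c)
      (by refine hsq.squarefree_of_dvd ⟨-1, by ring⟩) (by omega) (by omega) (by omega) (by omega)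
      (by omega) (fun p _ hp ↦ by simpa using h₁ p (by simpa using hp))
      (fun p _ hp ↦ by simpa using h₂ p (by simpa using hp))
      (fun p _ hp ↦ by simpa using h₃ p (by simpa using hp))
    exact ⟨x, y, z, hxyz, by linarith⟩

/-! ### Radicands, quadratic reciprocity and the norm equations. -/

open scoped NumberTheorySymbols

/-- A triple of squarefree radicands whose quadratic fields realize an `H₈`-factorization, ordered
so that the first two are discriminants. -/
structure IsH8Radicands (a b c : ℤ) : Prop where
  squarefree : Squarefree (a * b * c)
  mod_four₁ : a % 4 = 1
  mod_four₂ : b % 4 = 1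
  ne_one₁ : a ≠ 1
  ne_one₂ : b ≠ 1
  ne_one₃ : c ≠ 1
  isSquare₁ : ∀ (p : ℕ) [Fact p.Prime], (p : ℤ) ∣ a → IsSquare ((b * c : ℤ) : ZMod p)
  isSquare₂ : ∀ (p : ℕ) [Fact p.Prime], (p : ℤ) ∣ b → IsSquare ((a * c : ℤ) : ZMod p)
  isSquare₃ : ∀ (p : ℕ) [Fact p.Prime], (p : ℤ) ∣ c → IsSquare ((a * b : ℤ) : ZMod p)
  mod_eight : c % 4 ≠ 1 → (a * b) % 8 = 1

lemma Squarefree.not_dvd_of_dvd {a b n : ℤ} (h : Squarefree n) (hab : a * b ∣ n) {p : ℤ}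
    (hp : Prime p) (ha : p ∣ a) : ¬ p ∣ b :=
  fun hb ↦ hp.not_isUnit (h p ((mul_dvd_mul ha hb).trans hab))

lemma Squarefree.gcd_natAbs_eq_one {a b n : ℤ} (h : Squarefree n) (hab : a * b ∣ n) :
    a.gcd b.natAbs = 1 := by
  rw [Int.gcd_eq_natAbs, Int.natAbs_natCast, Nat.eq_one_iff_not_exists_prime_dvd]
  intro p hp hpd
  have h1 : (p : ℤ) ∣ a := Int.natCast_dvd.mpr (hpd.trans (Nat.gcd_dvd_left _ _))
  have h2 : (p : ℤ) ∣ b := Int.natCast_dvd.mpr (hpd.trans (Nat.gcd_dvd_right _ _))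
  exact h.not_dvd_of_dvd hab (Nat.prime_iff_prime_int.mp hp) h1 h2

lemma jacobiSym_eq_one_of_isSquare {a : ℤ} {n : ℕ}
    (h : ∀ (p : ℕ) [Fact p.Prime], p ∣ n → IsSquare (a : ZMod p)) (hc : a.gcd n = 1) :
    J(a | n) = 1 := by
  refine (jacobiSym.eq_one_or_neg_one hc).resolve_right fun h' ↦ ?_
  obtain ⟨p, hp, hpn, hj⟩ := jacobiSym.eq_neg_one_at_prime_divisor_of_eq_neg_one h'
  have := Fact.mk hp
  exact ZMod.nonsquare_iff_jacobiSym_eq_neg_one.mp hj (h p hpn)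

lemma jacobiSym_neg_one_natAbs {D : ℤ} (hD : D % 4 = 1) :
    J(-1 | D.natAbs) = if 0 < D then 1 else -1 := by
  have hodd : Odd D.natAbs := by rw [Nat.odd_iff]; omega
  rw [jacobiSym.at_neg_one hodd]
  split_ifs with h
  · exact ZMod.χ₄_nat_one_mod_four (by omega)
  · exact ZMod.χ₄_nat_three_mod_four (by omega)

/-- Quadratic reciprocity for an integer `D ≡ 1 mod 4` of arbitrary sign. -/
lemma jacobiSym_natAbs_comm {D : ℤ} (hD : D % 4 = 1) {n : ℕ} (hn : Odd n) :
    J(D | n) = J(n | D.natAbs) := by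
  rcases lt_or_ge 0 D with h | h
  · obtain ⟨m, rfl⟩ := Int.eq_ofNat_of_zero_le h.le
    simpa using jacobiSym.quadratic_reciprocity_one_mod_four (by omega) hn
  · obtain ⟨m, rfl⟩ : ∃ m : ℕ, D = -m := ⟨D.natAbs, by omega⟩
    have hm : m % 4 = 3 := by omega
    rw [Int.natAbs_neg, Int.natAbs_natCast, neg_eq_neg_one_mul, jacobiSym.mul_left,
      jacobiSym.at_neg_one hn]
    rcases Nat.odd_mod_four_iff.mp (Nat.odd_iff.mp hn) with h1 | h3
    · rw [ZMod.χ₄_nat_one_mod_four h1, one_mul]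
      exact jacobiSym.quadratic_reciprocity_one_mod_four' (Nat.odd_iff.mpr (by omega)) h1
    · rw [ZMod.χ₄_nat_three_mod_four h3, jacobiSym.quadratic_reciprocity_three_mod_four hm h3]
      ring

/-- Reciprocity applies to the odd positive part of c; the sign and the power of 2 are split off for
the supplementary laws. When `j` is not 0 the radicand is even, so the condition modulo 8 is
available for the symbol of 2. -/
lemma exists_eq_sign_mul_pow_two_mul_odd {c : ℤ} (hc : Squarefree c) :
    ∃ (j o : ℕ), Odd o ∧ (j = 0 ∨ 2 ∣ c) ∧ c = (if 0 < c then 1 else -1) * 2 ^ j * o := by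
  have h0 : c.natAbs ≠ 0 := by simpa using hc.ne_zero
  obtain ⟨j, o, ho, h⟩ := Nat.exists_eq_two_pow_mul_odd h0
  have hc0 := hc.ne_zero
  have hc' : (c.natAbs : ℤ) = 2 ^ j * o := by rw [h]; push_cast; ring
  refine ⟨j, o, ho, ?_, ?_⟩
  · rcases Nat.eq_zero_or_pos j with hj | hj
    · exact Or.inl hj
    · right
      rw [← Int.dvd_natAbs, hc']
      exact dvd_mul_of_dvd_left (dvd_pow_self _ hj.ne') _
  · rw [mul_assoc, ← hc']
    split_ifs <;> omega

namespace IsH8Radicands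

variable {a b c : ℤ}

lemma prod_mod_four (h : IsH8Radicands a b c) : (a * b) % 4 = 1 := by
  rw [Int.mul_emod, h.mod_four₁, h.mod_four₂]; rfl

lemma ne_zero₁ (h : IsH8Radicands a b c) : a ≠ 0 := by
  rintro rfl; simpa using h.mod_four₁

lemma ne_zero₂ (h : IsH8Radicands a b c) : b ≠ 0 := by
  rintro rfl; simpa using h.mod_four₂

lemma ne_zero₃ (h : IsH8Radicands a b c) : c ≠ 0 := by
  rintro rfl; simpa using h.squarefree

lemma isCoprime₁₂ (h : IsH8Radicands a b c) : IsCoprime a b := by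
  have := h.squarefree.gcd_natAbs_eq_one (a := a) (b := b) ⟨c, rfl⟩
  rw [Int.isCoprime_iff_gcd_eq_one]
  rwa [Int.gcd_eq_natAbs, Int.natAbs_natCast, ← Int.gcd_eq_natAbs] at this

lemma sign_mul_sign (h : IsH8Radicands a b c) : a.sign * a.sign = 1 := by
  rcases lt_trichotomy a 0 with ha | ha | ha
  · simp [Int.sign_eq_neg_one_of_neg ha]
  · exact absurd ha h.ne_zero₁
  · simp [Int.sign_eq_one_of_pos ha]

/-- This is solvability at the real place, deduced from the finite places. The product of the
symbols (bc/|a|) and (ac/|b|) is 1. By reciprocity (a/|b|) and (b/|a|) differ by a sign that is −1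
exactly if a, b < 0, and (c/|ab|) is −1 exactly if c, ab < 0. These two signs have product 1, so
they agree; they cannot both be −1, since a, b < 0 implies ab > 0. -/
lemma not_both_neg (h : IsH8Radicands a b c) :
    ¬ (a < 0 ∧ b < 0) ∧ ¬ (c < 0 ∧ a * b < 0) := by
  have hsq := h.squarefree
  have ha0 := h.ne_zero₁
  have hb0 := h.ne_zero₂
  have hc0 := h.ne_zero₃
  have ha4 := h.mod_four₁
  have hb4 := h.mod_four₂
  have hab4 := h.prod_mod_four
  have hA : J(b * c | a.natAbs) = 1 := jacobiSym_eq_one_of_isSquare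
    (fun p _ hp ↦ h.isSquare₁ p (Int.natCast_dvd.mpr hp))
    (hsq.gcd_natAbs_eq_one ⟨1, by ring⟩)
  have hB : J(a * c | b.natAbs) = 1 := jacobiSym_eq_one_of_isSquare
    (fun p _ hp ↦ h.isSquare₂ p (Int.natCast_dvd.mpr hp))
    (hsq.gcd_natAbs_eq_one ⟨1, by ring⟩)
  have hgab : b.gcd a.natAbs = 1 := hsq.gcd_natAbs_eq_one ⟨c, by ring⟩
  have e1 : J(a | b.natAbs) = (if 0 < a then 1 else if 0 < b then 1 else -1) * J(b | a.natAbs) := by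
    rw [jacobiSym_natAbs_comm hb4 (n := a.natAbs) (by rw [Nat.odd_iff]; omega)]
    rcases lt_or_gt_of_ne ha0 with ha | ha
    · rw [if_neg (by omega), ← jacobiSym_neg_one_natAbs hb4, ← jacobiSym.mul_left]
      congr 1; omega
    · rw [if_pos ha, one_mul]
      congr 1; omega
  have e2 : J(c | (a * b).natAbs) = if 0 < c then 1 else if 0 < a * b then 1 else -1 := by
    obtain ⟨j, o, ho, hj, hco⟩ := exists_eq_sign_mul_pow_two_mul_odd
      (hsq.squarefree_of_dvd ⟨a * b, by ring⟩ : Squarefree c)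
    have hodd : Odd (a * b).natAbs := by rw [Nat.odd_iff]; omega
    have hoc : (o : ℤ) ∣ c := ⟨(if 0 < c then 1 else -1) * 2 ^ j, by rw [mul_comm]; exact hco⟩
    have k1 : J(o | (a * b).natAbs) = 1 := by
      rw [← jacobiSym_natAbs_comm hab4 ho]
      refine jacobiSym_eq_one_of_isSquare
        (fun p _ hp ↦ h.isSquare₃ p ((Int.natCast_dvd_natCast.mpr hp).trans hoc)) ?_
      simpa using hsq.gcd_natAbs_eq_one (a := a * b) (b := o) (mul_dvd_mul_left _ hoc)
    have k2 : J(2 | (a * b).natAbs) ^ j = 1 := by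
      rcases hj with rfl | h2
      · simp
      · have h8 := h.mod_eight (by omega)
        rw [jacobiSym.at_two hodd, ZMod.χ₈_nat_eq_if_mod_eight, if_neg (by omega), if_pos (by omega),
          one_pow]
    conv_lhs => rw [hco]
    rw [jacobiSym.mul_left, jacobiSym.mul_left, jacobiSym.pow_left, k1, k2, mul_one, mul_one]
    by_cases hc : 0 < c
    · rw [if_pos hc, if_pos hc, jacobiSym.one_left]
    · rw [if_neg hc, if_neg hc, jacobiSym_neg_one_natAbs hab4]
  rw [Int.natAbs_mul, jacobiSym.mul_right' _ (by simpa) (by simpa)] at e2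
  rw [jacobiSym.mul_left] at hA hB
  have hsqb := jacobiSym.sq_one hgab
  have key : (if 0 < a then 1 else if 0 < b then (1 : ℤ) else -1) *
      (if 0 < c then 1 else if 0 < a * b then (1 : ℤ) else -1) = 1 := by
    rw [← e2]
    rw [e1] at hB
    generalize (if 0 < a then 1 else if 0 < b then (1 : ℤ) else -1) = ε at *
    linear_combination hB + ε * J(b | a.natAbs) * J(c | b.natAbs) * hA -
      ε * J(c | a.natAbs) * J(c | b.natAbs) * hsqb
  constructor
  · rintro ⟨ha, hb⟩
    rw [if_neg (by omega), if_neg (by omega), if_pos (mul_pos_of_neg_of_neg ha hb)] at key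
    simp at key
  · rintro ⟨hc, hab⟩
    rw [if_neg (c := 0 < c) (by omega), if_neg (c := 0 < a * b) (by omega)] at key
    by_cases ha : 0 < a
    · rw [if_pos ha] at key; norm_num at key
    · have hb : 0 < b := by
        by_contra hb
        have := mul_nonneg_of_nonpos_of_nonpos (not_lt.mp ha) (not_lt.mp hb)
        omega
      rw [if_neg ha, if_pos hb] at key; norm_num at key

/-- Dirichlet's theorem provides the auxiliary prime. -/
lemma exists_prime (h : IsH8Radicands a b c) : ∃ q : ℕ, q.Prime ∧ ¬ (q : ℤ) ∣ 2 * (a * b * c) ∧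
    a ∣ q + a.sign ∧ b ∣ q - a.sign := by
  have hsq := h.squarefree
  obtain ⟨u, v, huv⟩ := h.isCoprime₁₂
  have hs := h.sign_mul_sign
  -- Chinese remainders from ua + vb = 1: r is −sign a modulo a and sign a modulo b.
  let r := a.sign * (u * a - v * b)
  have hr1 : r = -a.sign + a * (2 * a.sign * u) := by
    simp only [r]; linear_combination -a.sign * huv
  have hr2 : r = a.sign - b * (2 * a.sign * v) := by
    simp only [r]; linear_combination a.sign * huv
  have hcop : IsCoprime r ((a * b).natAbs : ℤ) := by
    rw [Int.natCast_natAbs, IsCoprime.abs_right_iff]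
    refine IsCoprime.mul_right ⟨-a.sign, 2 * u, ?_⟩ ⟨a.sign, 2 * v, ?_⟩
    · rw [hr1]; linear_combination (1 - 2 * a * u) * hs
    · rw [hr2]; linear_combination (1 - 2 * b * v) * hs
  obtain ⟨q, hq, hqp, hmod⟩ := Nat.forall_exists_prime_gt_and_zmodEq (2 * (a * b * c)).natAbs
    (by simpa using ⟨h.ne_zero₁, h.ne_zero₂⟩) hcop
  have hdvd : a * b ∣ q - r := by
    have := hmod.symm.dvd
    rwa [Int.natCast_natAbs, abs_dvd] at this
  refine ⟨q, hqp, fun hd ↦ ?_, ?_, ?_⟩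
  · have := Int.natAbs_dvd_natAbs.mpr hd
    have := Nat.le_of_dvd (Int.natAbs_pos.mpr (mul_ne_zero two_ne_zero hsq.ne_zero)) this
    simp only [Int.natAbs_natCast] at this
    omega
  · have : (q : ℤ) + a.sign = (q - r) + a * (2 * a.sign * u) := by rw [hr1]; ring
    rw [this]
    exact dvd_add ((dvd_mul_right a b).trans hdvd) (dvd_mul_right _ _)
  · have : (q : ℤ) - a.sign = (q - r) - b * (2 * a.sign * v) := by rw [hr2]; ring
    rw [this]
    exact dvd_sub ((dvd_mul_left b a).trans hdvd) (dvd_mul_right _ _)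

lemma not_isSquare_of_prime_dvd {n m p : ℤ} (hp : Prime p) (hn : Squarefree n) (hmn : m ∣ n)
    (hpm : p ∣ m) : ¬ IsSquare m := by
  rintro ⟨r, rfl⟩
  have hpr : p ∣ r := (hp.dvd_or_dvd hpm).elim id id
  exact hp.not_isUnit (hn p ((mul_dvd_mul hpr hpr).trans hmn))

lemma exists_prime_dvd_of_mod_four {n : ℤ} (h4 : n % 4 = 1) (h1 : n ≠ 1) :
    ∃ p : ℤ, Prime p ∧ p ∣ n :=
  Int.exists_prime_and_dvd (by omega)

lemma not_isSquare₁ (h : IsH8Radicands a b c) : ¬ IsSquare a := by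
  obtain ⟨p, hp, hpa⟩ := exists_prime_dvd_of_mod_four h.mod_four₁ h.ne_one₁
  exact not_isSquare_of_prime_dvd hp h.squarefree ⟨b * c, by ring⟩ hpa

lemma not_isSquare₂ (h : IsH8Radicands a b c) : ¬ IsSquare b := by
  obtain ⟨p, hp, hpa⟩ := exists_prime_dvd_of_mod_four h.mod_four₂ h.ne_one₂
  exact not_isSquare_of_prime_dvd hp h.squarefree ⟨a * c, by ring⟩ hpa

lemma not_isSquare₁₂ (h : IsH8Radicands a b c) : ¬ IsSquare (a * b) := by
  obtain ⟨p, hp, hpa⟩ := exists_prime_dvd_of_mod_four h.mod_four₁ h.ne_one₁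
  exact not_isSquare_of_prime_dvd hp h.squarefree ⟨c, by ring⟩ (dvd_mul_of_dvd_left hpa _)

lemma not_isSquare₁₃ (h : IsH8Radicands a b c) : ¬ IsSquare (a * c) := by
  obtain ⟨p, hp, hpa⟩ := exists_prime_dvd_of_mod_four h.mod_four₁ h.ne_one₁
  exact not_isSquare_of_prime_dvd hp h.squarefree ⟨b, by ring⟩ (dvd_mul_of_dvd_left hpa _)

lemma not_isSquare₂₃ (h : IsH8Radicands a b c) : ¬ IsSquare (b * c) := by
  obtain ⟨p, hp, hpa⟩ := exists_prime_dvd_of_mod_four h.mod_four₂ h.ne_one₂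
  exact not_isSquare_of_prime_dvd hp h.squarefree ⟨a, by ring⟩ (dvd_mul_of_dvd_left hpa _)

lemma not_isSquare₃ (h : IsH8Radicands a b c) : ¬ IsSquare c := by
  by_cases hc : c.natAbs = 1
  · have : c = -1 := by have := h.ne_one₃; omega
    rw [this]
    rintro ⟨r, hr⟩
    nlinarith [mul_self_nonneg r]
  · obtain ⟨p, hp, hpa⟩ := Int.exists_prime_and_dvd hc
    exact not_isSquare_of_prime_dvd hp h.squarefree ⟨a * b, by ring⟩ hpa

lemma not_isSquare₁₂₃ (h : IsH8Radicands a b c) : ¬ IsSquare (a * b * c) := by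
  obtain ⟨p, hp, hpa⟩ := exists_prime_dvd_of_mod_four h.mod_four₁ h.ne_one₁
  exact not_isSquare_of_prime_dvd hp h.squarefree ⟨1, by ring⟩
    ((hpa.mul_right b).mul_right c)

/-- A zero of the ternary form yields a representation by the norm form. -/
lemma exists_norm_eq {D N k l m : ℤ} (hD : ¬ IsSquare D) (hk : k ≠ 0)
    (hl : k * l = D) (hm : k * m = N)
    (hex : ∃ x y z : ℤ, (x, y, z) ≠ 0 ∧ k * x ^ 2 + -l * y ^ 2 + -m * z ^ 2 = 0) :
    ∃ x y : ℚ, x ^ 2 - D * y ^ 2 = N := by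
  obtain ⟨x, y, z, h0, h⟩ := hex
  -- The common factor k of D and N was divided out to make the product of the coefficients
  -- squarefree; multiplying by k brings it back.
  have h' : (k * x) ^ 2 - D * y ^ 2 = N * z ^ 2 := by rw [← hl, ← hm]; linear_combination k * h
  have hz : z ≠ 0 := by
    rintro rfl
    have h2 : (k * x) ^ 2 = D * y ^ 2 := by linarith
    by_cases hy : y = 0
    · subst hy
      have : k * x = 0 := by simpa using h2
      have hx : x = 0 := (mul_eq_zero.mp this).resolve_left hk
      exact h0 (by simp [hx])
    · apply hD
      have hd : y ^ 2 ∣ (k * x) ^ 2 := ⟨D, by rw [h2]; ring⟩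
      obtain ⟨w, hw⟩ := (Int.pow_dvd_pow_iff two_ne_zero).mp hd
      refine ⟨w, ?_⟩
      rw [hw] at h2
      have := mul_left_cancel₀ (pow_ne_zero 2 hy) (a := y ^ 2) (b := w * w) (c := D) (by linarith)
      exact this.symm
  have hzq : (z : ℚ) ≠ 0 := by exact_mod_cast hz
  refine ⟨k * x / z, y / z, ?_⟩
  have hq : ((k : ℚ) * x) ^ 2 - D * y ^ 2 = N * z ^ 2 := by exact_mod_cast h'
  field_simp
  linarith

/-- Elements of the three quadratic fields with prescribed norms. -/
theorem exists_norms (h : IsH8Radicands a b c) : ∃ t a₀ a₁ b₀ b₁ c₀ c₁ : ℚ, t ≠ 0 ∧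
    a₀ ^ 2 - a * a₁ ^ 2 = t ∧ b₀ ^ 2 - b * b₁ ^ 2 = t * a ∧
    c₀ ^ 2 - (a * b) * c₁ ^ 2 = t * c := by
  -- The common norm will be t = |a|q. The congruences for q make the forms for α and β solvable at
  -- the primes dividing a and b and reduce the form for γ there to the hypotheses on bc and ac; by
  -- reciprocity they also make a and b squares modulo q.
  obtain ⟨q, hq, hqd, hqa, hqb⟩ := h.exists_prime
  have hsq := h.squarefree
  have ha0 := h.ne_zero₁
  have hb0 := h.ne_zero₂
  have hc0 := h.ne_zero₃
  have hs := h.sign_mul_sign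
  obtain ⟨hab, hcab⟩ := h.not_both_neg
  have hqF := Fact.mk hq
  have hq0 : (0 : ℤ) < q := by exact_mod_cast hq.pos
  have hqi : Prime (q : ℤ) := Nat.prime_iff_prime_int.mp hq
  have hqodd : Odd q := hq.odd_of_ne_two (by rintro rfl; exact hqd ⟨a * b * c, by simp⟩)
  obtain ⟨s, hsdef⟩ : ∃ s, s = a.sign := ⟨_, rfl⟩
  rw [← hsdef] at hs hqa hqb
  have hk : 0 < a * s := by
    rw [hsdef, mul_comm, Int.sign_mul_self_eq_abs]
    exact abs_pos.mpr ha0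
  have hsu : IsUnit s := IsUnit.of_mul_eq_one _ hs
  have hpu : ∀ (p : ℕ) [Fact p.Prime], ¬ (p : ℤ) ∣ s := fun p _ hp ↦
    (Nat.prime_iff_prime_int.mp (Fact.out : p.Prime)).not_isUnit (isUnit_of_dvd_unit hp hsu)
  have hpsm : ∀ (p : ℕ) [Fact p.Prime] (n : ℤ), (p : ℤ) ∣ s * n → (p : ℤ) ∣ n := fun p _ n hp ↦
    ((Nat.prime_iff_prime_int.mp (Fact.out : p.Prime)).dvd_or_dvd hp).resolve_left (hpu p)
  have hs' : s = if 0 < a then 1 else -1 := by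
    split_ifs with h
    · rw [hsdef, Int.sign_eq_one_of_pos h]
    · rw [hsdef, Int.sign_eq_neg_one_of_neg (by omega)]
  have hqsq : Squarefree (a * b * c * q) := by
    rw [squarefree_mul_iff]
    exact ⟨(hqi.irreducible.isRelPrime_iff_not_dvd.mpr fun h ↦ hqd (h.mul_left 2)).symm, hsq,
      hqi.squarefree⟩
  have hmod : ∀ (p : ℕ) [Fact p.Prime] (n x y : ℤ), (p : ℤ) ∣ n → n ∣ x - y →
      (x : ZMod p) = y := fun p _ n x y hp hn ↦ by
    rw [← sub_eq_zero, ← Int.cast_sub, ZMod.intCast_zmod_eq_zero_iff_dvd]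
    exact hp.trans hn
  have hqa' : ∀ (p : ℕ) [Fact p.Prime], (p : ℤ) ∣ a → (q : ZMod p) = -(s : ZMod p) := by
    intro p _ hp
    simpa using hmod p a q (-s) hp (by simpa using hqa)
  have hqb' : ∀ (p : ℕ) [Fact p.Prime], (p : ℤ) ∣ b → (q : ZMod p) = (s : ZMod p) := by
    intro p _ hp
    simpa using hmod p b q s hp hqb
  have hss : ∀ (p : ℕ), (s : ZMod p) * s = 1 := fun p ↦ by
    rw [← Int.cast_mul, hs, Int.cast_one]
  have hJa : J(a | q) = 1 := by
    rw [jacobiSym_natAbs_comm h.mod_four₁ hqodd, jacobiSym.mod_left' (a₂ := -s)]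
    · rw [hs']
      split_ifs with hpos
      · rw [jacobiSym_neg_one_natAbs h.mod_four₁, if_pos hpos]
      · rw [neg_neg, jacobiSym.one_left]
    · refine Int.ModEq.symm ((Int.modEq_iff_dvd).mpr ?_)
      rw [Int.natCast_natAbs, abs_dvd]
      simpa using hqa
  have hJb : J(b | q) = 1 := by
    rw [jacobiSym_natAbs_comm h.mod_four₂ hqodd, jacobiSym.mod_left' (a₂ := s)]
    · rw [hs']
      split_ifs with hpos
      · rw [jacobiSym.one_left]
      · rw [jacobiSym_neg_one_natAbs h.mod_four₂, if_pos]
        by_contra hb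
        exact hab ⟨by omega, by omega⟩
    · refine Int.ModEq.symm ((Int.modEq_iff_dvd).mpr ?_)
      rw [Int.natCast_natAbs, abs_dvd]
      exact hqb
  have hJab : J(a * b | q) = 1 := by rw [jacobiSym.mul_left, hJa, hJb, one_mul]
  have hpq : ∀ (p : ℕ) [Fact p.Prime], (p : ℤ) ∣ q → p = q := fun p _ hp ↦
    (Nat.prime_dvd_prime_iff_eq Fact.out hq).mp (by exact_mod_cast hp)
  have hmodq : ∀ (p : ℕ) [Fact p.Prime] (n : ℤ), J(n | q) = 1 → (p : ℤ) ∣ q →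
      IsSquare (n : ZMod p) := by
    intro p _ n hJ hp
    obtain rfl := hpq p hp
    exact ZMod.isSquare_of_jacobiSym_eq_one hJ
  have hbc : 0 < c ∨ 0 < s * b := by
    by_contra! hcon
    have hc : c < 0 := lt_of_le_of_ne hcon.1 hc0
    refine hcab ⟨hc, lt_of_le_of_ne ?_ (mul_ne_zero ha0 hb0)⟩
    have : a * b = (a * s) * (s * b) := by linear_combination -a * b * hs
    rw [this]
    exact mul_nonpos_of_nonneg_of_nonpos hk.le hcon.2
  obtain ⟨a₀, a₁, hA⟩ : ∃ x y : ℚ, x ^ 2 - (a : ℤ) * y ^ 2 = (a * s * q : ℤ) := by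
    refine exists_norm_eq (k := a * s) (l := s) (m := q) h.not_isSquare₁ hk.ne'
      (by linear_combination a * hs) rfl (exists_ternary_zero ?_ ?_ ?_ ?_ ?_ ?_)
    · exact hqsq.squarefree_of_dvd ⟨b * c, by linear_combination -(a * b * c * q) * hs⟩
    · rintro ⟨-, -, h3⟩; omega
    · rintro ⟨h1, -, -⟩; omega
    · intro p _ hp
      have hp' := hpsm p a (by rwa [mul_comm])
      refine ⟨1, ?_⟩
      push_cast
      rw [hqa' p hp']
      linear_combination hss p
    · intro p _ hp
      exact absurd (by simpa using hp) (hpu p)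
    · intro p _ hp
      have := hmodq p a hJa (by simpa using hp)
      convert this using 2
      linear_combination a * hs
  obtain ⟨b₀, b₁, hB⟩ : ∃ x y : ℚ, x ^ 2 - (b : ℤ) * y ^ 2 = (s * q : ℤ) := by
    refine exists_norm_eq (k := 1) (l := b) (m := s * q) h.not_isSquare₂ one_ne_zero
      (by ring) (by ring) (exists_ternary_zero ?_ ?_ ?_ ?_ ?_ ?_)
    · exact hqsq.squarefree_of_dvd ⟨a * c * s, by linear_combination -(a * b * c * q) * hs⟩
    · rintro ⟨-, h2, h3⟩
      have hs1 : s < 0 := by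
        by_contra hcon
        have := mul_nonneg (not_lt.mp hcon) hq0.le
        omega
      refine hab ⟨?_, by omega⟩
      rw [hs'] at hs1
      by_contra hcon
      rw [if_pos (by omega)] at hs1
      omega
    · rintro ⟨h1, -, -⟩; omega
    · intro p _ hp
      exact absurd (isUnit_of_dvd_one hp)
        (Nat.prime_iff_prime_int.mp (Fact.out : p.Prime)).not_isUnit
    · intro p _ hp
      refine ⟨1, ?_⟩
      push_cast
      rw [hqb' p (by simpa using hp)]
      linear_combination hss p
    · intro p _ hp
      have := hmodq p b hJb (hpsm p q (by simpa using hp))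
      convert this using 2
      ring
  obtain ⟨c₀, c₁, hC⟩ : ∃ x y : ℚ, x ^ 2 - (a * b : ℤ) * y ^ 2 = (a * s * (q * c) : ℤ) := by
    refine exists_norm_eq (k := a * s) (l := s * b) (m := q * c) h.not_isSquare₁₂ hk.ne'
      (by linear_combination a * b * hs) rfl (exists_ternary_zero ?_ ?_ ?_ ?_ ?_ ?_)
    · exact hqsq.squarefree_of_dvd ⟨1, by linear_combination -(a * b * c * q) * hs⟩
    · rintro ⟨-, h2, h3⟩
      rcases hbc with hc | hsb
      · have := mul_pos hq0 hc
        linarith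
      · linarith
    · rintro ⟨h1, -, -⟩; omega
    · intro p _ hp
      have hp' := hpsm p a (by rwa [mul_comm])
      have := h.isSquare₁ p hp'
      convert this using 1
      push_cast
      rw [hqa' p hp']
      linear_combination (b * c) * hss p
    · intro p _ hp
      have hp' := hpsm p b (by simpa using hp)
      have := h.isSquare₂ p hp'
      convert this using 1
      push_cast
      rw [hqb' p hp']
      linear_combination (a * c) * hss p
    · intro p _ hp
      have : IsSquare ((a * b : ℤ) : ZMod p) := by
        rcases (Nat.prime_iff_prime_int.mp (Fact.out : p.Prime)).dvd_or_dvd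
          (by simpa using hp : (p : ℤ) ∣ q * c) with hp | hp
        · exact hmodq p _ hJab hp
        · exact h.isSquare₃ p hp
      convert this using 2
      linear_combination (a * b) * hs
  -- Scaling the second element by a turns its norm sq into a²sq = ta.
  refine ⟨a * s * q, a₀, a₁, a * b₀, a * b₁, c₀, c₁, ?_, ?_, ?_, ?_⟩
  · exact_mod_cast (mul_pos hk hq0).ne'
  · push_cast at hA; exact hA
  · push_cast at hB; linear_combination (a : ℚ) ^ 2 * hB
  · push_cast at hC; linear_combination hC

end IsH8Radicands

/-! ### Discriminants of quadratic fields. -/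

open NumberField Module

/-- The discriminant of the quadratic field generated by the square root of a squarefree `m`. -/
def fundamentalDiscr (m : ℤ) : ℤ := if m % 4 = 1 then m else 4 * m

lemma not_isSquare_of_squarefree {m : ℤ} (hm : Squarefree m) (h1 : m ≠ 1) : ¬ IsSquare m := by
  rintro ⟨r, rfl⟩
  have := hm r dvd_rfl
  exact h1 (Int.isUnit_mul_self this)

lemma sq_ratCast_ne_of_not_isSquare {m : ℤ} (hm : ¬ IsSquare m) (r : ℚ) : r ^ 2 ≠ m := by
  intro h
  apply hm
  rw [← Rat.isSquare_intCast_iff]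
  exact ⟨r, by rw [← h, sq]⟩

lemma isIntegral_of_quadratic {R : Type*} [CommRing R] {y a b : R} (ha : IsIntegral ℤ a)
    (hb : IsIntegral ℤ b) (h : y ^ 2 = a * y - b) : IsIntegral ℤ y := by
  nontriviality R
  let a' : integralClosure ℤ R := ⟨a, ha⟩
  let b' : integralClosure ℤ R := ⟨b, hb⟩
  have hy : IsIntegral (integralClosure ℤ R) y := by
    refine ⟨Polynomial.X ^ 2 + (-Polynomial.C a' * Polynomial.X + Polynomial.C b'), ?_, ?_⟩
    · refine Polynomial.monic_X_pow_add ?_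
      compute_degree!
    · simp only [Polynomial.eval₂_add, Polynomial.eval₂_mul, Polynomial.eval₂_neg,
        Polynomial.eval₂_pow, Polynomial.eval₂_X, Polynomial.eval₂_C]
      change y ^ 2 + (-a * y + b) = 0
      rw [h]
      ring
  exact isIntegral_trans _ hy

lemma coords_unique {F : Type*} [Field F] [CharZero F] {x : F} {m : ℤ} (hx : x ^ 2 = m) (hm : ¬ IsSquare m)
    {u v u' v' : ℚ} (h : (u : F) + v * x = u' + v' * x) : u = u' ∧ v = v' := by
  have hv : v = v' := by
    by_contra hv
    have hvF : (v : F) - v' ≠ 0 := by rw [sub_ne_zero]; exact_mod_cast hv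
    have hxr : x = (((u' - u) / (v - v') : ℚ) : F) := by
      push_cast
      field_simp
      linear_combination h
    rw [hxr] at hx
    exact sq_ratCast_ne_of_not_isSquare hm ((u' - u) / (v - v')) (by exact_mod_cast hx)
  subst hv
  exact ⟨by exact_mod_cast add_right_cancel h, rfl⟩

section Quadratic

variable {F : Type*} [Field F] [NumberField F]

lemma exists_ratCast_add_mul (hF : finrank ℚ F = 2) {x : F} {m : ℤ} (hx : x ^ 2 = m)
    (hm : ¬ IsSquare m) (y : F) : ∃ u v : ℚ, y = u + v * x := by
  have hli : LinearIndependent ℚ ![(1 : F), x] := by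
    rw [LinearIndependent.pair_iff]
    intro s t hst
    have ht : t = 0 := by
      by_contra ht
      have hxr : x = ((-s / t : ℚ) : F) := by
        have : (t : F) ≠ 0 := by exact_mod_cast ht
        rw [Rat.smul_def, Rat.smul_def] at hst
        push_cast
        field_simp
        linear_combination hst
      apply sq_ratCast_ne_of_not_isSquare hm (-s / t)
      have := hx
      rw [hxr] at this
      exact_mod_cast this
    subst ht
    simpa using hst
  have htop := hli.span_eq_top_of_card_eq_finrank (by simp [hF])
  have hy : y ∈ Submodule.span ℚ (Set.range ![(1 : F), x]) := by rw [htop]; trivial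
  rw [Matrix.range_cons, Matrix.range_cons, Matrix.range_empty, Set.union_empty,
    Set.singleton_union, Submodule.mem_span_pair] at hy
  obtain ⟨u, v, h⟩ := hy
  exact ⟨u, v, by rw [← h, Rat.smul_def, Rat.smul_def, mul_one]⟩

lemma exists_algEquiv_neg {K L : Type*} [Field K] [Field L] [Algebra K L] [FiniteDimensional K L]
    [IsGalois K L] {x : L}
    {m : K} (hx : x ^ 2 = algebraMap K L m) (hm : ¬ IsSquare m) : ∃ σ : L ≃ₐ[K] L, σ x = -x := by
  by_contra! hcon
  have hfix : ∀ σ : L ≃ₐ[K] L, σ x = x := by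
    intro σ
    have : (σ x) ^ 2 = x ^ 2 := by rw [← map_pow, hx, AlgEquiv.commutes]
    exact (sq_eq_sq_iff_eq_or_eq_neg.mp this).resolve_right (hcon σ)
  obtain ⟨r, hr⟩ := (IsGalois.mem_range_algebraMap_iff_fixed x).mpr hfix
  refine hm ⟨r, (algebraMap K L).injective ?_⟩
  rw [map_mul, hr, ← hx, sq]

lemma trace_ratCast_add_mul (hF : finrank ℚ F = 2) {x : F} {m : ℤ} (hx : x ^ 2 = m)
    (hm : ¬ IsSquare m) (u v : ℚ) : Algebra.trace ℚ F (u + v * x) = 2 * u := by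
  have : Algebra.IsQuadraticExtension ℚ F := ⟨hF⟩
  obtain ⟨σ, hσ⟩ := exists_algEquiv_neg (K := ℚ) (x := x) (m := (m : ℚ)) (by simpa using hx)
    (by rwa [Rat.isSquare_intCast_iff])
  have h0 : Algebra.trace ℚ F x = 0 := by
    have := Algebra.trace_eq_of_algEquiv σ x
    rw [hσ, map_neg] at this
    linarith
  have h1 : ((u : F) + v * x) = algebraMap ℚ F u + v • x := by rw [Rat.smul_def]; rfl
  rw [h1, map_add, map_smul, h0, smul_zero, add_zero, Algebra.trace_algebraMap, hF]
  simp

lemma discr_pair (hF : finrank ℚ F = 2) {x : F} {m : ℤ} (hx : x ^ 2 = m)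
    (hm : ¬ IsSquare m) (u v : Fin 2 → ℚ) :
    Algebra.discr ℚ (fun i ↦ (u i : F) + v i * x) = 4 * m * (u 0 * v 1 - u 1 * v 0) ^ 2 := by
  have key : ∀ i j, Algebra.trace ℚ F (((u i : F) + v i * x) * (u j + v j * x)) =
      2 * (u i * u j + m * (v i * v j)) := by
    intro i j
    rw [← trace_ratCast_add_mul hF hx hm _ (u i * v j + u j * v i)]
    congr 1
    push_cast
    linear_combination (v i * v j : F) * hx
  rw [Algebra.discr_def, Matrix.det_fin_two]
  simp only [Algebra.traceMatrix_apply, Algebra.traceForm_apply, key]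
  ring

/-- The square of the denominator of r is prime to the numerator, so it divides the squarefree m and
must be 1. -/
lemma isInteger_of_mul_sq {m : ℤ} (hm : Squarefree m) {r : ℚ} {n : ℤ} (h : m * r ^ 2 = n) :
    ∃ k : ℤ, r = k := by
  have hd : (r.den : ℤ) * r.den ∣ m := by
    have hr := Rat.num_div_den r
    have hden : (r.den : ℚ) ≠ 0 := by exact_mod_cast r.den_ne_zero
    have e : m * r.num ^ 2 = n * r.den ^ 2 := by
      have : (m : ℚ) * r.num ^ 2 = n * r.den ^ 2 := by
        rw [← hr] at h
        field_simp at h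
        linarith
      exact_mod_cast this
    have hc : IsCoprime ((r.den : ℤ) * r.den) (r.num ^ 2) := by
      rw [← sq]
      refine IsCoprime.pow ?_
      rw [isCoprime_comm, Int.isCoprime_iff_gcd_eq_one]
      exact r.reduced
    exact hc.dvd_of_dvd_mul_right ⟨n, by rw [e]; ring⟩
  have h1 := hm _ hd
  have h2 : r.den = 1 := by simpa using Int.isUnit_iff_natAbs_eq.mp h1
  exact ⟨r.num, (Rat.coe_int_num_of_den_eq_one h2).symm⟩

/-- Integral elements of `ℚ(√m)` have half-integral coordinates. -/
lemma exists_two_mul_coords {x : F} {m : ℤ} (hF : finrank ℚ F = 2) (hx : x ^ 2 = m)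
    (hm : Squarefree m) (h1 : m ≠ 1) {u v : ℚ} (hi : IsIntegral ℤ ((u : F) + v * x)) :
    ∃ U V : ℤ, 2 * u = U ∧ 2 * v = V ∧ 4 ∣ U ^ 2 - m * V ^ 2 := by
  have hns := not_isSquare_of_squarefree hm h1
  have : Algebra.IsQuadraticExtension ℚ F := ⟨hF⟩
  obtain ⟨σ, hσ⟩ := exists_algEquiv_neg (K := ℚ) (x := x) (m := (m : ℚ)) (by simpa using hx)
    (by rwa [Rat.isSquare_intCast_iff])
  have hi' : IsIntegral ℤ ((u : F) - v * x) := by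
    have := hi.map (σ : F →ₐ[ℚ] F)
    simpa [hσ, ← sub_eq_add_neg] using this
  have ht : IsIntegral ℤ (2 * u : ℚ) := by
    have := hi.add hi'
    rw [show ((u : F) + v * x + (u - v * x)) = algebraMap ℚ F (2 * u) by
      simp only [eq_ratCast]; push_cast; ring] at this
    exact (isIntegral_algebraMap_iff (algebraMap ℚ F).injective).mp this
  have hn : IsIntegral ℤ (u ^ 2 - m * v ^ 2 : ℚ) := by
    have := hi.mul hi'
    rw [show ((u : F) + v * x) * (u - v * x) = algebraMap ℚ F (u ^ 2 - m * v ^ 2) by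
      simp only [eq_ratCast]; push_cast; linear_combination (-(v : F) ^ 2) * hx] at this
    exact (isIntegral_algebraMap_iff (algebraMap ℚ F).injective).mp this
  obtain ⟨U, hU⟩ := IsIntegrallyClosed.isIntegral_iff.mp ht
  obtain ⟨N, hN⟩ := IsIntegrallyClosed.isIntegral_iff.mp hn
  simp only [algebraMap_int_eq, eq_intCast] at hU hN
  obtain ⟨V, hV⟩ := isInteger_of_mul_sq hm (r := 2 * v) (n := U ^ 2 - 4 * N) (by
    push_cast; rw [hU, hN]; ring)
  refine ⟨U, V, hU.symm, hV, N, ?_⟩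
  have : ((U ^ 2 - m * V ^ 2 : ℤ) : ℚ) = (4 * N : ℤ) := by
    push_cast; rw [← hV, hU, hN]; ring
  exact_mod_cast this

/-- Let Δ be the determinant of the coordinates of an integral basis with respect to 1, x. The
discriminant is 4mΔ², and any two integers have a determinant in ℤΔ. If m ≡ 1 mod 4, the pair 1, (1
+ x)/2 gives k² · disc = m, and k = ±1 as m is squarefree. Otherwise a computation modulo 4 shows
that integers have integral coordinates, so Δ ∈ ℤ, and the pair 1, x gives Δ = ±1. -/
lemma discr_of_sq_eq (hF : finrank ℚ F = 2) {x : F} {m : ℤ} (hx : x ^ 2 = m)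
    (hm : Squarefree m) (h1 : m ≠ 1) : NumberField.discr F = fundamentalDiscr m := by
  have hns := not_isSquare_of_squarefree hm h1
  have hrank : finrank ℤ (𝓞 F) = 2 := by rw [RingOfIntegers.rank, hF]
  let b : Basis (Fin 2) ℤ (𝓞 F) := finBasisOfFinrankEq ℤ (𝓞 F) hrank
  choose u v huv using fun i ↦ exists_ratCast_add_mul hF hx hns (b i : F)
  have hdisc : (NumberField.discr F : ℚ) = 4 * m * (u 0 * v 1 - u 1 * v 0) ^ 2 := by
    rw [← discr_pair hF hx hns, ← NumberField.discr_eq_discr F b]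
    change algebraMap ℤ ℚ _ = _
    rw [← Algebra.discr_localizationLocalization ℤ (nonZeroDivisors ℤ) F]
    congr 1
    ext i
    rw [← huv, Basis.localizationLocalization_apply]
  have hcomb : ∀ y : 𝓞 F, ∃ n₀ n₁ : ℤ, (y : F) =
      ((n₀ * u 0 + n₁ * u 1 : ℚ) : F) + ((n₀ * v 0 + n₁ * v 1 : ℚ) : F) * x := by
    intro y
    have := b.sum_repr y
    rw [Fin.sum_univ_two] at this
    refine ⟨b.repr y 0, b.repr y 1, ?_⟩
    have h := congrArg (algebraMap (𝓞 F) F) this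
    simp only [map_add, zsmul_eq_mul, map_mul, map_intCast] at h
    refine h.symm.trans ?_
    have e0 : algebraMap (𝓞 F) F (b 0) = _ := huv 0
    have e1 : algebraMap (𝓞 F) F (b 1) = _ := huv 1
    rw [e0, e1]
    push_cast
    ring
  have hdet : ∀ y z : 𝓞 F, ∀ u' v' u'' v'' : ℚ, (y : F) = u' + v' * x → (z : F) = u'' + v'' * x →
      ∃ k : ℤ, u' * v'' - u'' * v' = k * (u 0 * v 1 - u 1 * v 0) := by
    intro y z u' v' u'' v'' hy hz
    obtain ⟨n₀, n₁, hn⟩ := hcomb y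
    obtain ⟨k₀, k₁, hk⟩ := hcomb z
    obtain ⟨h1, h2⟩ := coords_unique hx hns (hy.symm.trans hn)
    obtain ⟨h3, h4⟩ := coords_unique hx hns (hz.symm.trans hk)
    refine ⟨n₀ * k₁ - n₁ * k₀, ?_⟩
    rw [h1, h2, h3, h4]
    push_cast
    ring
  by_cases h4 : m % 4 = 1
  · rw [fundamentalDiscr, if_pos h4]
    have hω : IsIntegral ℤ ((1 + x) / 2) := by
      obtain ⟨n, hn⟩ : ∃ n : ℤ, m = 1 + 4 * n := ⟨m / 4, by omega⟩
      refine isIntegral_of_quadratic (isIntegral_intCast 1) (isIntegral_intCast (-n)) ?_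
      rw [hn] at hx
      push_cast at hx ⊢
      linear_combination hx / 4
    obtain ⟨k, hk⟩ := hdet 1 ⟨_, hω⟩ 1 0 (1 / 2) (1 / 2) (by simp) (by
      change (1 + x) / 2 = _; push_cast; ring)
    have : ((k * k * NumberField.discr F : ℤ) : ℚ) = m := by
      push_cast
      rw [hdisc]
      linear_combination (-4 * (m : ℚ) * (k * (u 0 * v 1 - u 1 * v 0) + 1 / 2)) * hk
    have hkm : k * k * NumberField.discr F = m := by exact_mod_cast this
    have hunit := hm k ⟨_, hkm.symm⟩
    rw [Int.isUnit_mul_self hunit, one_mul] at hkm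
    exact hkm
  · rw [fundamentalDiscr, if_neg h4]
    have hint : ∀ i, ∃ U V : ℤ, u i = U ∧ v i = V := by
      intro i
      obtain ⟨U, V, hU, hV, hd⟩ := exists_two_mul_coords hF hx hm h1 (u := u i) (v := v i) (by
        rw [← huv i]; exact (b i).isIntegral_coe)
      have h0 : m % 4 ≠ 0 := fun h0 ↦ by
        have := hm 2 (by omega)
        exact absurd this (by decide)
      obtain ⟨hUe, hVe⟩ : 2 ∣ U ∧ 2 ∣ V := by
        have e : (U ^ 2 - m * V ^ 2) % 4 = 0 := by omega
        have hU4 : U % 4 = 0 ∨ U % 4 = 1 ∨ U % 4 = 2 ∨ U % 4 = 3 := by omega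
        have hV4 : V % 4 = 0 ∨ V % 4 = 1 ∨ V % 4 = 2 ∨ V % 4 = 3 := by omega
        have hm4 : m % 4 = 2 ∨ m % 4 = 3 := by omega
        rcases hU4 with hu | hu | hu | hu <;> rcases hV4 with hv | hv | hv | hv <;>
          rcases hm4 with hm' | hm' <;>
          simp [Int.sub_emod, Int.mul_emod, pow_two, hu, hv, hm'] at e <;> omega
      obtain ⟨U', rfl⟩ := hUe
      obtain ⟨V', rfl⟩ := hVe
      refine ⟨U', V', ?_, ?_⟩
      · push_cast at hU; linarith
      · push_cast at hV; linarith
    choose U V hU hV using hint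
    have hxi : IsIntegral ℤ x := by
      refine isIntegral_of_quadratic (isIntegral_intCast 0) (isIntegral_intCast (-m)) ?_
      push_cast
      linear_combination hx
    obtain ⟨k, hk⟩ := hdet 1 ⟨_, hxi⟩ 1 0 0 1 (by simp) (by
      change x = _; push_cast; ring)
    rw [hU, hU, hV, hV] at hk hdisc
    have hk' : k * (U 0 * V 1 - U 1 * V 0) = 1 := by
      have : ((k * (U 0 * V 1 - U 1 * V 0) : ℤ) : ℚ) = 1 := by push_cast; linarith
      exact_mod_cast this
    have hu : (U 0 * V 1 - U 1 * V 0) * (U 0 * V 1 - U 1 * V 0) = 1 :=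
      Int.isUnit_mul_self (IsUnit.of_mul_eq_one_right _ hk')
    have : NumberField.discr F = 4 * m * ((U 0 * V 1 - U 1 * V 0) * (U 0 * V 1 - U 1 * V 0)) := by
      rw [← sq]; exact_mod_cast hdisc
    rw [this, hu, mul_one]

lemma exists_squarefree_mul_sq {n : ℤ} (hn : n ≠ 0) : ∃ m r : ℤ, Squarefree m ∧ r ≠ 0 ∧
    n = m * r ^ 2 := by
  obtain ⟨a, b, ha, hb, hab, hsq⟩ := Nat.sq_mul_squarefree_of_pos (Int.natAbs_pos.mpr hn)
  have hb0 : (b : ℤ) ≠ 0 := by exact_mod_cast hb.ne'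
  have hab' : (n.natAbs : ℤ) = b ^ 2 * a := by exact_mod_cast hab.symm
  rcases Int.natAbs_eq n with h | h
  · exact ⟨a, b, Int.squarefree_natCast.mpr hsq, hb0, by rw [h, hab']; ring⟩
  · refine ⟨-a, b, ?_, hb0, by rw [h, hab']; ring⟩
    exact (Int.squarefree_natCast.mpr hsq).squarefree_of_dvd ⟨-1, by ring⟩

/-- Every quadratic field is generated by the square root of a squarefree integer. -/
lemma exists_sq_eq_squarefree (hF : finrank ℚ F = 2) :
    ∃ (m : ℤ) (x : F), Squarefree m ∧ m ≠ 1 ∧ x ^ 2 = m := by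
  obtain ⟨y, hy⟩ : ∃ y : F, y ∉ (algebraMap ℚ F).range := by
    by_contra! h
    have hbij : Function.Bijective (algebraMap ℚ F) := ⟨(algebraMap ℚ F).injective, h⟩
    have := Algebra.finrank_eq_one_iff_bijective_algebraMap.mpr hbij
    omega
  have hdeg : (minpoly ℚ y).natDegree = 2 := by
    have hint := Algebra.IsIntegral.isIntegral (R := ℚ) y
    have hle : (minpoly ℚ y).natDegree ≤ 2 := hF ▸ minpoly.natDegree_le y
    have h1 := (minpoly.two_le_natDegree_iff hint).mpr hy
    omega
  obtain ⟨p, q, hpq⟩ : ∃ p q : ℚ, y ^ 2 + p * y + q = 0 := by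
    refine ⟨(minpoly ℚ y).coeff 1, (minpoly ℚ y).coeff 0, ?_⟩
    have hmonic := minpoly.monic (Algebra.IsIntegral.isIntegral (R := ℚ) y)
    have h2 : (minpoly ℚ y).coeff 2 = 1 := by rw [← hdeg]; exact hmonic
    have := minpoly.aeval ℚ y
    rw [Polynomial.aeval_eq_sum_range, hdeg, Finset.sum_range_succ, Finset.sum_range_succ,
      Finset.sum_range_succ, Finset.sum_range_zero, h2] at this
    simp only [Rat.smul_def] at this
    push_cast at this
    linear_combination this
  set Δ : ℚ := p ^ 2 / 4 - q with hΔ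
  have hz : (y + (p / 2 : ℚ)) ^ 2 = (Δ : F) := by
    rw [hΔ]; push_cast; linear_combination hpq
  have hz0 : y + (p / 2 : ℚ) ≠ 0 := fun h ↦ hy ⟨-(p / 2), by
    rw [eq_ratCast]; push_cast at h ⊢; linear_combination -h⟩
  have hΔ0 : Δ ≠ 0 := by
    rintro h0
    rw [h0, Rat.cast_zero] at hz
    exact hz0 (pow_eq_zero_iff two_ne_zero |>.mp hz)
  obtain ⟨m, r, hm, hr, hmr⟩ := exists_squarefree_mul_sq (n := Δ.num * Δ.den)
    (mul_ne_zero (Rat.num_ne_zero.mpr hΔ0) (by exact_mod_cast Δ.den_ne_zero))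
  have hden : (Δ.den : F) ≠ 0 := by exact_mod_cast Δ.den_ne_zero
  have hrF : (r : F) ≠ 0 := by exact_mod_cast hr
  have hx : ((y + (p / 2 : ℚ)) * Δ.den / r) ^ 2 = (m : F) := by
    have e1 : (Δ : F) * Δ.den = Δ.num := by exact_mod_cast Rat.mul_den_eq_num Δ
    have e2 : (Δ.num : F) * Δ.den = m * r ^ 2 := by exact_mod_cast congrArg (Int.cast (R := F)) hmr
    rw [div_pow, mul_pow, hz]
    field_simp
    linear_combination (Δ.den : F) * e1 + e2
  refine ⟨m, _, hm, ?_, hx⟩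
  rintro rfl
  have : ((y + (p / 2 : ℚ)) * Δ.den / r) = 1 ∨ ((y + (p / 2 : ℚ)) * Δ.den / r) = -1 := by
    rw [← sq_eq_one_iff]; simpa using hx
  have hmem : ∀ e : ℚ, ((y + (p / 2 : ℚ)) * Δ.den / r) = (e : F) → False := by
    intro e he
    refine hy ⟨e * r / Δ.den - p / 2, ?_⟩
    rw [eq_ratCast]
    push_cast at he ⊢
    rw [← he]
    field_simp
    ring
  rcases this with h | h
  · exact hmem 1 (by simpa using h)
  · exact hmem (-1) (by simpa using h)

lemma exists_discr_eq (hF : finrank ℚ F = 2) : ∃ (m : ℤ) (x : F), Squarefree m ∧ m ≠ 1 ∧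
    x ^ 2 = m ∧ NumberField.discr F = fundamentalDiscr m := by
  obtain ⟨m, x, hm, h1, hx⟩ := exists_sq_eq_squarefree hF
  exact ⟨m, x, hm, h1, hx, discr_of_sq_eq hF hx hm h1⟩

end Quadratic

/-! ### From factorizations of the discriminant to radicands. -/

lemma IsQuadraticDiscriminant.exists_squarefree {D : ℤ} (h : IsQuadraticDiscriminant D) :
    ∃ m : ℤ, Squarefree m ∧ m ≠ 1 ∧ D = fundamentalDiscr m := by
  obtain ⟨F, _, _, hF, rfl⟩ := h
  obtain ⟨m, -, hm, h1, -, hd⟩ := exists_discr_eq hF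
  exact ⟨m, hm, h1, hd⟩

lemma IsH8Factorization.rotate {d d₁ d₂ d₃ : ℤ} (h : IsH8Factorization d d₁ d₂ d₃) :
    IsH8Factorization d d₂ d₃ d₁ where
  prod_eq := by rw [h.prod_eq]; ring
  discr₁ := h.discr₂
  discr₂ := h.discr₃
  discr₃ := h.discr₁
  coprime₁₂ := h.coprime₂₃
  coprime₂₃ := h.coprime₃₁
  coprime₃₁ := h.coprime₁₂
  symbol₃ := h.symbol₁
  symbol₁ := h.symbol₂
  symbol₂ := h.symbol₃

lemma isSquare_of_kroneckerSymbol_eq_one {p : ℕ} [Fact p.Prime] {n : ℤ}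
    (h : kroneckerSymbol n p = 1) : IsSquare (n : ZMod p) := by
  by_cases hp : p = 2
  · subst hp
    generalize (n : ZMod 2) = x
    clear h
    revert x
    decide +revert
  · rw [kroneckerSymbol, if_neg hp, jacobiSym.legendreSym.to_jacobiSym] at h
    exact ZMod.isSquare_of_jacobiSym_eq_one h

lemma kroneckerSymbol_two_eq_one_iff {n : ℤ} : haveI := Fact.mk Nat.prime_two
    kroneckerSymbol n 2 = 1 ↔ n % 8 = 1 ∨ n % 8 = 7 := by
  rw [kroneckerSymbol, if_pos rfl, ZMod.χ₈_int_eq_if_mod_eight]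
  split_ifs <;> simp <;> omega

lemma isSquare_of_isSquare_mul_fundamentalDiscr {p : ℕ} [Fact p.Prime] (hp : p ≠ 2) {n m : ℤ}
    (h : IsSquare ((n * fundamentalDiscr m : ℤ) : ZMod p)) : IsSquare ((n * m : ℤ) : ZMod p) := by
  rw [fundamentalDiscr] at h
  split_ifs at h with h4
  · exact h
  · have h2 : (2 : ZMod p) ≠ 0 := by
      intro h0
      have : ((2 : ℕ) : ZMod p) = 0 := by exact_mod_cast h0
      rw [ZMod.natCast_eq_zero_iff] at this
      exact hp ((Nat.prime_dvd_prime_iff_eq Fact.out Nat.prime_two).mp this)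
    obtain ⟨r, hr⟩ := h
    refine ⟨r / 2, ?_⟩
    push_cast at hr ⊢
    field_simp
    linear_combination hr

lemma dvd_fundamentalDiscr (m : ℤ) : m ∣ fundamentalDiscr m := by
  rw [fundamentalDiscr]
  split_ifs
  · exact dvd_rfl
  · exact dvd_mul_left _ _

lemma fundamentalDiscr_of_odd {m : ℤ} (h : ¬ 2 ∣ fundamentalDiscr m) :
    fundamentalDiscr m = m ∧ m % 4 = 1 := by
  rw [fundamentalDiscr] at h ⊢
  split_ifs at h ⊢ with h4
  · exact ⟨rfl, h4⟩
  · omega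

lemma fundamentalDiscr_injective {m n : ℤ} (hm : Squarefree m) (hn : Squarefree n)
    (h : fundamentalDiscr m = fundamentalDiscr n) : m = n := by
  have aux : ∀ {x : ℤ}, Squarefree x → x % 4 ≠ 0 := fun hx h0 ↦
    absurd (hx 2 (by omega)) (by decide)
  have := aux hm
  have := aux hn
  simp only [fundamentalDiscr] at h
  split_ifs at h <;> omega

lemma fundamentalDiscr_mul {m n : ℤ} (hm : m % 4 = 1) :
    fundamentalDiscr (m * n) = m * fundamentalDiscr n := by
  have : (m * n) % 4 = n % 4 := by rw [Int.mul_emod, hm, one_mul, Int.emod_emod_of_dvd _ dvd_rfl]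
  rw [fundamentalDiscr, fundamentalDiscr, this]
  split_ifs <;> ring

lemma IsH8Factorization.exists_radicands_of_odd {d d₁ d₂ d₃ : ℤ}
    (h : IsH8Factorization d d₁ d₂ d₃) (h₁ : ¬ 2 ∣ d₁) (h₂ : ¬ 2 ∣ d₂) :
    ∃ a b c, IsH8Radicands a b c ∧ d = fundamentalDiscr (a * b * c) := by
  obtain ⟨a, ha, ha1, rfl⟩ := h.discr₁.exists_squarefree
  obtain ⟨b, hb, hb1, rfl⟩ := h.discr₂.exists_squarefree
  obtain ⟨c, hc, hc1, rfl⟩ := h.discr₃.exists_squarefree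
  obtain ⟨hfa, ha4⟩ := fundamentalDiscr_of_odd h₁
  obtain ⟨hfb, hb4⟩ := fundamentalDiscr_of_odd h₂
  have hab4 : (a * b) % 4 = 1 := by rw [Int.mul_emod, ha4, hb4]; rfl
  have hprod := h.prod_eq
  have hs₁ := h.symbol₁
  have hs₂ := h.symbol₂
  have hs₃ := h.symbol₃
  have hc₁₂ := h.coprime₁₂
  have hc₂₃ := h.coprime₂₃
  have hc₃₁ := h.coprime₃₁
  simp only [hfa, hfb] at h₁ h₂ hprod hs₁ hs₂ hs₃ hc₁₂ hc₂₃ hc₃₁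
  have hcd := dvd_fundamentalDiscr c
  refine ⟨a, b, c, ⟨?_, ha4, hb4, ha1, hb1, hc1, ?_, ?_, ?_, ?_⟩, ?_⟩
  · rw [squarefree_mul_iff, squarefree_mul_iff]
    refine ⟨(IsCoprime.mul_left ?_ ?_).isRelPrime, ⟨hc₁₂.isRelPrime, ha, hb⟩, hc⟩
    · exact (hc₃₁.of_isCoprime_of_dvd_left hcd).symm
    · exact hc₂₃.of_isCoprime_of_dvd_right hcd
  · intro p _ hp
    refine isSquare_of_isSquare_mul_fundamentalDiscr ?_
      (isSquare_of_kroneckerSymbol_eq_one (hs₁ p hp))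
    rintro rfl; exact h₁ (by exact_mod_cast hp)
  · intro p _ hp
    refine isSquare_of_isSquare_mul_fundamentalDiscr ?_
      (isSquare_of_kroneckerSymbol_eq_one (mul_comm _ a ▸ hs₂ p hp))
    rintro rfl; exact h₂ (by exact_mod_cast hp)
  · intro p _ hp
    exact isSquare_of_kroneckerSymbol_eq_one (hs₃ p (hp.trans hcd))
  -- Now 2 divides the third discriminant, so ab ≡ ±1 mod 8, and ab ≡ 1 mod 4 excludes the minus
  -- sign.
  · intro hc4
    have := @hs₃ 2 (Fact.mk Nat.prime_two) (by rw [fundamentalDiscr, if_neg hc4]; omega)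
    rw [kroneckerSymbol_two_eq_one_iff] at this
    omega
  · rw [hprod, fundamentalDiscr_mul hab4]

/-- Coprimality allows at most one even discriminant, and the conditions are invariant under cyclic
rotation, which moves it to the third place. -/
lemma IsH8Factorization.exists_radicands {d d₁ d₂ d₃ : ℤ} (h : IsH8Factorization d d₁ d₂ d₃) :
    ∃ a b c, IsH8Radicands a b c ∧ d = fundamentalDiscr (a * b * c) := by
  have hpair : ∀ {x y : ℤ}, IsCoprime x y → 2 ∣ x → ¬ 2 ∣ y := fun hxy hx hy ↦
    absurd (hxy.isUnit_of_dvd' hx hy) (by decide)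
  by_cases h₁ : 2 ∣ d₁
  · exact h.rotate.exists_radicands_of_odd (hpair h.coprime₁₂ h₁) (hpair h.coprime₃₁.symm h₁)
  by_cases h₂ : 2 ∣ d₂
  · exact h.rotate.rotate.exists_radicands_of_odd (hpair h.coprime₂₃ h₂) h₁
  · exact h.exists_radicands_of_odd h₁ h₂

/-! ### The element θ and its conjugates. -/

/-- Generators of the quaternion extension: square roots `x, y, z` of the radicands and a square
root `θ` of `δ α β γ`, where `α, β, γ` have prescribed norms in the quadratic fields generated by
`x`, `y` and `x y`. -/
structure H8Generators (a b c : ℤ) (M : Type*) [Field M] [CharZero M] where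
  (x y z θ : M)
  (t δ a₀ a₁ b₀ b₁ c₀ c₁ : ℚ)
  a_ne : a ≠ 0
  b_ne : b ≠ 0
  c_ne : c ≠ 0
  t_ne : t ≠ 0
  δ_ne : δ ≠ 0
  x_sq : x ^ 2 = a
  y_sq : y ^ 2 = b
  z_sq : z ^ 2 = c
  norm_α : a₀ ^ 2 - a * a₁ ^ 2 = t
  norm_β : b₀ ^ 2 - b * b₁ ^ 2 = t * a
  norm_γ : c₀ ^ 2 - (a * b) * c₁ ^ 2 = t * c
  θ_sq : θ ^ 2 = δ * ((a₀ + a₁ * x) * (b₀ + b₁ * y) * (c₀ + c₁ * (x * y)))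

namespace H8Generators

variable {a b c : ℤ} {M : Type*} [Field M] [CharZero M] (g : H8Generators a b c M)

def α : M := g.a₀ + g.a₁ * g.x
def α' : M := g.a₀ - g.a₁ * g.x
def β : M := g.b₀ + g.b₁ * g.y
def β' : M := g.b₀ - g.b₁ * g.y
def γ : M := g.c₀ + g.c₁ * (g.x * g.y)
def γ' : M := g.c₀ - g.c₁ * (g.x * g.y)

lemma θ_sq' : g.θ ^ 2 = g.δ * (g.α * g.β * g.γ) := g.θ_sq

lemma α_mul : g.α * g.α' = g.t := by
  have := congrArg (Rat.cast (K := M)) g.norm_α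
  push_cast at this
  rw [α, α']
  linear_combination this - (g.a₁ : M) ^ 2 * g.x_sq

lemma β_mul : g.β * g.β' = g.t * a := by
  have := congrArg (Rat.cast (K := M)) g.norm_β
  push_cast at this
  rw [β, β']
  linear_combination this - (g.b₁ : M) ^ 2 * g.y_sq

lemma γ_mul : g.γ * g.γ' = g.t * c := by
  have := congrArg (Rat.cast (K := M)) g.norm_γ
  push_cast at this
  rw [γ, γ']
  linear_combination this - (g.c₁ : M) ^ 2 * (g.x_sq * g.y ^ 2 + a * g.y_sq)

lemma t_ne' : (g.t : M) ≠ 0 := by exact_mod_cast g.t_ne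
lemma δ_ne' : (g.δ : M) ≠ 0 := by exact_mod_cast g.δ_ne
lemma a_ne' (g : H8Generators a b c M) : (a : M) ≠ 0 := by exact_mod_cast g.a_ne
lemma b_ne' (g : H8Generators a b c M) : (b : M) ≠ 0 := by exact_mod_cast g.b_ne
lemma c_ne' (g : H8Generators a b c M) : (c : M) ≠ 0 := by exact_mod_cast g.c_ne

lemma x_ne : g.x ≠ 0 := fun h ↦ g.a_ne' (by rw [← g.x_sq, h]; ring)
lemma y_ne : g.y ≠ 0 := fun h ↦ g.b_ne' (by rw [← g.y_sq, h]; ring)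
lemma z_ne : g.z ≠ 0 := fun h ↦ g.c_ne' (by rw [← g.z_sq, h]; ring)

lemma α_ne : g.α ≠ 0 := left_ne_zero_of_mul (g.α_mul ▸ g.t_ne')
lemma α'_ne : g.α' ≠ 0 := right_ne_zero_of_mul (g.α_mul ▸ g.t_ne')
lemma β_ne : g.β ≠ 0 := left_ne_zero_of_mul (g.β_mul ▸ mul_ne_zero g.t_ne' g.a_ne')
lemma β'_ne : g.β' ≠ 0 := right_ne_zero_of_mul (g.β_mul ▸ mul_ne_zero g.t_ne' g.a_ne')
lemma γ_ne : g.γ ≠ 0 := left_ne_zero_of_mul (g.γ_mul ▸ mul_ne_zero g.t_ne' g.c_ne')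
lemma γ'_ne : g.γ' ≠ 0 := right_ne_zero_of_mul (g.γ_mul ▸ mul_ne_zero g.t_ne' g.c_ne')

lemma θ_ne : g.θ ≠ 0 := by
  intro h
  have := g.θ_sq'
  rw [h, zero_pow two_ne_zero] at this
  exact mul_ne_zero g.δ_ne' (mul_ne_zero (mul_ne_zero g.α_ne g.β_ne) g.γ_ne) this.symm

section Conj

variable {F : Type*} [FunLike F M M] [RingHomClass F M M] (σ : F)

lemma map_α (h : σ g.x = g.x) : σ g.α = g.α := by simp [α, h]
lemma map_α_neg (h : σ g.x = -g.x) : σ g.α = g.α' := by simp [α, α', h, sub_eq_add_neg]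
lemma map_α'_neg (h : σ g.x = -g.x) : σ g.α' = g.α := by simp [α, α', h]
lemma map_α' (h : σ g.x = g.x) : σ g.α' = g.α' := by simp [α', h]
lemma map_β (h : σ g.y = g.y) : σ g.β = g.β := by simp [β, h]
lemma map_β_neg (h : σ g.y = -g.y) : σ g.β = g.β' := by simp [β, β', h, sub_eq_add_neg]
lemma map_β'_neg (h : σ g.y = -g.y) : σ g.β' = g.β := by simp [β, β', h]
lemma map_γ (h : σ (g.x * g.y) = g.x * g.y) : σ g.γ = g.γ := by
  rw [γ, map_add, map_mul, h]; simp
lemma map_γ' (h : σ (g.x * g.y) = g.x * g.y) : σ g.γ' = g.γ' := by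
  rw [γ', map_sub, map_mul, h]; simp
lemma map_γ_neg (h : σ (g.x * g.y) = -(g.x * g.y)) : σ g.γ = g.γ' := by
  rw [γ, γ', map_add, map_mul, h]; simp [sub_eq_add_neg]
lemma map_γ'_neg (h : σ (g.x * g.y) = -(g.x * g.y)) : σ g.γ' = g.γ := by
  rw [γ, γ', map_sub, map_mul, h]; simp

lemma map_x : σ g.x = g.x ∨ σ g.x = -g.x := by
  rw [← sq_eq_sq_iff_eq_or_eq_neg, ← map_pow, g.x_sq, map_intCast]

lemma map_y : σ g.y = g.y ∨ σ g.y = -g.y := by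
  rw [← sq_eq_sq_iff_eq_or_eq_neg, ← map_pow, g.y_sq, map_intCast]

lemma map_z : σ g.z = g.z ∨ σ g.z = -g.z := by
  rw [← sq_eq_sq_iff_eq_or_eq_neg, ← map_pow, g.z_sq, map_intCast]

lemma map_θ_sq : (σ g.θ) ^ 2 = g.δ * (σ g.α * σ g.β * σ g.γ) := by
  rw [← map_pow, g.θ_sq']; simp

lemma map_θ_of_fixed (hx : σ g.x = g.x) (hy : σ g.y = g.y) : σ g.θ = g.θ ∨ σ g.θ = -g.θ := by
  rw [← sq_eq_sq_iff_eq_or_eq_neg, map_θ_sq, g.map_α σ hx, g.map_β σ hy,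
    g.map_γ σ (by rw [map_mul, hx, hy]), g.θ_sq']

/-- The conjugate of θ² is δα'βγ', which equals (δtβz/θ)² because αα' = t and γγ' = tc. The next two
lemmas use the pairs β, γ and α, β in the same way. -/
lemma map_θ_neg_left (hx : σ g.x = -g.x) (hy : σ g.y = g.y) :
    σ g.θ = g.δ * g.t * g.β * g.z / g.θ ∨ σ g.θ = -(g.δ * g.t * g.β * g.z / g.θ) := by
  rw [← sq_eq_sq_iff_eq_or_eq_neg, map_θ_sq, g.map_α_neg σ hx, g.map_β σ hy,
    g.map_γ_neg σ (by rw [map_mul, hx, hy]; ring), div_pow, g.θ_sq', eq_div_iff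
    (mul_ne_zero g.δ_ne' (mul_ne_zero (mul_ne_zero g.α_ne g.β_ne) g.γ_ne))]
  linear_combination (g.δ : M) ^ 2 * g.β ^ 2 * (g.α_mul * g.γ * g.γ' + g.t * g.γ_mul -
    g.t ^ 2 * g.z_sq)

lemma map_θ_neg_right (hx : σ g.x = g.x) (hy : σ g.y = -g.y) :
    σ g.θ = g.δ * g.t * g.α * (g.x * g.z) / g.θ ∨
      σ g.θ = -(g.δ * g.t * g.α * (g.x * g.z) / g.θ) := by
  rw [← sq_eq_sq_iff_eq_or_eq_neg, map_θ_sq, g.map_α σ hx, g.map_β_neg σ hy,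
    g.map_γ_neg σ (by rw [map_mul, hx, hy]; ring), div_pow, g.θ_sq', eq_div_iff
    (mul_ne_zero g.δ_ne' (mul_ne_zero (mul_ne_zero g.α_ne g.β_ne) g.γ_ne))]
  linear_combination (g.δ : M) ^ 2 * g.α ^ 2 * (g.β_mul * g.γ * g.γ' + g.t * a * g.γ_mul -
    g.t ^ 2 * (g.x_sq * g.z ^ 2 + a * g.z_sq))

lemma map_θ_neg_neg (hx : σ g.x = -g.x) (hy : σ g.y = -g.y) :
    σ g.θ = g.α' * g.x / g.β * g.θ ∨ σ g.θ = -(g.α' * g.x / g.β * g.θ) := by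
  have := g.β_ne
  rw [← sq_eq_sq_iff_eq_or_eq_neg, map_θ_sq, g.map_α_neg σ hx, g.map_β_neg σ hy,
    g.map_γ σ (by rw [map_mul, hx, hy]; ring), mul_pow, g.θ_sq', div_pow, div_mul_eq_mul_div,
    eq_div_iff (pow_ne_zero 2 this)]
  linear_combination (g.δ : M) * g.α' * g.β * g.γ * (g.β_mul - a * g.α_mul -
    g.α * g.α' * g.x_sq)

/-- The sign of `σ θ` for an automorphism negating `y` and `z`, in multiplicative form. -/
lemma map_θ_of_neg_yz (hx : σ g.x = g.x) (hy : σ g.y = -g.y) :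
    σ g.θ = g.β' * g.γ' / (g.t * (g.x * g.z)) * g.θ ∨
      σ g.θ = -(g.β' * g.γ' / (g.t * (g.x * g.z)) * g.θ) := by
  have h1 := g.θ_ne
  have h2 := g.x_ne
  have h3 := g.z_ne
  have h4 := g.t_ne'
  have key : g.β' * g.γ' / (g.t * (g.x * g.z)) * g.θ = g.δ * g.t * g.α * (g.x * g.z) / g.θ := by
    rw [eq_div_iff h1, mul_assoc, ← sq, g.θ_sq', div_mul_eq_mul_div,
      div_eq_iff (mul_ne_zero h4 (mul_ne_zero h2 h3))]
    linear_combination (g.δ : M) * g.α * (g.β_mul * g.γ * g.γ' + g.t * a * g.γ_mul -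
      g.t ^ 2 * (g.x_sq * g.z ^ 2 + a * g.z_sq))
  rw [key]
  exact g.map_θ_neg_right σ hx hy

/-- σ multiplies θ by ±λ with λ = α'x/β, and λ · σ(λ) = −(αα')a/(ββ') = −1. The unknown sign occurs
twice and cancels. This is what the norm ta of β is for. -/
lemma map_map_θ_of_neg_neg (hx : σ g.x = -g.x) (hy : σ g.y = -g.y) : σ (σ g.θ) = -g.θ := by
  have h2 := g.β_ne
  have h2' := g.β'_ne
  have hl : σ (g.α' * g.x / g.β) * (g.α' * g.x / g.β) = -1 := by
    rw [map_div₀, map_mul, g.map_α'_neg σ hx, hx, g.map_β_neg σ hy]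
    field_simp
    linear_combination -(g.x ^ 2) * g.α_mul + g.β_mul - g.t * g.x_sq
  rcases g.map_θ_neg_neg σ hx hy with h | h
  · rw [h, map_mul, h]; linear_combination g.θ * hl
  · rw [h, map_neg, map_mul, h]; linear_combination g.θ * hl

/-- As before, with multiplier ξ = β'γ'/(txz) and ξ · σ(ξ) = −(ββ')(γγ')/(t²ac) = −1. -/
lemma map_map_θ_of_neg_yz (hx : σ g.x = g.x) (hy : σ g.y = -g.y) (hz : σ g.z = -g.z) :
    σ (σ g.θ) = -g.θ := by
  have h2 := g.x_ne
  have h3 := g.z_ne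
  have h4 := g.t_ne'
  have hl : σ (g.β' * g.γ' / (g.t * (g.x * g.z))) * (g.β' * g.γ' / (g.t * (g.x * g.z))) = -1 := by
    rw [map_div₀, map_mul, map_mul, map_mul, g.map_β'_neg σ hy,
      g.map_γ'_neg σ (by rw [map_mul, hx, hy]; ring), hx, hz, map_ratCast]
    field_simp
    linear_combination -(g.γ * g.γ') * g.β_mul - g.t * a * g.γ_mul +
      g.t ^ 2 * (g.x_sq * g.z ^ 2 + a * g.z_sq)
  rcases g.map_θ_of_neg_yz σ hx hy with h | h
  · rw [h, map_mul, h]; linear_combination g.θ * hl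
  · rw [h, map_neg, map_mul, h]; linear_combination g.θ * hl

/-- With the multipliers λ = α'x/β of σ and ξ = β'γ'/(txz) of τ, one has σ(ξ)λ = −α'γ'/(tz) and
τ(λ)ξ = α'γ'/(tz); the unknown signs occur once on each side. -/
lemma map_map_θ_comm {τ : F} (hx : σ g.x = -g.x) (hy : σ g.y = -g.y) (hz : σ g.z = g.z)
    (hx' : τ g.x = g.x) (hy' : τ g.y = -g.y) : σ (τ g.θ) = -τ (σ g.θ) := by
  have h2 := g.x_ne
  have h3 := g.z_ne
  have h4 := g.t_ne'
  have h5 := g.β_ne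
  have h6 := g.β'_ne
  have h7 := g.γ'_ne
  have h8 := g.α'_ne
  have hl : σ (g.β' * g.γ' / (g.t * (g.x * g.z))) * (g.α' * g.x / g.β) =
      - (τ (g.α' * g.x / g.β) * (g.β' * g.γ' / (g.t * (g.x * g.z)))) := by
    rw [map_div₀, map_mul, map_mul, map_mul, g.map_β'_neg σ hy,
      g.map_γ' σ (by rw [map_mul, hx, hy]; ring), hx, hz, map_ratCast, map_div₀, map_mul,
      g.map_α' τ hx', hx', g.map_β_neg τ hy']
    field_simp
  rcases g.map_θ_of_neg_yz τ hx' hy' with h | h <;> rcases g.map_θ_neg_neg σ hx hy with h' | h' <;>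
    rw [h, h'] <;> simp only [map_neg, map_mul (f := σ), map_mul (f := τ), h, h'] <;>
    first | linear_combination g.θ * hl | linear_combination -g.θ * hl

end Conj

end H8Generators

/-! ### Recognizing the quaternion group. -/

section Quaternion

variable {G : Type*} [Group G]

/-- Recognition of the quaternion group by generators and relations. -/
lemma nonempty_mulEquiv_quaternionGroup {I J : G} (hI : I ^ 4 = 1) (hI2 : I * I ≠ 1)
    (hJ : J * J = I * I) (hIJ : I * J * I = J) (hne : ∀ n : ℕ, J ≠ I ^ n)
    (hsurj : ∀ g : G, ∃ n : ℕ, g = I ^ n ∨ g = J * I ^ n) :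
    Nonempty (G ≃* QuaternionGroup 2) := by
  have hord : orderOf I = 4 := by
    have := orderOf_eq_prime_pow (p := 2) (n := 1) (x := I) (by simpa [sq] using hI2)
      (by simpa using hI)
    simpa using this
  have hconj : ∀ n : ℕ, I ^ n * J * I ^ n = J := by
    intro n
    induction n with
    | zero => simp
    | succ n ih =>
      calc I ^ (n + 1) * J * I ^ (n + 1) = (I ^ n * I) * J * (I * I ^ n) := by
            rw [← pow_succ, ← pow_succ']
        _ = I ^ n * (I * J * I) * I ^ n := by simp only [mul_assoc]
        _ = J := by rw [hIJ, ih]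
  let e : ZMod (2 * 2) → G := fun i ↦ I ^ i.val
  have he_add : ∀ i j, e (i + j) = e i * e j := by
    intro i j
    simp only [e]
    rw [ZMod.val_add, ← pow_add, ← pow_mod_orderOf I (i.val + j.val), hord]
  have he_inj : Function.Injective e := by
    intro i j hij
    have := pow_inj_mod.mp hij
    rw [hord] at this
    apply ZMod.val_injective
    rwa [Nat.mod_eq_of_lt (ZMod.val_lt i), Nat.mod_eq_of_lt (ZMod.val_lt j)] at this
  have he_zero : e 0 = 1 := by simp [e]
  have he_sub : ∀ i j, e (j - i) = (e i)⁻¹ * e j := by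
    intro i j
    rw [eq_inv_mul_iff_mul_eq, ← he_add, add_sub_cancel]
  have he_J : ∀ i, e i * J = J * (e i)⁻¹ := by
    intro i
    rw [eq_mul_inv_iff_mul_eq]
    exact hconj _
  have he_comm : ∀ i j, e i * e j = e j * e i := by
    intro i j; rw [← he_add, ← he_add, add_comm]
  have he_two : e ((2 : ℕ) : ZMod (2 * 2)) = J * J := by
    change I ^ 2 = J * J
    rw [hJ, sq]
  let f : QuaternionGroup 2 → G := fun w ↦ match w with
    | .a i => e i
    | .xa i => J * e i
  have hmul : ∀ w w', f (w * w') = f w * f w' := by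
    rintro (i | i) (j | j)
    · simp only [QuaternionGroup.a_mul_a, f, he_add]
    · simp only [QuaternionGroup.a_mul_xa, f, he_sub]
      rw [← mul_assoc (e i), he_J]; simp only [mul_assoc]
    · simp only [QuaternionGroup.xa_mul_a, f, he_add, mul_assoc]
    · simp only [QuaternionGroup.xa_mul_xa, f, he_sub, he_add, he_two]
      rw [mul_assoc J (e i), ← mul_assoc (e i), he_J]
      have h1 : (e i)⁻¹ * (J * J) = (J * J) * (e i)⁻¹ := by
        rw [← he_two, inv_mul_eq_iff_eq_mul, ← mul_assoc, he_comm, mul_assoc, mul_inv_cancel,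
          mul_one]
      rw [← mul_assoc, h1]; simp only [mul_assoc]
  have haux : ∀ i j, e i ≠ J * e j := by
    intro i j h
    refine hne (i - j).val ?_
    change J = e (i - j)
    rw [sub_eq_add_neg, he_add, h, mul_assoc, ← he_add, add_neg_cancel, he_zero, mul_one]
  have hinj : Function.Injective f := by
    rintro (i | i) (j | j) h
    · exact congrArg _ (he_inj h)
    · exact absurd h (haux i j)
    · exact absurd h.symm (haux j i)
    · exact congrArg _ (he_inj (mul_left_cancel h))
  have hsurj' : Function.Surjective f := by
    intro g
    have hpow : ∀ n : ℕ, I ^ n = e (n : ZMod (2 * 2)) := by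
      intro n
      simp only [e]
      rw [ZMod.val_natCast, show 2 * 2 = orderOf I from hord.symm, pow_mod_orderOf]
    obtain ⟨n, rfl | rfl⟩ := hsurj g
    · exact ⟨.a n, (hpow n).symm⟩
    · exact ⟨.xa n, by rw [hpow]⟩
  exact ⟨(MulEquiv.ofBijective (MonoidHom.mk' f hmul) ⟨hinj, hsurj'⟩).symm⟩

end Quaternion

/-! ### The Galois group of M/k and the normality of M/ℚ. -/

section Galois

open IntermediateField

variable {a b c : ℤ}

namespace H8Generators

section AlgEquiv

variable {k M : Type*} [Field k] [NumberField k] [Field M] [NumberField M] [Algebra k M]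
  (g : H8Generators a b c M)

lemma algEquiv_ext {R : Type*} [Field R] [Algebra R M] [CharZero R]
    (htop : adjoin ℚ {g.x, g.y, g.z, g.θ} = ⊤) {σ τ : M ≃ₐ[R] M}
    (hx : σ g.x = τ g.x) (hy : σ g.y = τ g.y) (hz : σ g.z = τ g.z) (hθ : σ g.θ = τ g.θ) :
    σ = τ := by
  let σ' : M →ₐ[ℚ] M := (σ : M →+* M).toRatAlgHom
  let τ' : M →ₐ[ℚ] M := (τ : M →+* M).toRatAlgHom
  have h : σ' = τ' := by
    ext w
    have hw : w ∈ adjoin ℚ {g.x, g.y, g.z, g.θ} := htop ▸ mem_top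
    induction hw using adjoin_induction with
    | mem w hw =>
      rcases hw with rfl | rfl | rfl | rfl
      exacts [hx, hy, hz, hθ]
    | algebraMap r => simp
    | add _ _ _ _ h1 h2 => rw [map_add, map_add, h1, h2]
    | inv _ _ h1 => rw [map_inv₀, map_inv₀, h1]
    | mul _ _ _ _ h1 h2 => rw [map_mul, map_mul, h1, h2]
  ext w
  exact DFunLike.congr_fun h w

/-- A rational integer that becomes a square in `ℚ(√m)` is a square up to a factor `m`. -/
lemma _root_.isSquare_or_isSquare_mul_of_quadratic {k : Type*} [Field k] [NumberField k]
    (hk : Module.finrank ℚ k = 2) {m n : ℤ} {κ : k} (hκ : κ ^ 2 = m) (hm : ¬ IsSquare m)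
    (hn : IsSquare (n : k)) : IsSquare n ∨ IsSquare (n * m) := by
  obtain ⟨w, hw⟩ := hn
  obtain ⟨u, v, rfl⟩ := exists_ratCast_add_mul hk hκ hm w
  have key : ((n : ℚ) : k) + (0 : ℚ) * κ = ((u ^ 2 + m * v ^ 2 : ℚ) : k) + (2 * u * v : ℚ) * κ := by
    push_cast
    rw [hw]
    linear_combination (v : k) ^ 2 * hκ
  obtain ⟨h1, h2⟩ := coords_unique hκ hm key
  have huv : u = 0 ∨ v = 0 := by
    have : u * v = 0 := by linarith
    exact mul_eq_zero.mp this
  rcases huv with rfl | rfl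
  · right
    rw [← Rat.isSquare_intCast_iff]
    exact ⟨m * v, by push_cast; rw [h1]; ring⟩
  · left
    rw [← Rat.isSquare_intCast_iff]
    exact ⟨u, by rw [h1]; ring⟩

lemma _root_.isSquare_of_isSquare_sq_mul {n r : ℤ} (hr : r ≠ 0) (h : IsSquare (r ^ 2 * n)) :
    IsSquare n := by
  rw [← Rat.isSquare_intCast_iff] at h ⊢
  obtain ⟨s, hs⟩ := h
  have hr' : (r : ℚ) ≠ 0 := by exact_mod_cast hr
  refine ⟨s / r, ?_⟩
  push_cast at hs
  field_simp
  linarith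

variable [IsGalois k M] {κ : k}

/-- None of a, b, ab becomes a square in k = ℚ(√(abc)), so each of x, y, xy is negated by some
automorphism over k. Products of these realize the required signs on x and y, and the sign on z
follows because xyz lies in k. -/
lemma exists_signs (g : H8Generators a b c M) (h : IsH8Radicands a b c) (hk : Module.finrank ℚ k = 2)
    (hκ : κ ^ 2 = (a * b * c : ℤ)) (hκM : algebraMap k M κ = g.x * g.y * g.z) :
    (∃ σ : M ≃ₐ[k] M, σ g.x = -g.x ∧ σ g.y = -g.y ∧ σ g.z = g.z) ∧
      ∃ σ : M ≃ₐ[k] M, σ g.x = g.x ∧ σ g.y = -g.y ∧ σ g.z = -g.z := by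
  have hns := h.not_isSquare₁₂₃
  have move : ∀ (n : ℤ) (w : M), w ^ 2 = n → ¬ IsSquare n → ¬ IsSquare (n * (a * b * c)) →
      ∃ σ : M ≃ₐ[k] M, σ w = -w := by
    intro n w hw h1 h2
    refine exists_algEquiv_neg (m := (n : k)) (by simpa using hw) fun hsq ↦ ?_
    exact (isSquare_or_isSquare_mul_of_quadratic hk hκ hns hsq).elim h1 h2
  obtain ⟨σ₁, h₁⟩ := move a g.x g.x_sq h.not_isSquare₁ fun hs ↦ h.not_isSquare₂₃
    (isSquare_of_isSquare_sq_mul g.a_ne (by convert hs using 1; ring))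
  obtain ⟨σ₂, h₂⟩ := move b g.y g.y_sq h.not_isSquare₂ fun hs ↦ h.not_isSquare₁₃
    (isSquare_of_isSquare_sq_mul g.b_ne (by convert hs using 1; ring))
  obtain ⟨σ₃, h₃⟩ := move (a * b) (g.x * g.y) (by push_cast; rw [mul_pow, g.x_sq, g.y_sq])
    h.not_isSquare₁₂ fun hs ↦ h.not_isSquare₃
    (isSquare_of_isSquare_sq_mul (mul_ne_zero g.a_ne g.b_ne) (by convert hs using 1; ring))
  have hz : ∀ σ : M ≃ₐ[k] M, σ g.x * σ g.y * σ g.z = g.x * g.y * g.z := fun σ ↦ by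
    rw [← map_mul, ← map_mul, ← hκM, AlgEquiv.commutes]
  have hx0 := g.x_ne
  have hy0 := g.y_ne
  have hxy0 := mul_ne_zero hx0 hy0
  have key : (∃ σ : M ≃ₐ[k] M, σ g.x = -g.x ∧ σ g.y = -g.y) ∧
      ∃ σ : M ≃ₐ[k] M, σ g.x = g.x ∧ σ g.y = -g.y := by
    rw [map_mul] at h₃
    rcases g.map_x σ₃ with h3x | h3x
    · have h3y : σ₃ g.y = -g.y := mul_left_cancel₀ hx0 (by rw [h3x] at h₃; rw [h₃]; ring)
      refine ⟨?_, σ₃, h3x, h3y⟩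
      rcases g.map_y σ₁ with h1y | h1y
      · exact ⟨σ₁ * σ₃, by simp [h3x, h₁], by simp [h3y, h1y]⟩
      · exact ⟨σ₁, h₁, h1y⟩
    · have h3y : σ₃ g.y = g.y := mul_left_cancel₀ (neg_ne_zero.mpr hx0)
        (by rw [h3x] at h₃; rw [h₃]; ring)
      rcases g.map_x σ₂ with h2x | h2x
      · exact ⟨⟨σ₂ * σ₃, by simp [h3x, h2x], by simp [h3y, h₂]⟩, σ₂, h2x, h₂⟩
      · exact ⟨⟨σ₂, h2x, h₂⟩, σ₂ * σ₃, by simp [h3x, h2x], by simp [h3y, h₂]⟩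
  obtain ⟨⟨σ, h1, h2⟩, τ, h3, h4⟩ := key
  refine ⟨⟨σ, h1, h2, mul_left_cancel₀ hxy0 ?_⟩, τ, h3, h4, mul_left_cancel₀ hxy0 ?_⟩
  · have := hz σ; rw [h1, h2] at this; linear_combination this
  · have := hz τ; rw [h3, h4] at this; linear_combination -this

/-- The Galois group of the field generated by `H8Generators` is the quaternion group. -/
theorem nonempty_galois_mulEquiv (h : IsH8Radicands a b c) (hk : Module.finrank ℚ k = 2)
    (hκ : κ ^ 2 = (a * b * c : ℤ)) (hκM : algebraMap k M κ = g.x * g.y * g.z)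
    (htop : adjoin ℚ {g.x, g.y, g.z, g.θ} = ⊤) :
    Nonempty ((M ≃ₐ[k] M) ≃* QuaternionGroup 2) := by
  obtain ⟨⟨I, hIx, hIy, hIz⟩, J, hJx, hJy, hJz⟩ := g.exists_signs h hk hκ hκM
  have hx0 := g.x_ne
  have hy0 := g.y_ne
  have hxy0 := mul_ne_zero hx0 hy0
  have ne_neg : ∀ {w : M}, w ≠ 0 → w ≠ -w := fun hw h ↦ hw (self_eq_neg.mp h)
  have hII : I (I g.θ) = -g.θ := g.map_map_θ_of_neg_neg I hIx hIy
  have hJJ : J (J g.θ) = -g.θ := g.map_map_θ_of_neg_yz J hJx hJy hJz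
  have hIJ : I (J g.θ) = -J (I g.θ) := g.map_map_θ_comm I hIx hIy hIz hJx hJy
  have hz : ∀ σ : M ≃ₐ[k] M, σ g.x * σ g.y * σ g.z = g.x * g.y * g.z := fun σ ↦ by
    rw [← map_mul, ← map_mul, ← hκM, AlgEquiv.commutes]
  -- J θ is a multiple of θ by an element of ℚ(x, y, z), which I² fixes.
  have hIIJ : I (I (J g.θ)) = -J g.θ := by
    rcases g.map_θ_of_neg_yz J hJx hJy with h' | h' <;>
    · have hfix : I (I (g.β' * g.γ' / (g.t * (g.x * g.z)))) = g.β' * g.γ' / (g.t * (g.x * g.z)) := by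
        simp [β', γ', hIx, hIy, hIz, sub_eq_add_neg]
      generalize g.β' * g.γ' / (g.t * (g.x * g.z)) = l at *
      rw [h']
      simp only [map_neg, map_mul, hfix, hII]
      ring
  have hIne : I * I ≠ 1 := fun h1 ↦ ne_neg g.θ_ne (by
    rw [← hII]; simpa using (DFunLike.congr_fun h1 g.θ).symm)
  -- Fixing x and y implies fixing z, and only the sign of θ is left. So an automorphism is
  -- determined, up to I², by its signs on x and y.
  have hfixed : ∀ σ : M ≃ₐ[k] M, σ g.x = g.x → σ g.y = g.y → σ = 1 ∨ σ = I * I := by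
    intro σ h1 h2
    have h3 : σ g.z = g.z := mul_left_cancel₀ hxy0 (by have := hz σ; rwa [h1, h2] at this)
    rcases g.map_θ_of_fixed σ h1 h2 with h4 | h4
    · left; exact g.algEquiv_ext htop h1 h2 h3 h4
    · right
      refine g.algEquiv_ext htop ?_ ?_ ?_ ?_
      · simp [h1, hIx]
      · simp [h2, hIy]
      · simp [h3, hIz]
      · rw [h4, AlgEquiv.mul_apply, hII]
  have hJ2 : J * J = I * I := by
    refine g.algEquiv_ext htop ?_ ?_ ?_ ?_
    · simp [hJx, hIx]
    · simp [hJy, hIy]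
    · simp [hJz, hIz]
    · rw [AlgEquiv.mul_apply, AlgEquiv.mul_apply, hII, hJJ]
  have hpowx : ∀ n : ℕ, ((I ^ n) g.x = g.x ∧ (I ^ n) g.y = g.y) ∨
      ((I ^ n) g.x = -g.x ∧ (I ^ n) g.y = -g.y) := by
    intro n
    induction n with
    | zero => left; simp
    | succ n ih =>
      rw [pow_succ]
      rcases ih with ⟨h1, h2⟩ | ⟨h1, h2⟩
      · right; simp only [AlgEquiv.mul_apply, hIx, hIy, map_neg, h1, h2, and_self]
      · left; simp only [AlgEquiv.mul_apply, hIx, hIy, map_neg, h1, h2, neg_neg, and_self]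
  have hI4 : I ^ 4 = 1 := by
    have e : I ^ 4 = I * I * (I * I) := by rw [← sq, ← sq, ← pow_mul]
    rw [e]
    refine g.algEquiv_ext htop ?_ ?_ ?_ ?_
    · simp [hIx]
    · simp [hIy]
    · simp [hIz]
    · simp [hII]
  refine nonempty_mulEquiv_quaternionGroup (I := I) (J := J) hI4 hIne hJ2 ?_ ?_ ?_
  · refine g.algEquiv_ext htop ?_ ?_ ?_ ?_
    · simp [hJx, hIx]
    · simp [hJy, hIy]
    · simp [hJz, hIz]
    · rw [AlgEquiv.mul_apply, AlgEquiv.mul_apply, ← neg_neg (J (I g.θ)), ← hIJ, map_neg, hIIJ,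
        neg_neg]
  · intro n hn
    rcases hpowx n with ⟨h1, h2⟩ | ⟨h1, h2⟩
    · rw [← hn, hJy] at h2; exact ne_neg hy0 h2.symm
    · rw [← hn, hJx] at h1; exact ne_neg hx0 h1
  · have hadj : ∀ σ τ : M ≃ₐ[k] M, τ⁻¹ * σ = 1 ∨ τ⁻¹ * σ = I * I → σ = τ ∨ σ = τ * I ^ 2 := by
      intro σ τ h
      rcases h with h | h
      · left; exact (inv_mul_eq_one.mp h).symm
      · right; rw [sq, ← h]; group
    have hinv : ∀ (τ : M ≃ₐ[k] M) (v w : M), τ v = w → τ⁻¹ w = v := by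
      rintro τ v w rfl
      exact AlgEquiv.symm_apply_apply τ v
    intro σ
    have hfix : ∀ τ : M ≃ₐ[k] M, τ g.x = σ g.x → τ g.y = σ g.y → σ = τ ∨ σ = τ * I ^ 2 :=
      fun τ h1 h2 ↦ hadj σ τ (hfixed _ (by rw [AlgEquiv.mul_apply, hinv τ _ _ h1])
        (by rw [AlgEquiv.mul_apply, hinv τ _ _ h2]))
    rcases g.map_x σ with h1 | h1 <;> rcases g.map_y σ with h2 | h2
    · rcases hfix 1 (by simp [h1]) (by simp [h2]) with h | h
      · exact ⟨0, Or.inl (by simpa using h)⟩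
      · exact ⟨2, Or.inl (by simpa using h)⟩
    · rcases hfix J (by rw [h1, hJx]) (by rw [h2, hJy]) with h | h
      · exact ⟨0, Or.inr (by simpa using h)⟩
      · exact ⟨2, Or.inr h⟩
    · rcases hfix (J * I) (by simp [h1, hJx, hIx]) (by simp [h2, hJy, hIy]) with h | h
      · exact ⟨1, Or.inr (by simpa using h)⟩
      · exact ⟨3, Or.inr (by rw [h]; group)⟩
    · rcases hfix I (by rw [h1, hIx]) (by rw [h2, hIy]) with h | h
      · exact ⟨1, Or.inl (by simpa using h)⟩
      · exact ⟨3, Or.inl (by rw [h]; group)⟩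

end AlgEquiv

section Normal

variable {Ω : Type*} [Field Ω] [CharZero Ω] (g : H8Generators a b c Ω)

lemma map_mem_adjoin (σ : Ω →ₐ[ℚ] Ω) {w : Ω} (hw : w ∈ ({g.x, g.y, g.z, g.θ} : Set Ω)) :
    σ w ∈ adjoin ℚ {g.x, g.y, g.z, g.θ} := by
  set K := adjoin ℚ {g.x, g.y, g.z, g.θ} with hK
  have hx : g.x ∈ K := subset_adjoin _ _ (by simp)
  have hy : g.y ∈ K := subset_adjoin _ _ (by simp)
  have hz : g.z ∈ K := subset_adjoin _ _ (by simp)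
  have hθ : g.θ ∈ K := subset_adjoin _ _ (by simp)
  have hrat : ∀ r : ℚ, (r : Ω) ∈ K := fun r ↦ by
    simp
  have pm : ∀ {v v' : Ω}, v' ∈ K → v = v' ∨ v = -v' → v ∈ K := by
    rintro v v' h (rfl | rfl)
    exacts [h, neg_mem h]
  have hα : g.α ∈ K := add_mem (hrat _) (mul_mem (hrat _) hx)
  have hα' : g.α' ∈ K := sub_mem (hrat _) (mul_mem (hrat _) hx)
  have hβ : g.β ∈ K := add_mem (hrat _) (mul_mem (hrat _) hy)
  rcases hw with rfl | rfl | rfl | rfl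
  · exact pm hx (g.map_x σ)
  · exact pm hy (g.map_y σ)
  · exact pm hz (g.map_z σ)
  · rcases g.map_x σ with h1 | h1 <;> rcases g.map_y σ with h2 | h2
    · exact pm hθ (g.map_θ_of_fixed σ h1 h2)
    · exact pm (div_mem (mul_mem (mul_mem (mul_mem (hrat _) (hrat _)) hα) (mul_mem hx hz)) hθ)
        (g.map_θ_neg_right σ h1 h2)
    · exact pm (div_mem (mul_mem (mul_mem (mul_mem (hrat _) (hrat _)) hβ) hz) hθ)
        (g.map_θ_neg_left σ h1 h2)
    · exact pm (mul_mem (div_mem (mul_mem hα' hx) hβ) hθ) (g.map_θ_neg_neg σ h1 h2)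

lemma normal_adjoin [Normal ℚ Ω] : Normal ℚ (adjoin ℚ {g.x, g.y, g.z, g.θ}) := by
  convert (normal_iff_forall_map_le (K := adjoin ℚ {g.x, g.y, g.z, g.θ})).mpr fun σ ↦ ?_
  · exact Subsingleton.elim _ _
  · rw [adjoin_map, adjoin_le_iff]
    rintro _ ⟨w, hw, rfl⟩
    exact g.map_mem_adjoin σ hw

end Normal

end H8Generators

end Galois

/-! ### Inertia groups and valuations. -/

section Inertia

open NumberField IsDedekindDomain

/-- The order of the inertia group is the ramification index. -/
lemma card_inertia_eq_ramificationIdx (A : Type*) {k M : Type*} [CommRing A] [IsDedekindDomain A]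
    [CharZero A] [Module.Finite ℤ A] [Field k] [Field M] [NumberField M] [Algebra k M]
    [Algebra A k] [IsFractionRing A k] [Algebra A (𝓞 M)] [Algebra A M] [IsScalarTower A (𝓞 M) M]
    [IsScalarTower A k M] [FiniteDimensional k M] [IsGalois k M]
    (Q : Ideal (𝓞 M)) [Q.IsMaximal] :
    Nat.card (Q.inertia (M ≃ₐ[k] M)) = Q.ramificationIdx A := by
  have : Module.Finite A (𝓞 M) := Module.Finite.of_restrictScalars_finite ℤ A _
  have : FaithfulSMul A M := by
    rw [faithfulSMul_iff_algebraMap_injective, IsScalarTower.algebraMap_eq A k M]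
    exact (algebraMap k M).injective.comp (IsFractionRing.injective A k)
  have : Module.IsTorsionFree A (𝓞 M) := by
    rw [Module.isTorsionFree_iff_faithfulSMul]
    exact .tower_bot A (𝓞 M) M
  have := IsGaloisGroup.of_isFractionRing Gal(M/k) A (𝓞 M) k M
  rw [← Ideal.ramificationIdxIn_eq_ramificationIdx (Q.under A) _ Gal(M/k),
    ← Ideal.card_inertia_eq_ramificationIdxIn (G := Gal(M/k)) (Q.under A) Q]

/-- A maximal ideal is unramified over the base exactly when its inertia group is trivial. -/
lemma isUnramifiedAt_ringOfIntegers_iff {k M : Type*} [Field k] [NumberField k]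
    [Field M] [NumberField M] [Algebra k M] [IsGalois k M] (Q : Ideal (𝓞 M)) [Q.IsMaximal] :
    Algebra.IsUnramifiedAt (𝓞 k) Q ↔ Q.inertia (M ≃ₐ[k] M) = ⊥ := by
  rw [← Ideal.ramificationIdx_eq_one_iff, ← card_inertia_eq_ramificationIdx (𝓞 k) (k := k) Q,
    Subgroup.card_eq_one]

variable {M : Type*} [Field M] [NumberField M]

/-- If `σ` acts as `r ↦ r ^ n` modulo a prime ideal, then it does so on the residue
field of the local ring. -/
lemma valuation_smul_sub_pow_lt_one {G : Type*} [Group G] [MulSemiringAction G M]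
    (v : HeightOneSpectrum (𝓞 M)) {σ : G} {n : ℕ}
    (hσ : ∀ r : 𝓞 M, σ • r - r ^ n ∈ v.asIdeal) {w : M}
    (hw : v.valuation M w ≤ 1) : v.valuation M (σ • w - w ^ n) < 1 := by
  -- Write w = r/s with s outside the prime; σ • s is outside as well, being s ^ n modulo the prime.
  obtain ⟨r, s, hs⟩ := v.exists_primeCompl_mul_eq_of_integer w hw
  have hs0 : v.valuation M ((s : 𝓞 M) : M) = 1 := (v.valuation_eq_one_iff_notMem).mpr s.2
  have hsσ : v.valuation M ((σ • (s : 𝓞 M) : 𝓞 M) : M) = 1 := by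
    rw [HeightOneSpectrum.valuation_eq_one_iff_notMem]
    intro h
    exact s.2 (v.isPrime.mem_of_pow_mem n ((v.asIdeal.sub_mem_iff_right h).mp (hσ s)))
  have hs1 : ((s : 𝓞 M) : M) ≠ 0 := fun h ↦ by simp [h] at hs0
  have hsσ1 : ((σ • (s : 𝓞 M) : 𝓞 M) : M) ≠ 0 := fun h ↦ by simp [h] at hsσ
  have hs' : w * ((s : 𝓞 M) : M) = (r : M) := hs
  have hσs : σ • w * σ • ((s : 𝓞 M) : M) = σ • (r : M) := by rw [← smul_mul', hs']
  have e : (r : M) ^ n = w ^ n * ((s : 𝓞 M) : M) ^ n := by rw [← mul_pow, hs']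
  have key : (σ • w - w ^ n) * (((σ • (s : 𝓞 M) : 𝓞 M) : M) * ((s : 𝓞 M) : M) ^ n) =
      (((σ • r - r ^ n) * (s : 𝓞 M) ^ n - r ^ n * (σ • (s : 𝓞 M) - (s : 𝓞 M) ^ n) : 𝓞 M) : M) := by
    push_cast
    change (σ • w - w ^ n) * (σ • ((s : 𝓞 M) : M) * ((s : 𝓞 M) : M) ^ n) =
      (σ • (r : M) - (r : M) ^ n) * _ - (r : M) ^ n * (σ • ((s : 𝓞 M) : M) - _)
    linear_combination ((s : 𝓞 M) : M) ^ n * hσs + σ • ((s : 𝓞 M) : M) * e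
  have h2 : v.valuation M ((σ • w - w ^ n) *
      (((σ • (s : 𝓞 M) : 𝓞 M) : M) * ((s : 𝓞 M) : M) ^ n)) < 1 := by
    rw [key, HeightOneSpectrum.valuation_lt_one_iff_mem]
    exact sub_mem (Ideal.mul_mem_right _ _ (hσ _)) (Ideal.mul_mem_left _ _ (hσ _))
  simpa [hs0, hsσ] using h2

/-- An element of the inertia group acts trivially on the residue field of the local ring. -/
lemma valuation_smul_sub_lt_one {G : Type*} [Group G] [MulSemiringAction G M]
    (v : HeightOneSpectrum (𝓞 M)) {σ : G} (hσ : σ ∈ v.asIdeal.inertia G) {w : M}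
    (hw : v.valuation M w ≤ 1) : v.valuation M (σ • w - w) < 1 := by
  simpa using valuation_smul_sub_pow_lt_one v (n := 1) (fun r ↦ by simpa using hσ r) hw

section RingHom

variable {E : Type*} [Field E] [NumberField E] {f : E →+* M} {v : HeightOneSpectrum (𝓞 E)}
  {V : HeightOneSpectrum (𝓞 M)}

/-- Only integrality is compared, not the values themselves, so `f` may be an automorphism as well
as the inclusion of a subfield over which `V` ramifies. Both occur below. -/
lemma valuation_map_le_one
    (hf : ∀ r : 𝓞 E, r ∈ v.asIdeal ↔ RingOfIntegers.mapRingHom f r ∈ V.asIdeal) {w : E}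
    (hw : v.valuation E w ≤ 1) : V.valuation M (f w) ≤ 1 := by
  obtain ⟨r, s, hs⟩ := v.exists_primeCompl_mul_eq_of_integer w hw
  have hs0 : V.valuation M (f (s : 𝓞 E)) = 1 :=
    (V.valuation_eq_one_iff_notMem (r := RingOfIntegers.mapRingHom f s)).mpr (mt (hf s).mpr s.2)
  have h2 : V.valuation M (f (r : E)) ≤ 1 := V.valuation_le_one (RingOfIntegers.mapRingHom f r)
  rwa [← show _ = (r : E) from hs, map_mul, map_mul,
    show V.valuation M (f (algebraMap _ E _)) = 1 from hs0, mul_one] at h2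

lemma valuation_map_eq_one
    (hf : ∀ r : 𝓞 E, r ∈ v.asIdeal ↔ RingOfIntegers.mapRingHom f r ∈ V.asIdeal) {w : E}
    (hw : v.valuation E w = 1) : V.valuation M (f w) = 1 := by
  refine le_antisymm (valuation_map_le_one hf hw.le) ?_
  have h := valuation_map_le_one hf (w := w⁻¹) (by simp [hw])
  have h0 : w ≠ 0 := fun h ↦ by simp [h] at hw
  rw [map_inv₀, map_inv₀] at h
  exact (inv_le_one₀ (by simpa [zero_lt_iff] using h0)).mp h

end RingHom

end Inertia

/-! ### Unramified fields: all values are powers of the value of p. -/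

section RationalValues

variable {M Γ : Type*} [Field M] [LinearOrderedCommGroupWithZero Γ]
  (v : Valuation M Γ)

lemma Valuation.map_intCast_le_one (n : ℤ) : v n ≤ 1 := by
  exact intCast_mem v.integer n

lemma Valuation.map_intCast_eq_one {p : ℕ} (hp : p.Prime) (hv : v p < 1) {n : ℤ}
    (hn : ¬ (p : ℤ) ∣ n) : v n = 1 := by
  have hc : IsCoprime (p : ℤ) n := (Nat.prime_iff_prime_int.mp hp).coprime_iff_not_dvd.mpr hn
  obtain ⟨r, s, h⟩ := hc
  refine le_antisymm (v.map_intCast_le_one n) ?_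
  by_contra! hlt
  have h1 : v ((r * p + s * n : ℤ) : M) < 1 := by
    push_cast
    refine v.map_add_lt ?_ ?_ <;> rw [map_mul]
    · exact (mul_le_of_le_one_left' (v.map_intCast_le_one r)).trans_lt hv
    · exact (mul_le_of_le_one_left' (v.map_intCast_le_one s)).trans_lt hlt
  simp [h] at h1

lemma Valuation.le_one_of_quadratic (v : Valuation M Γ) {r A B : M} (hA : v A ≤ 1) (hB : v B ≤ 1)
    (h : r ^ 2 = A * r - B) : v r ≤ 1 := by
  by_contra! hr
  have h1 : v (r ^ 2) ≤ v r := by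
    rw [h]
    exact v.map_sub_le (by rw [map_mul]; exact mul_le_of_le_one_left' hA) (hB.trans hr.le)
  rw [map_pow, sq] at h1
  exact hr.not_ge ((mul_le_iff_le_one_left (zero_lt_one.trans hr)).mp h1)

lemma Valuation.map_eq_one_of_sq {v : Valuation M Γ} {w : M} (h : v (w ^ 2) = 1) : v w = 1 := by
  rw [map_pow] at h
  exact (pow_eq_one_iff.mp h).resolve_right two_ne_zero

lemma Valuation.map_sqrt_eq_one (v : Valuation M Γ) {p : ℕ} (hp : p.Prime) (hv : v p < 1) {m : ℤ}
    (hpm : ¬ (p : ℤ) ∣ m) {x : M} (hx : x ^ 2 = m) : v x = 1 :=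
  map_eq_one_of_sq (by rw [hx]; exact v.map_intCast_eq_one hp hv hpm)

lemma Valuation.map_two_eq_one (v : Valuation M Γ) {p : ℕ} (hp : p.Prime) (hv : v p < 1)
    (hp2 : p ≠ 2) : v 2 = 1 := by
  have := v.map_intCast_eq_one hp hv (n := 2) fun h ↦
    hp2 ((Nat.prime_dvd_prime_iff_eq hp Nat.prime_two).mp (by exact_mod_cast h))
  exact_mod_cast this

variable [CharZero M]

/-- The nonzero elements of `K` have valuation a power of that of `p`. -/
def Valuation.IsUnramifiedOn (v : Valuation M Γ) (p : ℕ) (K : Subalgebra ℚ M) : Prop :=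
  ∀ w ∈ K, w ≠ 0 → ∃ n : ℤ, v w = v p ^ n

lemma Valuation.isUnramifiedOn_bot {p : ℕ} (hp : p.Prime) (hv : v p < 1) :
    v.IsUnramifiedOn p ⊥ := by
  have hint : ∀ n : ℤ, n ≠ 0 → ∃ m : ℕ, v n = v p ^ m := by
    intro n hn
    have hfin : FiniteMultiplicity (p : ℤ) n :=
      Int.finiteMultiplicity_iff.mpr ⟨by simpa using hp.ne_one, hn⟩
    obtain ⟨q, hnq, hq⟩ := hfin.exists_eq_pow_mul_and_not_dvd
    refine ⟨multiplicity (p : ℤ) n, ?_⟩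
    conv_lhs => rw [hnq]
    simp [v.map_intCast_eq_one hp hv hq]
  intro w hw hw0
  obtain ⟨r, rfl⟩ := Algebra.mem_bot.mp hw
  have hr : r ≠ 0 := by rintro rfl; simp at hw0
  obtain ⟨m, hm⟩ := hint r.num (by simpa using hr)
  obtain ⟨m', hm'⟩ := hint r.den (by simp)
  refine ⟨m - m', ?_⟩
  have hp0 : v p ≠ 0 := by simp [hp.ne_zero]
  rw [zpow_sub₀ hp0, zpow_natCast, zpow_natCast, ← hm, ← hm', ← map_div₀]
  congr 1
  push_cast
  simpa using (Rat.cast_def (K := M) r)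

/-- Values stay powers of `v p` after adjoining an integral quadratic element with unit
discriminant. -/
lemma Valuation.IsUnramifiedOn.exists_of_quadratic {v : Valuation M Γ} {p : ℕ} {K : Subalgebra ℚ M}
    (hK : v.IsUnramifiedOn p K) (hp : v p ≠ 0) {r r' : M} (hadd : r + r' ∈ K) (hmul : r * r' ∈ K)
    (hr : v r ≤ 1) (hr' : v r' ≤ 1) (hrr : v (r - r') = 1) {x y : M} (hx : x ∈ K) (hy : y ∈ K)
    (h0 : x + y * r ≠ 0) : ∃ n : ℤ, v (x + y * r) = v p ^ n := by
  by_cases hy0 : y = 0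
  · subst hy0
    simp only [zero_mul, add_zero] at h0 ⊢
    exact hK x hx h0
  obtain ⟨m, hm⟩ := hK y hy hy0
  have hvy : v y ≠ 0 := by simpa using hy0
  rcases lt_or_ge (v y) (v x) with hlt | hle
  · obtain ⟨n, hn⟩ := hK x hx (by rintro rfl; simp at hlt)
    refine ⟨n, ?_⟩
    rw [v.map_add_eq_of_lt_left, hn]
    rw [map_mul]
    exact (mul_le_of_le_one_right' hr).trans_lt hlt
  have hle1 : v (x + y * r) ≤ v y := v.map_add_le hle (by rw [map_mul]; exact mul_le_of_le_one_right' hr)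
  have hle2 : v (x + y * r') ≤ v y := v.map_add_le hle (by rw [map_mul]; exact mul_le_of_le_one_right' hr')
  have hdiff : v ((x + y * r) - (x + y * r')) = v y := by
    rw [show (x + y * r) - (x + y * r') = y * (r - r') by ring, map_mul, hrr, mul_one]
  -- If x + yr has a smaller value than y, then x + yr' has the value of y, because their difference
  -- y(r − r') does. The product of the two lies in K, so its value is known.
  rcases hle1.lt_or_eq with h1 | h1
  · have h2 : v (x + y * r') = v y := by
      refine le_antisymm hle2 (le_of_not_gt fun h2 ↦ ?_)
      exact (v.map_sub_lt h1 h2).ne hdiff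
    have hN : (x + y * r) * (x + y * r') ∈ K := by
      rw [show (x + y * r) * (x + y * r') = x * x + x * y * (r + r') + y * y * (r * r') by ring]
      exact add_mem (add_mem (mul_mem hx hx) (mul_mem (mul_mem hx hy) hadd))
        (mul_mem (mul_mem hy hy) hmul)
    have hr'0 : x + y * r' ≠ 0 := by rw [← v.ne_zero_iff, h2]; exact hvy
    obtain ⟨n, hn⟩ := hK _ hN (mul_ne_zero h0 hr'0)
    refine ⟨n - m, ?_⟩
    rw [zpow_sub₀ hp, ← hn, ← hm, map_mul, h2, mul_div_assoc, div_self hvy, mul_one]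
  · exact ⟨m, h1.trans hm⟩

/-- Values stay powers of `v p` after adjoining a square root of an integer `m` if `p` does not
divide the discriminant. -/
lemma Valuation.IsUnramifiedOn.exists_of_sqrt {v : Valuation M Γ} {p : ℕ} (hp : p.Prime)
    (hv : v p < 1) {K : Subalgebra ℚ M} (hK : v.IsUnramifiedOn p K) {m : ℤ} {x : M}
    (hx : x ^ 2 = m) (hpm : ¬ (p : ℤ) ∣ m) (hm : m % 4 = 1 ∨ p ≠ 2) {u w : M} (hu : u ∈ K)
    (hw : w ∈ K) (h0 : u + w * x ≠ 0) : ∃ n : ℤ, v (u + w * x) = v p ^ n := by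
  have hvx := v.map_sqrt_eq_one hp hv hpm hx
  have hp0 : v p ≠ 0 := by simp [hp.ne_zero]
  have hint : ∀ n : ℤ, (n : M) ∈ K := fun n ↦ intCast_mem K n
  -- The integral generator is (1 + x)/2, whose conjugates differ by the unit x, or x itself, whose
  -- conjugates differ by 2x.
  rcases hm with hm | hm
  · obtain ⟨n, hn⟩ : (4 : ℤ) ∣ m - 1 := by omega
    have hn' : (m : M) - 1 = 4 * n := by exact_mod_cast congrArg (Int.cast (R := M)) hn
    have e1 : ((1 + x) / 2) * ((1 - x) / 2) = ((-n : ℤ) : M) := by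
      push_cast
      linear_combination (-1 / 4 : M) * hx - (1 / 4 : M) * hn'
    have e2 : u + w * x = (u - w) + (2 * w) * ((1 + x) / 2) := by ring
    rw [e2] at h0 ⊢
    refine hK.exists_of_quadratic hp0 (r := (1 + x) / 2) (r' := (1 - x) / 2) ?_ ?_ ?_ ?_ ?_
      (sub_mem hu hw) (mul_mem (by exact_mod_cast hint 2) hw) h0
    · rw [show (1 + x) / 2 + (1 - x) / 2 = 1 by ring]
      exact one_mem K
    · rw [e1]
      exact hint _
    · refine v.le_one_of_quadratic (A := 1) (B := (-n : ℤ)) (by simp) (v.map_intCast_le_one _) ?_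
      rw [← e1]; ring
    · refine v.le_one_of_quadratic (A := 1) (B := (-n : ℤ)) (by simp) (v.map_intCast_le_one _) ?_
      rw [← e1]; ring
    · rw [show (1 + x) / 2 - (1 - x) / 2 = x by ring, hvx]
  · refine hK.exists_of_quadratic hp0 (r := x) (r' := -x) (by simp) ?_ hvx.le (by simp [hvx]) ?_
      hu hw h0
    · rw [show x * -x = ((-m : ℤ) : M) by push_cast; rw [← hx]; ring]
      exact hint _
    · rw [show x - -x = 2 * x by ring, map_mul, hvx, mul_one, v.map_two_eq_one hp hv hm]

lemma Algebra.exists_of_mem_adjoin_sqrt {m : ℤ} {x w : M} (hx : x ^ 2 = m)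
    (hw : w ∈ Algebra.adjoin ℚ {x}) : ∃ q r : ℚ, w = q + r * x := by
  induction hw using Algebra.adjoin_induction with
  | mem w hw => exact ⟨0, 1, by simp_all⟩
  | algebraMap q => exact ⟨q, 0, by simp⟩
  | add _ _ _ _ h1 h2 =>
    obtain ⟨q, r, rfl⟩ := h1
    obtain ⟨q', r', rfl⟩ := h2
    exact ⟨q + q', r + r', by push_cast; ring⟩
  | mul _ _ _ _ h1 h2 =>
    obtain ⟨q, r, rfl⟩ := h1
    obtain ⟨q', r', rfl⟩ := h2
    exact ⟨q * q' + m * r * r', q * r' + q' * r, by push_cast; linear_combination (r * r' : M) * hx⟩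

lemma Valuation.isUnramifiedOn_adjoin_sqrt {v : Valuation M Γ} {p : ℕ} (hp : p.Prime)
    (hv : v p < 1) {m : ℤ} {x : M} (hx : x ^ 2 = m) (hpm : ¬ (p : ℤ) ∣ m) (hm : m % 4 = 1 ∨ p ≠ 2) :
    v.IsUnramifiedOn p (Algebra.adjoin ℚ {x}) := by
  intro w hw h0
  obtain ⟨q, r, rfl⟩ := Algebra.exists_of_mem_adjoin_sqrt hx hw
  refine (v.isUnramifiedOn_bot hp hv).exists_of_sqrt hp hv hx hpm hm ?_ ?_ h0
  · exact ⟨q, by simp⟩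
  · exact ⟨r, by simp⟩

end RationalValues

/-! ### Square roots of elements that are squares modulo 4. -/

section Primary

variable {M Γ : Type*} [Field M] [LinearOrderedCommGroupWithZero Γ]

/-- `l` is, up to squares, a unit of the form `1 + 4 w` with `w` integral. Adjoining a square root
of such an element is unramified. -/
def Valuation.IsPrimary (v : Valuation M Γ) (l : M) : Prop :=
  ∃ s w, s ≠ 0 ∧ v w ≤ 1 ∧ v (1 + 4 * w) = 1 ∧ l = s ^ 2 * (1 + 4 * w)

namespace Valuation.IsPrimary

variable {v : Valuation M Γ} {l l' u : M}

lemma mul_sq (h : v.IsPrimary l) (hu : u ≠ 0) : v.IsPrimary (l * u ^ 2) := by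
  obtain ⟨s, w, hs, hw, h1, rfl⟩ := h
  exact ⟨s * u, w, mul_ne_zero hs hu, hw, h1, by ring⟩

/-- Away from 2 the number 4 is a unit, so every unit has the form 1 + 4w and only the parity of the
valuation matters. -/
lemma of_sq_eq [CharZero M] (h2 : v 2 = 1) (hu : u ≠ 0) (h : v l = v u ^ 2) :
    v.IsPrimary l := by
  have h4 : v 4 = 1 := by rw [show (4 : M) = 2 * 2 by norm_num, map_mul, h2, mul_one]
  have hvu : v u ≠ 0 := by simpa using hu
  have h1 : v (l / u ^ 2) = 1 := by rw [map_div₀, map_pow, h, div_self (pow_ne_zero 2 hvu)]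
  have e : 1 + 4 * ((l / u ^ 2 - 1) / 4) = l / u ^ 2 := by ring
  refine ⟨u, (l / u ^ 2 - 1) / 4, hu, ?_, by rw [e, h1], by rw [e]; field_simp⟩
  rw [map_div₀, h4, div_one]
  exact v.map_sub_le h1.le (by simp)

end Valuation.IsPrimary

/-- An automorphism that is trivial on the residue field fixes the square root of a primary
element. -/
lemma Valuation.map_eq_self_of_primary [CharZero M] {v : Valuation M Γ} {F : Type*} [FunLike F M M]
    [RingHomClass F M M] (σ : F) (hσ : ∀ w, v w ≤ 1 → v (σ w - w) < 1) {θ s w : M}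
    (hs : s ≠ 0) (hw : v w ≤ 1) (h1 : v (1 + 4 * w) = 1) (hθ : θ ^ 2 = s ^ 2 * (1 + 4 * w))
    (hσs : σ s = s) (hσθ : σ θ = θ ∨ σ θ = -θ) : σ θ = θ := by
  refine hσθ.resolve_right fun hneg ↦ ?_
  -- With η = θ/s, (1 + η)/2 is a root of X² − X − w, hence integral. Were θ negated, this root
  -- would move by the unit η.
  have hη : (θ / s) ^ 2 = 1 + 4 * w := by
    rw [div_pow, hθ]; field_simp
  have hr : v ((1 + θ / s) / 2) ≤ 1 := by
    refine v.le_one_of_quadratic (A := 1) (B := -w) (by simp) (by simpa using hw) ?_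
    linear_combination (1 / 4 : M) * hη
  have h2 := hσ _ hr
  rw [map_div₀, map_add, map_div₀, map_one, hneg, hσs, map_ofNat,
    show (1 + -θ / s) / 2 - (1 + θ / s) / 2 = -(θ / s) by ring, Valuation.map_neg] at h2
  rw [← hη] at h1
  exact h2.ne (map_eq_one_of_sq h1)

/-- The quotient θ/s is a unit; if σ negated it, it would move by the unit 2θ/s, against triviality
on the residue field. -/
lemma Valuation.map_eq_self_of_sq [CharZero M] {v : Valuation M Γ} {F : Type*} [FunLike F M M]
    [RingHomClass F M M] (σ : F) (hσ : ∀ w, v w ≤ 1 → v (σ w - w) < 1) (h2 : v 2 = 1)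
    {θ s : M} (hs : s ≠ 0) (h : v (θ ^ 2) = v s ^ 2) (hσs : σ s = s)
    (hσθ : σ θ = θ ∨ σ θ = -θ) : σ θ = θ := by
  refine hσθ.resolve_right fun hneg ↦ ?_
  have hvs : v s ≠ 0 := by simpa using hs
  have h1 : v (θ / s) = 1 :=
    map_eq_one_of_sq (by rw [div_pow, map_div₀, h, map_pow, div_self (pow_ne_zero 2 hvs)])
  have h3 := hσ _ h1.le
  rw [map_div₀, hneg, hσs, show -θ / s - θ / s = -(2 * (θ / s)) by ring, Valuation.map_neg, map_mul,
    h1, h2, mul_one] at h3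
  exact h3.ne rfl

open NumberField IsDedekindDomain in
lemma Valuation.IsPrimary.map {E M : Type*} [Field E] [NumberField E] [Field M] [NumberField M]
    {f : E →+* M} {v : HeightOneSpectrum (𝓞 E)} {V : HeightOneSpectrum (𝓞 M)}
    (hf : ∀ r : 𝓞 E, r ∈ v.asIdeal ↔ RingOfIntegers.mapRingHom f r ∈ V.asIdeal) {l : E}
    (h : (v.valuation E).IsPrimary l) : (V.valuation M).IsPrimary (f l) := by
  obtain ⟨s, w, hs, hw, h1, rfl⟩ := h
  refine ⟨f s, f w, by simpa using hs, valuation_map_le_one hf hw, ?_, by simp [map_ofNat f 4]⟩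
  simpa [map_ofNat f 4] using valuation_map_eq_one hf h1

/-- A square class that is stable under a Frobenius element at a prime above `2` becomes primary
after multiplication by one of `±1, ±2`. -/
lemma Valuation.IsPrimary.exists_of_frobenius [CharZero M] {v : Valuation M Γ}
    (hv : v.IsUnramifiedOn 2 ⊤) (h2 : v 2 < 1) {F : Type*} [FunLike F M M]
    [RingHomClass F M M] (σ : F) (hσ : ∀ w, v w ≤ 1 → v (σ w - w ^ 2) < 1) {l u : M} {κ : ℤ}
    (hl : l ≠ 0) (hu : u ≠ 0) (hκ : κ % 4 = 1) (h : σ l = l * κ * u ^ 2) :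
    ∃ ε : ℤ, (ε = 1 ∨ ε = -1 ∨ ε = 2 ∨ ε = -2) ∧ v.IsPrimary (ε * l) := by
  have hv2 : v 2 ≠ 0 := by simp
  have hpow : ∀ w : M, w ≠ 0 → ∃ n : ℤ, v w = v 2 ^ n := fun w hw ↦ by
    simpa using hv w Algebra.mem_top hw
  -- integral elements of the maximal ideal are divisible by `2`
  have hdiv : ∀ w : M, v w < 1 → v (w / 2) ≤ 1 := by
    intro w hw
    by_cases hw0 : w = 0
    · simp [hw0]
    obtain ⟨n, hn⟩ := hpow w hw0
    have hn1 : 1 ≤ n := by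
      by_contra! hn1
      have : 1 ≤ v 2 ^ n := one_le_zpow_of_nonpos₀ (by simp [zero_lt_iff]) h2.le (by omega)
      exact (hn ▸ hw).not_ge this
    rw [map_div₀, hn, div_eq_mul_inv, ← zpow_sub_one₀ hv2]
    exact zpow_le_one₀ (by simp [zero_lt_iff]) h2.le (by omega)
  have hint : ∀ n : ℤ, v n ≤ 1 := v.map_intCast_le_one
  have hκ1 : v (κ : M) = 1 := v.map_intCast_eq_one Nat.prime_two (by simpa using h2) (by omega)
  -- the case of a unit
  have main : ∀ l : M, v l = 1 → σ l = l * κ * u ^ 2 → v.IsPrimary l ∨ v.IsPrimary (-l) := by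
    intro l hl1 h
    obtain ⟨m, hm⟩ : (4 : ℤ) ∣ κ - 1 := by omega
    have hm' : (κ : M) = 1 + 4 * m := by
      rw [show κ = 1 + 4 * m by omega]; push_cast; ring
    have hσl := hσ l hl1.le
    have hvu : v u = 1 := by
      have h3 : v (σ l) = 1 := by
        rw [show σ l = (σ l - l ^ 2) + l ^ 2 by ring]
        rw [v.map_add_eq_of_lt_right (by simpa [hl1] using hσl), map_pow, hl1, one_pow]
      rw [h, map_mul, map_mul, hl1, hκ1, one_mul, one_mul] at h3
      exact map_eq_one_of_sq h3
    -- From l² ≡ σ l = lκu² and κ ≡ 1 one gets l ≡ u² modulo the prime, whose uniformizer is 2.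
    have hlu : v (l / u ^ 2 - 1) < 1 := by
      have h3 : v (κ * u ^ 2 - l) < 1 := by
        have : v (l * (κ * u ^ 2 - l)) < 1 := by
          rwa [show l * (κ * u ^ 2 - l) = σ l - l ^ 2 by rw [h]; ring]
        rwa [map_mul, hl1, one_mul] at this
      have h4 : v (4 * m * u ^ 2) < 1 := by
        rw [show (4 * m * u ^ 2 : M) = 2 * ((2 * m : ℤ) * u ^ 2) by push_cast; ring, map_mul]
        refine (mul_le_of_le_one_right' ?_).trans_lt h2
        rw [map_mul, map_pow, hvu, one_pow, mul_one]
        exact hint _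
      have h5 : l / u ^ 2 - 1 = (4 * m * u ^ 2 - (κ * u ^ 2 - l)) / u ^ 2 := by
        rw [hm']; field_simp; ring
      rw [h5, map_div₀, map_pow, hvu, one_pow, div_one]
      exact v.map_sub_lt h4 h3
    obtain ⟨w, hw, hlw⟩ : ∃ w, v w ≤ 1 ∧ l = u ^ 2 * (1 + 2 * w) :=
      ⟨(l / u ^ 2 - 1) / 2, hdiv _ hlu, by field_simp; ring⟩
    have hσu0 : σ u ≠ 0 := by simpa using hu
    have hvσu : v (σ u) = 1 := by
      rw [show σ u = (σ u - u ^ 2) + u ^ 2 by ring,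
        v.map_add_eq_of_lt_right (by simpa [hvu] using hσ u hvu.le), map_pow, hvu, one_pow]
    obtain ⟨ρ, hρ, hρu⟩ : ∃ ρ, v ρ ≤ 1 ∧ u ^ 2 = σ u * (1 + 2 * ρ) := by
      refine ⟨(u ^ 2 / σ u - 1) / 2, hdiv _ ?_, by field_simp; ring⟩
      rw [show u ^ 2 / σ u - 1 = -(σ u - u ^ 2) / σ u by field_simp; ring, map_div₀, hvσu, div_one,
        Valuation.map_neg]
      exact hσ u hvu.le
    -- Apply σ to l = u²(1 + 2w), with u² = σ(u)(1 + 2ρ). As κ and (1 + 2ρ)² = 1 + 4(ρ + ρ²) are 1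
    -- modulo 4, this yields σ w ≡ w modulo 2.
    have hσw : 1 + 2 * σ w = (1 + 2 * w) * κ * (1 + 2 * ρ) ^ 2 := by
      have e := congrArg σ hlw
      rw [h, map_mul, map_pow, map_add, map_mul, map_one, map_ofNat, hlw] at e
      apply mul_left_cancel₀ (pow_ne_zero 2 hσu0)
      rw [← e, hρu]; ring
    have hww : v (σ w - w) < 1 := by
      have e : σ w - w = 2 * (m * (1 + 2 * w) * (1 + 2 * ρ) ^ 2 + (ρ + ρ ^ 2) * (1 + 2 * w)) := by
        rw [hm'] at hσw
        linear_combination (1 / 2 : M) * hσw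
      have hi : ∀ a : M, v a ≤ 1 → v (1 + 2 * a) ≤ 1 := fun a ha ↦
        v.map_add_le (by simp) (by rw [map_mul]; exact mul_le_one' h2.le ha)
      rw [e, map_mul]
      refine (mul_le_of_le_one_right' (v.map_add_le ?_ ?_)).trans_lt h2
      · rw [map_mul, map_mul, map_pow]
        exact mul_le_one' (mul_le_one' (hint m) (hi w hw)) (pow_le_one' (hi ρ hρ) 2)
      · rw [map_mul]
        refine mul_le_one' (v.map_add_le hρ ?_) (hi w hw)
        rw [map_pow]
        exact pow_le_one' hρ 2
    -- Together with σ w ≡ w² this puts the residue of w into {0, 1}: l is primary in the first case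
    -- and −l in the second.
    have hw2 : v (w * (w - 1)) < 1 := by
      rw [show w * (w - 1) = (σ w - w) - (σ w - w ^ 2) by ring]
      exact v.map_sub_lt hww (hσ w hw)
    have hunit : ∀ a : M, v a ≤ 1 → v (1 + 4 * a) = 1 := by
      intro a ha
      rw [v.map_add_eq_of_lt_left, map_one]
      rw [map_one, show (4 * a : M) = 2 * (2 * a) by ring, map_mul, map_mul]
      exact (mul_le_of_le_one_right' (mul_le_one' h2.le ha)).trans_lt h2
    by_cases hw1 : v w < 1
    · exact Or.inl ⟨u, w / 2, hu, hdiv w hw1, hunit _ (hdiv w hw1), by rw [hlw]; ring⟩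
    · have hw1' : v w = 1 := le_antisymm hw (not_lt.mp hw1)
      rw [map_mul, hw1', one_mul] at hw2
      have h3 : v (-1 - (w - 1) / 2) ≤ 1 := v.map_sub_le (by simp) (hdiv _ hw2)
      exact Or.inr ⟨u, _, hu, h3, hunit _ h3, by rw [hlw]; ring⟩
  have main' : ∀ l : M, (∃ k : ℤ, v l = v 2 ^ (2 * k)) → σ l = l * κ * u ^ 2 →
      v.IsPrimary l ∨ v.IsPrimary (-l) := by
    rintro l ⟨k, hk⟩ h
    have hk2 : ((2 : M) ^ k) ≠ 0 := zpow_ne_zero _ two_ne_zero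
    have h3 := main (l / (2 ^ k) ^ 2) (by
      rw [map_div₀, hk, map_pow, map_zpow₀, ← zpow_natCast, ← zpow_mul, mul_comm k,
        Nat.cast_ofNat, div_self (zpow_ne_zero _ hv2)]) (by
      rw [map_div₀, map_pow, map_zpow₀, map_ofNat, h]; ring)
    rcases h3 with h3 | h3
    · left
      simpa [hk2] using h3.mul_sq hk2
    · right
      have := h3.mul_sq hk2
      rwa [← neg_div, div_mul_cancel₀ _ (pow_ne_zero 2 hk2)] at this
  obtain ⟨n, hn⟩ := hpow l hl
  rcases Int.even_or_odd' n with ⟨k, rfl | rfl⟩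
  · rcases main' l ⟨k, hn⟩ h with h3 | h3
    · exact ⟨1, by simp, by simpa using h3⟩
    · exact ⟨-1, by simp, by simpa using h3⟩
  -- All values are powers of that of 2, so a factor 2 repairs an odd exponent; σ fixes it.
  · rcases main' (2 * l) ⟨k + 1, by
      rw [map_mul, hn, show 2 * (k + 1) = 1 + (2 * k + 1) by ring, zpow_one_add₀ hv2]⟩
      (by rw [map_mul, map_ofNat, h]; ring) with h3 | h3
    · exact ⟨2, by simp, by simpa using h3⟩
    · exact ⟨-2, by simp, by simpa using h3⟩

end Primary

/-! ### The rational twist. -/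

section Twist

open NumberField IsDedekindDomain

lemma Algebra.exists_of_mem_adjoin_pair {M : Type*} [Field M] [CharZero M] {n : ℤ} {x y w : M}
    (hy : y ^ 2 = n) (hw : w ∈ Algebra.adjoin ℚ {x, y}) :
    ∃ q ∈ Algebra.adjoin ℚ {x}, ∃ r ∈ Algebra.adjoin ℚ {x}, w = q + r * y := by
  induction hw using Algebra.adjoin_induction with
  | mem w hw =>
    rcases hw with rfl | rfl
    · exact ⟨w, Algebra.self_mem_adjoin_singleton ℚ w, 0, zero_mem _, by simp⟩
    · exact ⟨0, zero_mem _, 1, one_mem _, by simp⟩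
  | algebraMap q => exact ⟨_, algebraMap_mem _ q, 0, zero_mem _, by simp⟩
  | add _ _ _ _ h1 h2 =>
    obtain ⟨q, hq, r, hr, rfl⟩ := h1
    obtain ⟨q', hq', r', hr', rfl⟩ := h2
    exact ⟨q + q', add_mem hq hq', r + r', add_mem hr hr', by ring⟩
  | mul _ _ _ _ h1 h2 =>
    obtain ⟨q, hq, r, hr, rfl⟩ := h1
    obtain ⟨q', hq', r', hr', rfl⟩ := h2
    exact ⟨q * q' + n * (r * r'), add_mem (mul_mem hq hq') (mul_mem (intCast_mem _ n)
      (mul_mem hr hr')), q * r' + q' * r, add_mem (mul_mem hq hr') (mul_mem hq' hr),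
      by linear_combination (r * r' : M) * hy⟩

lemma Valuation.isUnramifiedOn_adjoin_pair {M Γ : Type*} [Field M] [CharZero M]
    [LinearOrderedCommGroupWithZero Γ] {v : Valuation M Γ} {p : ℕ} (hp : p.Prime)
    (hv : v p < 1) {m n : ℤ} {x y : M} (hx : x ^ 2 = m) (hy : y ^ 2 = n) (hpm : ¬ (p : ℤ) ∣ m)
    (hpn : ¬ (p : ℤ) ∣ n) (hm : m % 4 = 1 ∨ p ≠ 2) (hn : n % 4 = 1 ∨ p ≠ 2) :
    v.IsUnramifiedOn p (Algebra.adjoin ℚ {x, y}) := by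
  intro w hw h0
  obtain ⟨q, hq, r, hr, rfl⟩ := Algebra.exists_of_mem_adjoin_pair hy hw
  exact (isUnramifiedOn_adjoin_sqrt hp hv hx hpm hm).exists_of_sqrt hp hv hy hpn hn hq hr h0

variable {E : Type*} [Field E] [NumberField E]

lemma HeightOneSpectrum.natCast_mem_iff (v : HeightOneSpectrum (𝓞 E)) (n : ℕ) :
    (n : 𝓞 E) ∈ v.asIdeal ↔ v.valuation E n < 1 := by
  rw [← v.valuation_lt_one_iff_mem (K := E)]
  simp

lemma HeightOneSpectrum.under_int_eq_span (v : HeightOneSpectrum (𝓞 E)) {p : ℕ} (hp : p.Prime)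
    (hv : v.valuation E p < 1) : v.asIdeal.under ℤ = Ideal.span {(p : ℤ)} := by
  have hmem : (p : 𝓞 E) ∈ v.asIdeal := (HeightOneSpectrum.natCast_mem_iff v p).mpr hv
  exact (((Ideal.liesOver_span_iff v.isPrime.ne_top (Nat.prime_iff_prime_int.mp hp)).mpr
    (by simpa using hmem)).1).symm

lemma HeightOneSpectrum.exists_prime_valuation_lt_one (v : HeightOneSpectrum (𝓞 E)) :
    ∃ p : ℕ, p.Prime ∧ v.valuation E p < 1 := by
  have : Finite (𝓞 E ⧸ v.asIdeal) := Ring.HasFiniteQuotients.finiteQuotient v.ne_bot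
  have : v.asIdeal.IsMaximal := v.isMaximal
  have : Field (𝓞 E ⧸ v.asIdeal) := Ideal.Quotient.field _
  obtain ⟨p, hc⟩ := CharP.exists (𝓞 E ⧸ v.asIdeal)
  have hp : p.Prime := CharP.char_is_prime (𝓞 E ⧸ v.asIdeal) p
  refine ⟨p, hp, ?_⟩
  rw [← HeightOneSpectrum.natCast_mem_iff, ← Ideal.Quotient.eq_zero_iff_mem]
  simp

variable [IsGalois ℚ E]

lemma HeightOneSpectrum.exists_frobenius (v : HeightOneSpectrum (𝓞 E)) {p : ℕ} (hp : p.Prime)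
    (hv : v.valuation E p < 1) :
    ∃ σ : E ≃ₐ[ℚ] E, ∀ r : 𝓞 E, σ • r - r ^ p ∈ v.asIdeal := by
  have : Finite (𝓞 E ⧸ v.asIdeal) := Ring.HasFiniteQuotients.finiteQuotient v.ne_bot
  obtain ⟨σ, hσ⟩ := IsArithFrobAt.exists_of_isInvariant ℤ (E ≃ₐ[ℚ] E) v.asIdeal
  refine ⟨σ, fun r ↦ ?_⟩
  have h := hσ r
  rw [HeightOneSpectrum.under_int_eq_span v hp hv,
    Nat.card_congr (Int.quotientSpanNatEquivZMod p).toEquiv, Nat.card_zmod] at h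
  exact h

/-- The Galois group is transitive on the primes above p. It is stated through membership, the form
in which primary elements are transported. -/
lemma HeightOneSpectrum.exists_algEquiv (v v' : HeightOneSpectrum (𝓞 E)) {p : ℕ} (hp : p.Prime)
    (hv : v.valuation E p < 1) (hv' : v'.valuation E p < 1) :
    ∃ τ : E ≃ₐ[ℚ] E, ∀ r : 𝓞 E,
      r ∈ v.asIdeal ↔ RingOfIntegers.mapRingHom (τ : E →+* E) r ∈ v'.asIdeal := by
  obtain ⟨τ, hτ⟩ := Algebra.IsInvariant.exists_smul_of_under_eq ℤ (𝓞 E) (E ≃ₐ[ℚ] E)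
    v.asIdeal v'.asIdeal ((HeightOneSpectrum.under_int_eq_span v hp hv).trans
      (HeightOneSpectrum.under_int_eq_span v' hp hv').symm)
  refine ⟨τ, fun r ↦ ?_⟩
  rw [hτ, show RingOfIntegers.mapRingHom (τ : E →+* E) r = τ • r from rfl,
    Ideal.smul_mem_pointwise_smul_iff]

/-- Both l and l⁻¹ have nonzero integer multiples that are integral; away from those two integers l
is a unit. This makes the set of primes to be twisted finite. -/
lemma HeightOneSpectrum.exists_forall_valuation_eq_one {l : E} (hl : l ≠ 0) :
    ∃ N : ℕ, N ≠ 0 ∧ ∀ (v : HeightOneSpectrum (𝓞 E)) (p : ℕ), p.Prime → v.valuation E p < 1 →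
      ¬ p ∣ N → v.valuation E l = 1 := by
  have key : ∀ w : E, ∃ N : ℤ, N ≠ 0 ∧ ∀ (v : HeightOneSpectrum (𝓞 E)) (p : ℕ), p.Prime →
      v.valuation E p < 1 → ¬ (p : ℤ) ∣ N → v.valuation E w ≤ 1 := by
    intro w
    have hw : IsAlgebraic ℤ w := (IsFractionRing.isAlgebraic_iff ℤ ℚ E).mpr
      (Algebra.IsAlgebraic.isAlgebraic w)
    obtain ⟨N, hN, hi⟩ := hw.exists_integral_multiple
    refine ⟨N, hN, fun v p hp hv hpN ↦ ?_⟩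
    have h1 := v.valuation_le_one (K := E) (⟨_, hi⟩ : 𝓞 E)
    change v.valuation E (N • w) ≤ 1 at h1
    rwa [zsmul_eq_mul, map_mul, Valuation.map_intCast_eq_one _ hp hv hpN, one_mul] at h1
  obtain ⟨N, hN, h1⟩ := key l
  obtain ⟨N', hN', h2⟩ := key l⁻¹
  refine ⟨(N * N').natAbs, by simp [hN, hN'], fun v p hp hv hpN ↦ ?_⟩
  have hpN' : ¬ (p : ℤ) ∣ N * N' := by rwa [Int.natCast_dvd]
  refine le_antisymm (h1 v p hp hv fun h ↦ hpN' (h.mul_right _)) ?_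
  have h3 := h2 v p hp hv fun h ↦ hpN' (h.mul_left _)
  rw [map_inv₀] at h3
  exact (inv_le_one₀ (by simpa [zero_lt_iff] using hl)).mp h3

/-- The multiplicative twist: an element `μ` of a biquadratic field whose conjugates are
`μ` or `c μ` up to squares has a rational multiple that is primary at all primes not dividing the
radicands. -/
theorem exists_twist {a b c : ℤ} {x y μ : E} (hx : x ^ 2 = a) (hy : y ^ 2 = b)
    (htop : Algebra.adjoin ℚ {x, y} = ⊤) (ha : a % 4 = 1) (hb : b % 4 = 1)
    (habc : c % 4 ≠ 1 → (a * b) % 8 = 1) (hμ0 : μ ≠ 0)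
    (hμ : ∀ τ : E ≃ₐ[ℚ] E, ∃ u, u ≠ 0 ∧ (τ μ = μ * u ^ 2 ∨ τ μ = c * μ * u ^ 2))
    (hμ' : ∀ τ : E ≃ₐ[ℚ] E, τ (x * y) = x * y → ∃ u, u ≠ 0 ∧ τ μ = μ * u ^ 2) :
    ∃ δ : ℚ, δ ≠ 0 ∧ ∀ (v : HeightOneSpectrum (𝓞 E)) (p : ℕ), p.Prime → v.valuation E p < 1 →
      ¬ (p : ℤ) ∣ a * b → (p ≠ 2 → ¬ (p : ℤ) ∣ c) →
      (v.valuation E).IsPrimary (δ * μ) ∨ (v.valuation E).IsPrimary (c * (δ * μ)) := by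
  classical
  have hunr : ∀ (v : HeightOneSpectrum (𝓞 E)) (p : ℕ), p.Prime → v.valuation E p < 1 →
      ¬ (p : ℤ) ∣ a * b → (v.valuation E).IsUnramifiedOn p ⊤ := fun v p hp hv hpab ↦
    htop ▸ Valuation.isUnramifiedOn_adjoin_pair hp hv hx hy (fun h ↦ hpab (h.mul_right _))
      (fun h ↦ hpab (h.mul_left _)) (Or.inl ha) (Or.inl hb)
  -- Primes above p are conjugate, and conjugation changes μ by squares and possibly c. So one prime
  -- above each p suffices, at the cost of the alternative with the factor c.
  have transport : ∀ (v v' : HeightOneSpectrum (𝓞 E)) (p : ℕ), p.Prime → v.valuation E p < 1 →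
      v'.valuation E p < 1 → ∀ δ : ℚ, (v.valuation E).IsPrimary (δ * μ) →
      (v'.valuation E).IsPrimary (δ * μ) ∨ (v'.valuation E).IsPrimary (c * (δ * μ)) := by
    intro v v' p hp hv hv' δ h
    obtain ⟨τ, hτ⟩ := HeightOneSpectrum.exists_algEquiv v v' hp hv hv'
    have h1 := h.map hτ
    obtain ⟨u, hu, hτμ⟩ := hμ τ
    have e : (τ : E →+* E) (δ * μ) = δ * τ μ := by simp
    rw [e] at h1
    rcases hτμ with h2 | h2
    · left
      have := h1.mul_sq (inv_ne_zero hu)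
      rwa [h2, show δ * (μ * u ^ 2) * u⁻¹ ^ 2 = δ * μ by field_simp] at this
    · right
      have := h1.mul_sq (inv_ne_zero hu)
      rwa [h2, show δ * (c * μ * u ^ 2) * u⁻¹ ^ 2 = c * (δ * μ) by field_simp] at this
  obtain ⟨N, hN0, hN⟩ := HeightOneSpectrum.exists_forall_valuation_eq_one hμ0
  -- The odd part of the twist is the product of the odd primes p at which μ has odd value
  -- somewhere; p itself has value of exponent 1 there.
  let isOdd : ℕ → Prop := fun p ↦ ∃ v : HeightOneSpectrum (𝓞 E), v.valuation E p < 1 ∧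
    ∃ k : ℤ, v.valuation E μ = v.valuation E p ^ (2 * k + 1)
  let S : Finset ℕ := N.primeFactors.filter fun p ↦ p ≠ 2 ∧ isOdd p
  have hSp : ∀ q ∈ S, q.Prime := fun q hq ↦ Nat.prime_of_mem_primeFactors (Finset.mem_filter.mp hq).1
  have hval : ∀ (v : HeightOneSpectrum (𝓞 E)) (p : ℕ), p.Prime → v.valuation E p < 1 →
      v.valuation E ((∏ q ∈ S, q : ℕ) : E) = if p ∈ S then v.valuation E p else 1 := by
    intro v p hp hv
    have hq : ∀ q ∈ S, q ≠ p → v.valuation E (q : E) = 1 := by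
      intro q hqS hne
      have := Valuation.map_intCast_eq_one (v.valuation E) hp hv (n := q) fun h ↦
        hne ((Nat.prime_dvd_prime_iff_eq hp (hSp q hqS)).mp (by exact_mod_cast h)).symm
      exact_mod_cast this
    rw [Nat.cast_prod, map_prod]
    split_ifs with hpS
    · rw [Finset.prod_eq_single_of_mem p hpS hq]
    · exact Finset.prod_eq_one fun q hqS ↦ hq q hqS fun h ↦ hpS (h ▸ hqS)
  set D : ℕ := ∏ q ∈ S, q with hD
  have hD0 : D ≠ 0 := Finset.prod_ne_zero_iff.mpr fun q hq ↦ (hSp q hq).ne_zero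
  have hDE : (D : E) ≠ 0 := by exact_mod_cast hD0
  -- choice of the factor at `2`
  obtain ⟨ε, hε, hε2⟩ : ∃ ε : ℤ, (ε = 1 ∨ ε = -1 ∨ ε = 2 ∨ ε = -2) ∧
      ∀ v : HeightOneSpectrum (𝓞 E), v.valuation E ((2 : ℕ) : E) < 1 →
        (v.valuation E).IsPrimary (((ε * D : ℚ) : E) * μ) ∨
          (v.valuation E).IsPrimary (c * (((ε * D : ℚ) : E) * μ)) := by
    by_cases hex : ∃ v : HeightOneSpectrum (𝓞 E), v.valuation E ((2 : ℕ) : E) < 1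
    swap
    · exact ⟨1, by simp, fun v hv ↦ absurd ⟨v, hv⟩ hex⟩
    obtain ⟨v, hv⟩ := hex
    have h2ab : ¬ ((2 : ℕ) : ℤ) ∣ a * b := by
      rw [Nat.cast_ofNat, Int.prime_two.dvd_mul]; omega
    obtain ⟨σ, hσ⟩ := HeightOneSpectrum.exists_frobenius v Nat.prime_two hv
    have hσ' : ∀ w, v.valuation E w ≤ 1 → v.valuation E (σ w - w ^ 2) < 1 := fun w hw ↦
      valuation_smul_sub_pow_lt_one v hσ hw
    obtain ⟨u, κ, hu, hκ, hσμ⟩ : ∃ (u : E) (κ : ℤ), u ≠ 0 ∧ κ % 4 = 1 ∧ σ μ = μ * κ * u ^ 2 := by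
      -- The Frobenius argument tolerates the factor c only if c ≡ 1 mod 4. Otherwise ab ≡ 1 mod 8,
      -- and (1 + xy)/2 is a root of a polynomial congruent to X² − X modulo 2, so Frobenius fixes
      -- xy and μ changes by a square only.
      by_cases hc : c % 4 = 1
      · obtain ⟨u, hu, h | h⟩ := hμ σ
        · exact ⟨u, 1, hu, by norm_num, by simpa using h⟩
        · exact ⟨u, c, hu, hc, by rw [h]; ring⟩
      · have hxy : (x * y) ^ 2 = ((a * b : ℤ) : E) := by push_cast; rw [mul_pow, hx, hy]
        obtain ⟨n, hn⟩ : (8 : ℤ) ∣ a * b - 1 := by have := habc hc; omega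
        have hn' : ((a * b : ℤ) : E) = 1 + 8 * n := by
          rw [show a * b = 1 + 8 * n by linarith]; push_cast; ring
        have hv1 : v.valuation E (x * y) = 1 :=
          Valuation.map_sqrt_eq_one _ Nat.prime_two hv h2ab hxy
        have hpm : σ (x * y) = x * y ∨ σ (x * y) = -(x * y) := by
          rw [← sq_eq_sq_iff_eq_or_eq_neg, ← map_pow, hxy, map_intCast]
        have hfix : σ (x * y) = x * y := by
          refine hpm.resolve_right fun hneg ↦ ?_
          have hr2 : ((1 + x * y) / 2) ^ 2 = 1 * ((1 + x * y) / 2) - ((-2 * n : ℤ) : E) := by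
            push_cast
            linear_combination (1 / 4 : E) * hxy + (1 / 4 : E) * hn'
          have hr : v.valuation E ((1 + x * y) / 2) ≤ 1 :=
            Valuation.le_one_of_quadratic _ (by simp) (Valuation.map_intCast_le_one _ _) hr2
          have h3 := hσ' _ hr
          have e : σ ((1 + x * y) / 2) - ((1 + x * y) / 2) ^ 2 = -(x * y) - 2 * n := by
            rw [hr2, map_div₀, map_add, hneg, map_one, map_ofNat]; push_cast; ring
          rw [e] at h3
          have h4 : v.valuation E (2 * n : E) < 1 := by
            rw [map_mul]
            exact (mul_le_of_le_one_right' (Valuation.map_intCast_le_one _ n)).trans_lt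
              (by exact_mod_cast hv)
          have h5 := Valuation.map_add_lt _ h3 h4
          rw [sub_add_cancel, Valuation.map_neg, hv1] at h5
          exact h5.ne rfl
        obtain ⟨u, hu, h⟩ := hμ' σ hfix
        exact ⟨u, 1, hu, by norm_num, by simpa using h⟩
    obtain ⟨ε, hε, h⟩ := Valuation.IsPrimary.exists_of_frobenius
      (hunr v 2 Nat.prime_two hv h2ab) (by exact_mod_cast hv) σ hσ' (l := D * μ)
      (mul_ne_zero hDE hμ0) hu hκ (by rw [map_mul, map_natCast, hσμ]; ring)
    refine ⟨ε, hε, fun v' hv' ↦ transport v v' 2 Nat.prime_two hv hv' _ ?_⟩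
    push_cast
    rwa [mul_assoc]
  have hε0 : ε ≠ 0 := by rintro rfl; simp at hε
  refine ⟨ε * D, mul_ne_zero (by exact_mod_cast hε0) (by exact_mod_cast hD0),
    fun v p hp hv hpab hpc ↦ ?_⟩
  by_cases hp2 : p = 2
  · subst hp2
    exact hε2 v hv
  have h2 : ∀ v : HeightOneSpectrum (𝓞 E), v.valuation E p < 1 → v.valuation E 2 = 1 := fun v hv ↦
    Valuation.map_two_eq_one _ hp hv hp2
  have hvε : ∀ v : HeightOneSpectrum (𝓞 E), v.valuation E p < 1 → v.valuation E (ε : E) = 1 := by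
    intro v hv
    have := h2 v hv
    rcases hε with rfl | rfl | rfl | rfl <;> simp [this, Valuation.map_neg]
  have hp0 : (p : E) ≠ 0 := by exact_mod_cast hp.ne_zero
  have heval : ∀ v : HeightOneSpectrum (𝓞 E), v.valuation E p < 1 →
      v.valuation E (((ε * D : ℚ) : E) * μ) =
        (if p ∈ S then v.valuation E p else 1) * v.valuation E μ := by
    intro v hv
    push_cast
    rw [map_mul, map_mul, hvε v hv, one_mul, hval v p hp hv]
  have hpv : ∀ v : HeightOneSpectrum (𝓞 E), v.valuation E p ≠ 0 := fun v ↦ by simpa using hp0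
  have hprim : ∀ (v : HeightOneSpectrum (𝓞 E)) (k : ℤ), v.valuation E p < 1 →
      v.valuation E (((ε * D : ℚ) : E) * μ) = v.valuation E p ^ (2 * k) →
      (v.valuation E).IsPrimary (((ε * D : ℚ) : E) * μ) := by
    intro v k hv h
    refine Valuation.IsPrimary.of_sq_eq (h2 v hv) (u := (p : E) ^ k) (zpow_ne_zero _ hp0) ?_
    rw [h, map_zpow₀, ← zpow_natCast, ← zpow_mul, mul_comm k, Nat.cast_ofNat]
  by_cases hodd : isOdd p
  · obtain ⟨v₀, hv₀, k, hk⟩ := hodd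
    have hpS : p ∈ S := by
      refine Finset.mem_filter.mpr ⟨Nat.mem_primeFactors.mpr ⟨hp, ?_, hN0⟩, hp2, v₀, hv₀, k, hk⟩
      by_contra hpN
      rw [hN v₀ p hp hv₀ hpN, eq_comm, zpow_eq_one_iff_right₀ zero_le hv₀.ne] at hk
      omega
    refine transport v₀ v p hp hv₀ hv _ (hprim v₀ (k + 1) hv₀ ?_)
    rw [heval v₀ hv₀, if_pos hpS, hk, show 2 * (k + 1) = 1 + (2 * k + 1) by ring,
      zpow_one_add₀ (hpv v₀)]
  · left
    have hpS : p ∉ S := fun h ↦ hodd (Finset.mem_filter.mp h).2.2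
    obtain ⟨n, hn⟩ := hunr v p hp hv hpab μ Algebra.mem_top hμ0
    rcases Int.even_or_odd' n with ⟨k, rfl | rfl⟩
    · refine hprim v k hv ?_
      rw [heval v hv, if_neg hpS, one_mul, hn]
    · exact absurd ⟨v, hv, k, hn⟩ hodd

end Twist

/-! ### Inertia over k acts trivially on the generators. -/

section Unramified

open NumberField IsDedekindDomain

section Sqrt

variable {M Γ : Type*} [Field M] [LinearOrderedCommGroupWithZero Γ] {v : Valuation M Γ}

lemma Valuation.map_sq_eq_of_dvd {p : ℕ} (hp : p.Prime) (hv : v p < 1) {m : ℤ}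
    (hm : Squarefree m) (hpm : (p : ℤ) ∣ m) {x : M} (hx : x ^ 2 = m) : v p = v x ^ 2 := by
  obtain ⟨n, rfl⟩ := hpm
  have hpn : ¬ (p : ℤ) ∣ n := hm.not_dvd_of_dvd dvd_rfl (Nat.prime_iff_prime_int.mp hp) dvd_rfl
  rw [← map_pow, hx]
  push_cast
  rw [map_mul, v.map_intCast_eq_one hp hv hpn, mul_one]

variable [CharZero M] {F : Type*} [FunLike F M M] [RingHomClass F M M] (σ : F)

/-- An automorphism that is trivial on the residue field fixes the square root of an integer that
is coprime to `p`, and congruent to `1` modulo `4` if `p = 2`. -/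
lemma Valuation.map_sqrt_eq_self (hσ : ∀ w, v w ≤ 1 → v (σ w - w) < 1) {p : ℕ} (hp : p.Prime)
    (hv : v p < 1) {m : ℤ} {x : M} (hx : x ^ 2 = m) (hpm : ¬ (p : ℤ) ∣ m)
    (hm : m % 4 = 1 ∨ p ≠ 2) : σ x = x := by
  have hpm1 : σ x = x ∨ σ x = -x := by
    rw [← sq_eq_sq_iff_eq_or_eq_neg, ← map_pow, hx, map_intCast]
  have hvm := v.map_intCast_eq_one hp hv hpm
  rcases hm with hm | hm
  · obtain ⟨n, hn⟩ : (4 : ℤ) ∣ m - 1 := by omega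
    have hn' : (m : M) = 1 + 4 * n := by
      rw [show m = 1 + 4 * n by omega]; push_cast; ring
    exact map_eq_self_of_primary σ hσ one_ne_zero (v.map_intCast_le_one n) (hn' ▸ hvm)
      (by rw [hx, hn']; ring) (map_one σ) hpm1
  · exact map_eq_self_of_sq σ hσ (v.map_two_eq_one hp hv hm) one_ne_zero (by rw [hx, hvm]; simp)
      (map_one σ) hpm1

/-- If `θ²` has valuation a power of `v p` and `p` is a unit times the square of a fixed element,
then `θ` is fixed. -/
lemma Valuation.map_eq_self_of_dvd (hσ : ∀ w, v w ≤ 1 → v (σ w - w) < 1) {p : ℕ} (hp : p.Prime)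
    (hv : v p < 1) (hp2 : p ≠ 2) {m : ℤ} (hm : Squarefree m) (hpm : (p : ℤ) ∣ m) {x θ : M}
    (hx : x ^ 2 = m) (hσx : σ x = x) (hθ : ∃ n : ℤ, v (θ ^ 2) = v p ^ n)
    (hσθ : σ θ = θ ∨ σ θ = -θ) : σ θ = θ := by
  obtain ⟨n, hn⟩ := hθ
  have hx0 : x ≠ 0 := by
    rintro rfl
    rw [zero_pow two_ne_zero, eq_comm, Int.cast_eq_zero] at hx
    exact hm.ne_zero hx
  refine map_eq_self_of_sq σ hσ (v.map_two_eq_one hp hv hp2) (s := x ^ n) (zpow_ne_zero _ hx0) ?_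
    (by rw [map_zpow₀, hσx]) hσθ
  rw [hn, map_sq_eq_of_dvd hp hv hm hpm hx, map_zpow₀, ← zpow_natCast, ← zpow_natCast, ← zpow_mul,
    ← zpow_mul, mul_comm]

end Sqrt

namespace H8Generators

variable {a b c : ℤ}

section

variable {M Γ : Type*} [Field M] [CharZero M] [LinearOrderedCommGroupWithZero Γ]
  {v : Valuation M Γ} {F : Type*} [FunLike F M M] [RingHomClass F M M] (σ : F)
  (g : H8Generators a b c M)

/-- The added term θ' satisfies θ'² = δα'βγ', being up to sign a conjugate of θ under x ↦ −x when ζ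
= ±z. In (θ + θ')² = δβ(αγ + α'γ' + 2tζ) the sum αγ + α'γ' is a trace and x has disappeared. What is
left lies in ℚ(y, z), where the primes dividing a do not ramify. The companion below removes y
instead. -/
lemma sq_add_left {ζ : M} (hζ : ζ ^ 2 = c) : (g.θ + g.δ * g.t * g.β * ζ / g.θ) ^ 2 =
    g.δ * g.β * ((2 * (g.a₀ * g.c₀) + 2 * (g.a₁ * g.c₁ * a) * g.y) + 2 * g.t * ζ) := by
  have hθ0 := g.θ_ne
  have hα0 := g.α_ne
  have hγ0 := g.γ_ne
  have hβ0 := g.β_ne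
  have hδ0 := g.δ_ne'
  have e1 : (g.θ + g.δ * g.t * g.β * ζ / g.θ) ^ 2 =
      g.θ ^ 2 + 2 * g.δ * g.t * g.β * ζ + g.δ ^ 2 * g.t ^ 2 * g.β ^ 2 * ζ ^ 2 / g.θ ^ 2 := by
    field_simp; ring
  have e2 : g.δ ^ 2 * g.t ^ 2 * g.β ^ 2 * (c : M) / (g.δ * (g.α * g.β * g.γ)) =
      g.δ * g.β * (g.α' * g.γ') := by
    rw [div_eq_iff (by positivity)]
    linear_combination (-g.δ ^ 2 * g.β ^ 2 * g.γ * g.γ' : M) * g.α_mul - (g.δ ^ 2 * g.β ^ 2 * g.t : M) * g.γ_mul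
  have e3 : g.α * g.γ + g.α' * g.γ' = 2 * (g.a₀ * g.c₀) + 2 * (g.a₁ * g.c₁ * a) * g.y := by
    rw [α, γ, α', γ']
    linear_combination (2 * g.a₁ * g.c₁ * g.y : M) * g.x_sq
  rw [e1, hζ, g.θ_sq', e2]
  linear_combination (g.δ * g.β : M) * e3

lemma sq_add_right {ζ : M} (hζ : ζ ^ 2 = c) :
    (g.θ + g.δ * g.t * g.α * (g.x * ζ) / g.θ) ^ 2 =
    g.δ * g.α * ((2 * (g.b₀ * g.c₀) + 2 * (g.b₁ * g.c₁ * b) * g.x) + 2 * g.t * g.x * ζ) := by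
  have hθ0 := g.θ_ne
  have hα0 := g.α_ne
  have hγ0 := g.γ_ne
  have hβ0 := g.β_ne
  have hδ0 := g.δ_ne'
  have e1 : (g.θ + g.δ * g.t * g.α * (g.x * ζ) / g.θ) ^ 2 = g.θ ^ 2 +
      2 * g.δ * g.t * g.α * (g.x * ζ) + g.δ ^ 2 * g.t ^ 2 * g.α ^ 2 * (g.x ^ 2 * ζ ^ 2) / g.θ ^ 2 := by
    field_simp; ring
  have e2 : g.δ ^ 2 * g.t ^ 2 * g.α ^ 2 * (a * c : M) / (g.δ * (g.α * g.β * g.γ)) =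
      g.δ * g.α * (g.β' * g.γ') := by
    rw [div_eq_iff (by positivity)]
    linear_combination (-g.δ ^ 2 * g.α ^ 2 * g.γ * g.γ' : M) * g.β_mul - (g.δ ^ 2 * g.α ^ 2 * g.t * a : M) * g.γ_mul
  have e3 : g.β * g.γ + g.β' * g.γ' = 2 * (g.b₀ * g.c₀) + 2 * (g.b₁ * g.c₁ * b) * g.x := by
    rw [β, γ, β', γ']
    linear_combination (2 * g.b₁ * g.c₁ * g.x : M) * g.y_sq
  rw [e1, hζ, g.x_sq, g.θ_sq', e2]
  linear_combination (g.δ * g.α : M) * e3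

/-- The values for the two signs of ζ add up to 2w, so they are not both 0. -/
lemma exists_add_ne_zero (z : M) {w : M} (r : M) (hw : w ≠ 0) :
    ∃ ζ : M, (ζ = z ∨ ζ = -z) ∧ w + r * ζ / w ≠ 0 := by
  by_contra! h
  have h1 := h z (Or.inl rfl)
  have h2 := h (-z) (Or.inr rfl)
  have : 2 * w = 0 := by linear_combination h1 + h2
  simp [hw] at this

/-- The inertia group acts trivially on all generators. -/
theorem map_eq_self_of_inertia (h : IsH8Radicands a b c)
    (hσ : ∀ w, v w ≤ 1 → v (σ w - w) < 1) {p : ℕ} (hp : p.Prime) (hv : v p < 1)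
    (hxyz : σ (g.x * g.y * g.z) = g.x * g.y * g.z)
    (hprim : ¬ (p : ℤ) ∣ a * b → (p ≠ 2 → ¬ (p : ℤ) ∣ c) →
      ∃ s w, s ≠ 0 ∧ (σ g.x = g.x → σ g.y = g.y → σ s = s) ∧ v w ≤ 1 ∧ v (1 + 4 * w) = 1 ∧
        (g.θ ^ 2 = s ^ 2 * (1 + 4 * w) ∨ c * g.θ ^ 2 = s ^ 2 * (1 + 4 * w))) :
    σ g.x = g.x ∧ σ g.y = g.y ∧ σ g.z = g.z ∧ σ g.θ = g.θ := by
  have hx0 := g.x_ne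
  have hy0 := g.y_ne
  have hz0 := g.z_ne
  have hp' : Prime (p : ℤ) := Nat.prime_iff_prime_int.mp hp
  have hsqf := h.squarefree
  have hsqa : Squarefree a := hsqf.squarefree_of_dvd ⟨b * c, by ring⟩
  have hsqb : Squarefree b := hsqf.squarefree_of_dvd ⟨a * c, by ring⟩
  have hsqc : Squarefree c := hsqf.squarefree_of_dvd ⟨a * b, by ring⟩
  have hodd : ∀ {n : ℤ}, n % 4 = 1 → (p : ℤ) ∣ n → p ≠ 2 := by
    rintro n hn hpn rfl
    omega
  -- Two of x, y, z have radicands at which p is unramified and are fixed; the third follows from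
  -- the product.
  have key : σ g.x = g.x ∧ σ g.y = g.y ∧ σ g.z = g.z := by
    by_cases hpa : (p : ℤ) ∣ a
    · have hp2 := hodd h.mod_four₁ hpa
      have hy := Valuation.map_sqrt_eq_self σ hσ hp hv g.y_sq
        (hsqf.not_dvd_of_dvd ⟨c, by ring⟩ hp' hpa) (Or.inr hp2)
      have hz := Valuation.map_sqrt_eq_self σ hσ hp hv g.z_sq
        (hsqf.not_dvd_of_dvd ⟨b, by ring⟩ hp' hpa) (Or.inr hp2)
      rw [map_mul, map_mul, hy, hz] at hxyz
      exact ⟨mul_right_cancel₀ hy0 (mul_right_cancel₀ hz0 hxyz), hy, hz⟩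
    have hx := Valuation.map_sqrt_eq_self σ hσ hp hv g.x_sq hpa (Or.inl h.mod_four₁)
    by_cases hpb : (p : ℤ) ∣ b
    · have hp2 := hodd h.mod_four₂ hpb
      have hz := Valuation.map_sqrt_eq_self σ hσ hp hv g.z_sq
        (hsqf.not_dvd_of_dvd ⟨a, by ring⟩ hp' hpb) (Or.inr hp2)
      rw [map_mul, map_mul, hx, hz] at hxyz
      exact ⟨hx, mul_left_cancel₀ hx0 (mul_right_cancel₀ hz0 hxyz), hz⟩
    have hy := Valuation.map_sqrt_eq_self σ hσ hp hv g.y_sq hpb (Or.inl h.mod_four₂)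
    rw [map_mul, map_mul, hx, hy] at hxyz
    exact ⟨hx, hy, mul_left_cancel₀ (mul_ne_zero hx0 hy0) hxyz⟩
  obtain ⟨hx, hy, hz⟩ := key
  refine ⟨hx, hy, hz, ?_⟩
  have hpm := g.map_θ_of_fixed σ hx hy
  have hrat : ∀ (K : Subalgebra ℚ M) (q : ℚ), (q : M) ∈ K := fun K q ↦ by
    simpa using algebraMap_mem K q
  have hmem : ∀ w : M, w ∈ Algebra.adjoin ℚ {w} := Algebra.self_mem_adjoin_singleton ℚ
  have hp0 : v p ≠ 0 := by simp [hp.ne_zero]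
  have hmul : ∀ {w w' : M}, (∃ n : ℤ, v w = v p ^ n) → (∃ n : ℤ, v w' = v p ^ n) →
      ∃ n : ℤ, v (w * w') = v p ^ n := by
    rintro w w' ⟨n, hn⟩ ⟨n', hn'⟩
    exact ⟨n + n', by rw [map_mul, hn, hn', zpow_add₀ hp0]⟩
  have hδ : ∃ n : ℤ, v g.δ = v p ^ n := v.isUnramifiedOn_bot hp hv _ (hrat _ _) g.δ_ne'
  have hζfix : ∀ {ζ : M}, ζ = g.z ∨ ζ = -g.z → σ ζ = ζ ∧ ζ ^ 2 = c := by
    rintro ζ (rfl | rfl)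
    · exact ⟨hz, g.z_sq⟩
    · exact ⟨by rw [map_neg, hz], by rw [neg_sq, g.z_sq]⟩
  -- If σ negates θ, it negates θ + θ'. But the square of this sum has value v(p)ⁿ = v(xⁿ)² with xⁿ
  -- fixed by σ, and p is odd, so the sum is fixed. It was chosen nonzero.
  by_cases hpa : (p : ℤ) ∣ a
  · have hp2 := hodd h.mod_four₁ hpa
    have hpb := hsqf.not_dvd_of_dvd (b := b) ⟨c, by ring⟩ hp' hpa
    have hpc := hsqf.not_dvd_of_dvd (b := c) ⟨b, by ring⟩ hp' hpa
    refine hpm.resolve_right fun hneg ↦ ?_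
    obtain ⟨ζ, hζ, hne⟩ := exists_add_ne_zero g.z (g.δ * g.t * g.β) g.θ_ne
    obtain ⟨hσζ, hζ2⟩ := hζfix hζ
    have hσθ : σ (g.θ + g.δ * g.t * g.β * ζ / g.θ) = -(g.θ + g.δ * g.t * g.β * ζ / g.θ) := by
      simp only [map_add, map_div₀, map_mul, hneg, hσζ, g.map_β σ hy, map_ratCast]
      rw [div_neg]; ring
    have hsq := g.sq_add_left hζ2
    have hval : ∃ n : ℤ, v ((g.θ + g.δ * g.t * g.β * ζ / g.θ) ^ 2) = v p ^ n := by
      have hne2 := pow_ne_zero 2 hne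
      rw [hsq] at hne2 ⊢
      have hy' := Valuation.isUnramifiedOn_adjoin_sqrt hp hv g.y_sq hpb (Or.inr hp2)
      refine hmul (hmul hδ (hy' _ ?_ g.β_ne)) ?_
      · exact add_mem (hrat _ _) (mul_mem (hrat _ _) (hmem _))
      · refine hy'.exists_of_sqrt hp hv hζ2 hpc (Or.inr hp2) ?_ ?_ (right_ne_zero_of_mul hne2)
        · exact add_mem (by exact_mod_cast hrat _ (2 * (g.a₀ * g.c₀)))
            (mul_mem (by exact_mod_cast hrat _ (2 * (g.a₁ * g.c₁ * a))) (hmem _))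
        · exact_mod_cast hrat _ (2 * g.t)
    have := Valuation.map_eq_self_of_dvd σ hσ hp hv hp2 hsqa hpa g.x_sq hx hval (Or.inr hσθ)
    rw [hσθ] at this
    exact hne (self_eq_neg.mp this.symm)
  by_cases hpb : (p : ℤ) ∣ b
  · have hp2 := hodd h.mod_four₂ hpb
    have hpc := hsqf.not_dvd_of_dvd (b := c) ⟨a, by ring⟩ hp' hpb
    refine hpm.resolve_right fun hneg ↦ ?_
    obtain ⟨ζ, hζ, hne⟩ := exists_add_ne_zero g.z (g.δ * g.t * g.α * g.x) g.θ_ne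
    rw [mul_assoc (g.δ * g.t * g.α : M)] at hne
    obtain ⟨hσζ, hζ2⟩ := hζfix hζ
    have hσθ : σ (g.θ + g.δ * g.t * g.α * (g.x * ζ) / g.θ) =
        -(g.θ + g.δ * g.t * g.α * (g.x * ζ) / g.θ) := by
      simp only [map_add, map_div₀, map_mul, hneg, hσζ, g.map_α σ hx, hx, map_ratCast]
      rw [div_neg]; ring
    have hsq := g.sq_add_right hζ2
    have hval : ∃ n : ℤ, v ((g.θ + g.δ * g.t * g.α * (g.x * ζ) / g.θ) ^ 2) = v p ^ n := by
      have hne2 := pow_ne_zero 2 hne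
      rw [hsq] at hne2 ⊢
      have hx' := Valuation.isUnramifiedOn_adjoin_sqrt hp hv g.x_sq hpa (Or.inr hp2)
      refine hmul (hmul hδ (hx' _ ?_ g.α_ne)) ?_
      · exact add_mem (hrat _ _) (mul_mem (hrat _ _) (hmem _))
      · refine hx'.exists_of_sqrt hp hv hζ2 hpc (Or.inr hp2) ?_ ?_ (right_ne_zero_of_mul hne2)
        · exact add_mem (by exact_mod_cast hrat _ (2 * (g.b₀ * g.c₀)))
            (mul_mem (by exact_mod_cast hrat _ (2 * (g.b₁ * g.c₁ * b))) (hmem _))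
        · exact mul_mem (by exact_mod_cast hrat _ (2 * g.t)) (hmem _)
    have := Valuation.map_eq_self_of_dvd σ hσ hp hv hp2 hsqb hpb g.y_sq hy hval (Or.inr hσθ)
    rw [hσθ] at this
    exact hne (self_eq_neg.mp this.symm)
  have hpab : ¬ (p : ℤ) ∣ a * b := hp'.not_dvd_mul hpa hpb
  -- For odd p ∣ c each of α, β, γ lies in a quadratic field unramified at p, so θ² itself has value
  -- a power of v(p) = v(z)².
  by_cases hpc : p ≠ 2 ∧ (p : ℤ) ∣ c
  · obtain ⟨hp2, hpc⟩ := hpc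
    refine Valuation.map_eq_self_of_dvd σ hσ hp hv hp2 hsqc hpc g.z_sq hz ?_ hpm
    rw [g.θ_sq']
    have hxy : (g.x * g.y) ^ 2 = ((a * b : ℤ) : M) := by
      push_cast; rw [mul_pow, g.x_sq, g.y_sq]
    refine hmul hδ (hmul (hmul ?_ ?_) ?_)
    · exact Valuation.isUnramifiedOn_adjoin_sqrt hp hv g.x_sq hpa (Or.inr hp2) _
        (add_mem (hrat _ _) (mul_mem (hrat _ _) (hmem _))) g.α_ne
    · exact Valuation.isUnramifiedOn_adjoin_sqrt hp hv g.y_sq hpb (Or.inr hp2) _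
        (add_mem (hrat _ _) (mul_mem (hrat _ _) (hmem _))) g.β_ne
    · exact Valuation.isUnramifiedOn_adjoin_sqrt hp hv hxy hpab (Or.inr hp2) _
        (add_mem (hrat _ _) (mul_mem (hrat _ _) (hmem _))) g.γ_ne
  obtain ⟨s, w, hs0, hs, hw, h1, hθ | hθ⟩ := hprim hpab (fun h1 h2 ↦ hpc ⟨h1, h2⟩)
  · exact Valuation.map_eq_self_of_primary σ hσ hs0 hw h1 hθ (hs hx hy) hpm
  -- Here zθ is the square root of a primary element, and z is already known to be fixed.
  · have := Valuation.map_eq_self_of_primary σ hσ (θ := g.z * g.θ) hs0 hw h1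
      (by rw [mul_pow, g.z_sq, hθ]) (hs hx hy) (by
        rw [map_mul, hz]
        exact hpm.imp (fun h ↦ by rw [h]) (fun h ↦ by rw [h, mul_neg]))
    rw [map_mul, hz] at this
    exact mul_left_cancel₀ hz0 this

end

end H8Generators

end Unramified

/-! ### Choice of the generators in an algebraic closure. -/

section Construction

open NumberField IsDedekindDomain IntermediateField

/-- The conjugates of `μ = α β γ` are `μ` or `c μ` up to squares. -/
lemma exists_map_mul_eq_sq {a c : ℤ} {E : Type*} [Field E] [CharZero E] {x α α' β β' γ γ' : E}
    {t : ℚ} (hc : (c : E) ≠ 0) (ht : (t : E) ≠ 0)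
    (hx0 : x ≠ 0) (hx : x ^ 2 = a) (hα : α * α' = t) (hβ : β * β' = t * a) (hγ : γ * γ' = t * c)
    {A B C : E} {p : Prop} (h : (A = α ∧ B = β ∧ C = γ) ∨ (p ∧ A = α' ∧ B = β ∧ C = γ') ∨
      (p ∧ A = α ∧ B = β' ∧ C = γ') ∨ (A = α' ∧ B = β' ∧ C = γ)) :
    ∃ u, u ≠ 0 ∧ (A * B * C = α * β * γ * u ^ 2 ∨
      (p ∧ A * B * C = c * (α * β * γ) * u ^ 2)) := by
  have ha0 : (a : E) ≠ 0 := hx ▸ pow_ne_zero 2 hx0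
  have hα0 : α ≠ 0 := left_ne_zero_of_mul (hα ▸ ht)
  have hβ0 : β ≠ 0 := left_ne_zero_of_mul (hβ ▸ mul_ne_zero ht ha0)
  have hγ0 : γ ≠ 0 := left_ne_zero_of_mul (hγ ▸ mul_ne_zero ht hc)
  have eα : α' = t / α := by rw [eq_div_iff hα0, mul_comm, hα]
  have eβ : β' = t * x ^ 2 / β := by rw [eq_div_iff hβ0, mul_comm, hβ, hx]
  have eγ : γ' = t * c / γ := by rw [eq_div_iff hγ0, mul_comm, hγ]
  rcases h with ⟨hA, hB, hC⟩ | ⟨hp, hA, hB, hC⟩ | ⟨hp, hA, hB, hC⟩ | ⟨hA, hB, hC⟩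
  · exact ⟨1, one_ne_zero, Or.inl (by rw [hA, hB, hC]; ring)⟩
  · refine ⟨t / (α * γ), by positivity, Or.inr ⟨hp, ?_⟩⟩
    rw [hA, hB, hC, eα, eγ]; field_simp
  · refine ⟨t * x / (β * γ), by positivity, Or.inr ⟨hp, ?_⟩⟩
    rw [hA, hB, hC, eβ, eγ]; field_simp
  · refine ⟨t * x / (α * β), by positivity, Or.inl ?_⟩
    rw [hA, hB, hC, eα, eβ]; field_simp

/-- Square roots in an algebraically closed field, a rational twist, and the resulting generators
of the quaternion extension. -/
theorem IsH8Radicands.exists_generators {a b c : ℤ} (h : IsH8Radicands a b c) {Ω : Type*} [Field Ω]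
    [CharZero Ω] [IsAlgClosed Ω] [Normal ℚ Ω] {κ : Ω} (hκ : κ ^ 2 = (a * b * c : ℤ)) :
    ∃ g : H8Generators a b c Ω, g.x * g.y * g.z = κ ∧
      ∃ (E : IntermediateField ℚ Ω) (_ : NumberField E) (μ : E), E = adjoin ℚ {g.x, g.y} ∧
        (μ : Ω) = g.θ ^ 2 ∧
        ∀ (v : HeightOneSpectrum (𝓞 E)) (p : ℕ), p.Prime → v.valuation E p < 1 →
          ¬ (p : ℤ) ∣ a * b → (p ≠ 2 → ¬ (p : ℤ) ∣ c) →
          (v.valuation E).IsPrimary μ ∨ (v.valuation E).IsPrimary (c * μ) := by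
  obtain ⟨t, a₀, a₁, b₀, b₁, c₀, c₁, ht, hα, hβ, hγ⟩ := h.exists_norms
  have ha0 : (a : Ω) ≠ 0 := by exact_mod_cast h.ne_zero₁
  have hb0 : (b : Ω) ≠ 0 := by exact_mod_cast h.ne_zero₂
  obtain ⟨x, hx⟩ := IsAlgClosed.exists_pow_nat_eq (a : Ω) two_pos
  obtain ⟨y, hy⟩ := IsAlgClosed.exists_pow_nat_eq (b : Ω) two_pos
  have hx0 : x ≠ 0 := by rintro rfl; simp [eq_comm, ha0] at hx
  have hy0 : y ≠ 0 := by rintro rfl; simp [eq_comm, hb0] at hy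
  let E : IntermediateField ℚ Ω := adjoin ℚ {x, y}
  have hxE : x ∈ E := subset_adjoin _ _ (by simp)
  have hyE : y ∈ E := subset_adjoin _ _ (by simp)
  have hxi : IsIntegral ℚ x := .of_pow two_pos (by
    rw [hx]; simpa using isIntegral_algebraMap (R := ℚ) (A := Ω) (x := (a : ℚ)))
  have hyi : IsIntegral ℚ y := .of_pow two_pos (by
    rw [hy]; simpa using isIntegral_algebraMap (R := ℚ) (A := Ω) (x := (b : ℚ)))
  have hfin : FiniteDimensional ℚ E := finiteDimensional_adjoin (by
    rintro w (rfl | rfl) <;> assumption)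
  have : NumberField E := { to_charZero := inferInstance, to_finiteDimensional := by convert hfin }
  have hnormal : Normal ℚ E := by
    convert (normal_iff_forall_map_le (K := E)).mpr fun σ ↦ ?_
    · exact Subsingleton.elim _ _
    rw [adjoin_map, adjoin_le_iff]
    have hpm : ∀ {w : Ω} {n : ℤ}, w ^ 2 = n → w ∈ E → σ w ∈ E := by
      intro w n hw hwE
      have : σ w = w ∨ σ w = -w := by
        rw [← sq_eq_sq_iff_eq_or_eq_neg, ← map_pow, hw, map_intCast]
      rcases this with h | h <;> rw [h]
      exacts [hwE, neg_mem hwE]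
    rintro _ ⟨w, rfl | rfl, rfl⟩
    exacts [hpm hx hxE, hpm hy hyE]
  have : IsGalois ℚ E := { to_normal := hnormal }
  have hgal : IsGalois ℚ E := { to_normal := hnormal }
  let x' : E := ⟨x, hxE⟩
  let y' : E := ⟨y, hyE⟩
  have hx' : x' ^ 2 = a := Subtype.ext (by simpa [x'] using hx)
  have hy' : y' ^ 2 = b := Subtype.ext (by simpa [y'] using hy)
  have hx'0 : x' ≠ 0 := fun h ↦ hx0 (congrArg Subtype.val h)
  have hy'0 : y' ≠ 0 := fun h ↦ hy0 (congrArg Subtype.val h)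
  have htE : (t : E) ≠ 0 := by exact_mod_cast ht
  have hcE : (c : E) ≠ 0 := by exact_mod_cast h.ne_zero₃
  let α : E := a₀ + a₁ * x'
  let α' : E := a₀ - a₁ * x'
  let β : E := b₀ + b₁ * y'
  let β' : E := b₀ - b₁ * y'
  let γ : E := c₀ + c₁ * (x' * y')
  let γ' : E := c₀ - c₁ * (x' * y')
  have hα' : α * α' = t := by
    have := congrArg (Rat.cast (K := E)) hα
    push_cast at this
    linear_combination this - (a₁ : E) ^ 2 * hx'
  have hβ' : β * β' = t * a := by
    have := congrArg (Rat.cast (K := E)) hβ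
    push_cast at this
    linear_combination this - (b₁ : E) ^ 2 * hy'
  have hγ' : γ * γ' = t * c := by
    have := congrArg (Rat.cast (K := E)) hγ
    push_cast at this
    linear_combination this - (c₁ : E) ^ 2 * (hx' * y' ^ 2 + a * hy')
  have hα0 : α ≠ 0 := left_ne_zero_of_mul (hα' ▸ htE)
  have hβ0 : β ≠ 0 := left_ne_zero_of_mul (hβ' ▸ mul_ne_zero htE (hx' ▸ pow_ne_zero 2 hx'0))
  have hγ0 : γ ≠ 0 := left_ne_zero_of_mul (hγ' ▸ mul_ne_zero htE hcE)
  have hconj : ∀ τ : E ≃ₐ[ℚ] E, ∃ u, u ≠ 0 ∧ (τ (α * β * γ) = α * β * γ * u ^ 2 ∨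
      (τ (x' * y') = -(x' * y') ∧ τ (α * β * γ) = c * (α * β * γ) * u ^ 2)) := by
    intro τ
    have h1 : τ x' = x' ∨ τ x' = -x' := by
      rw [← sq_eq_sq_iff_eq_or_eq_neg, ← map_pow, hx', map_intCast]
    have h2 : τ y' = y' ∨ τ y' = -y' := by
      rw [← sq_eq_sq_iff_eq_or_eq_neg, ← map_pow, hy', map_intCast]
    rw [map_mul, map_mul]
    refine exists_map_mul_eq_sq hcE htE hx'0 hx' hα' hβ' hγ' ?_
    rcases h1 with h1 | h1 <;> rcases h2 with h2 | h2
    · left; simp [α, β, γ, h1, h2]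
    · right; right; left; refine ⟨by simp [h1, h2], ?_⟩; simp [α, β, γ, β', γ', h1, h2, sub_eq_add_neg]
    · right; left; refine ⟨by simp [h1, h2], ?_⟩; simp [α, β, γ, α', γ', h1, h2, sub_eq_add_neg]
    · right; right; right; simp [α, β, γ, α', β', h1, h2, sub_eq_add_neg]
  have htop : Algebra.adjoin ℚ {x', y'} = ⊤ := by
    have key : ∀ w ∈ Algebra.adjoin ℚ {x, y}, ∃ w' ∈ Algebra.adjoin ℚ {x', y'}, (w' : Ω) = w := by
      intro w hw
      induction hw using Algebra.adjoin_induction with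
      | mem w hw =>
        rcases hw with rfl | rfl
        exacts [⟨x', Algebra.subset_adjoin (by simp), rfl⟩,
          ⟨y', Algebra.subset_adjoin (by simp), rfl⟩]
      | algebraMap q => exact ⟨algebraMap ℚ E q, algebraMap_mem _ q, by simp⟩
      | add _ _ _ _ h1 h2 =>
        obtain ⟨u, hu, rfl⟩ := h1
        obtain ⟨v, hv, rfl⟩ := h2
        exact ⟨u + v, add_mem hu hv, rfl⟩
      | mul _ _ _ _ h1 h2 =>
        obtain ⟨u, hu, rfl⟩ := h1
        obtain ⟨v, hv, rfl⟩ := h2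
        exact ⟨u * v, mul_mem hu hv, rfl⟩
    rw [eq_top_iff]
    rintro w -
    have hw : (w : Ω) ∈ E.toSubalgebra := w.2
    rw [adjoin_toSubalgebra_of_isAlgebraic (by
      rintro w (rfl | rfl)
      exacts [hxi.isAlgebraic, hyi.isAlgebraic])] at hw
    obtain ⟨w', hw', h⟩ := key w hw
    exact Subtype.ext h ▸ hw'
  obtain ⟨δ, hδ, hprim⟩ := exists_twist hx' hy' htop h.mod_four₁ h.mod_four₂ h.mod_eight
    (mul_ne_zero (mul_ne_zero hα0 hβ0) hγ0) (fun τ ↦ by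
      obtain ⟨u, hu, h1 | h1⟩ := hconj τ
      exacts [⟨u, hu, Or.inl h1⟩, ⟨u, hu, Or.inr h1.2⟩]) (fun τ hτ ↦ by
      obtain ⟨u, hu, h1 | ⟨h1, h2⟩⟩ := hconj τ
      · exact ⟨u, hu, h1⟩
      · rw [hτ] at h1
        exact absurd (self_eq_neg.mp h1) (mul_ne_zero hx'0 hy'0))
  obtain ⟨θ, hθ⟩ := IsAlgClosed.exists_pow_nat_eq
    (δ * ((a₀ + a₁ * x) * (b₀ + b₁ * y) * (c₀ + c₁ * (x * y))) : Ω) two_pos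
  have hxy0 := mul_ne_zero hx0 hy0
  refine ⟨{ x := x, y := y, z := κ / (x * y), θ := θ, t := t, δ := δ, a₀ := a₀, a₁ := a₁, b₀ := b₀,
            b₁ := b₁, c₀ := c₀, c₁ := c₁, a_ne := h.ne_zero₁, b_ne := h.ne_zero₂,
            c_ne := h.ne_zero₃, t_ne := ht, δ_ne := hδ, x_sq := hx, y_sq := hy,
            z_sq := ?_, norm_α := hα, norm_β := hβ, norm_γ := hγ, θ_sq := hθ },
    mul_div_cancel₀ κ hxy0, E, inferInstance, δ * (α * β * γ), rfl, ?_, hprim⟩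
  · rw [div_pow, hκ, mul_pow, hx, hy]
    push_cast
    field_simp
  · rw [hθ]
    simp [α, β, γ, x', y']

end Construction

/-! ### The unramified quaternion extension. -/

section Existence

open NumberField IsDedekindDomain IntermediateField

/-- Radicands of an `H₈`-factorization give an unramified quaternion extension. -/
theorem IsH8Radicands.exists_unramifiedH8Extension {a b c : ℤ} (h : IsH8Radicands a b c)
    (k : Type u) [Field k] [NumberField k] (hk : Module.finrank ℚ k = 2)
    (hd : discr k = fundamentalDiscr (a * b * c)) :
    ∃ (M : Type u) (_ : Field M) (_ : NumberField M) (_ : Algebra k M),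
      IsUnramifiedH8Extension k M ∧ Normal ℚ M := by
  obtain ⟨κ, hκ⟩ : ∃ κ : k, κ ^ 2 = (a * b * c : ℤ) := by
    obtain ⟨m, κ, hm, -, hκ, hm'⟩ := exists_discr_eq hk
    obtain rfl := fundamentalDiscr_injective hm h.squarefree (hm'.symm.trans hd)
    exact ⟨κ, hκ⟩
  let Ω := AlgebraicClosure k
  have : Algebra.IsAlgebraic ℚ Ω := Algebra.IsAlgebraic.trans ℚ k Ω
  have : IsAlgClosure ℚ Ω := ⟨inferInstance, inferInstance⟩
  have : Normal ℚ Ω := IsAlgClosure.normal ℚ Ω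
  obtain ⟨g, hxyz, E, _, μ, hE, hμ, hprim⟩ := h.exists_generators (Ω := Ω)
    (κ := algebraMap k Ω κ) (by rw [← map_pow, hκ, map_intCast])
  let M : IntermediateField ℚ Ω := adjoin ℚ {g.x, g.y, g.z, g.θ}
  have hx : g.x ∈ M := subset_adjoin _ _ (by simp)
  have hy : g.y ∈ M := subset_adjoin _ _ (by simp)
  have hz : g.z ∈ M := subset_adjoin _ _ (by simp)
  have hθ : g.θ ∈ M := subset_adjoin _ _ (by simp)
  have hfin : FiniteDimensional ℚ M := finiteDimensional_adjoin fun w _ ↦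
    (Algebra.IsAlgebraic.isAlgebraic w).isIntegral
  have : NumberField M := { to_charZero := inferInstance, to_finiteDimensional := by convert hfin }
  have hkM : ∀ w : k, algebraMap k Ω w ∈ M := by
    intro w
    obtain ⟨u, v, rfl⟩ := exists_ratCast_add_mul hk hκ h.not_isSquare₁₂₃ w
    rw [map_add, map_mul, ← hxyz, map_ratCast, map_ratCast]
    exact add_mem (by simp) (mul_mem (by simp) (mul_mem (mul_mem hx hy) hz))
  let : Algebra k M := ((algebraMap k Ω).codRestrict M hkM).toAlgebra
  let g' : H8Generators a b c M :=
    { x := ⟨g.x, hx⟩, y := ⟨g.y, hy⟩, z := ⟨g.z, hz⟩, θ := ⟨g.θ, hθ⟩, t := g.t, δ := g.δ,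
      a₀ := g.a₀, a₁ := g.a₁, b₀ := g.b₀, b₁ := g.b₁, c₀ := g.c₀, c₁ := g.c₁,
      a_ne := g.a_ne, b_ne := g.b_ne, c_ne := g.c_ne, t_ne := g.t_ne, δ_ne := g.δ_ne,
      x_sq := Subtype.ext (by simpa using g.x_sq), y_sq := Subtype.ext (by simpa using g.y_sq),
      z_sq := Subtype.ext (by simpa using g.z_sq), norm_α := g.norm_α, norm_β := g.norm_β,
      norm_γ := g.norm_γ, θ_sq := Subtype.ext (by simpa using g.θ_sq) }
  have hκM : algebraMap k M κ = g'.x * g'.y * g'.z := Subtype.ext hxyz.symm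
  have htop : adjoin ℚ {g'.x, g'.y, g'.z, g'.θ} = ⊤ := by
    have key : ∀ w ∈ M, ∃ w' ∈ adjoin ℚ {g'.x, g'.y, g'.z, g'.θ}, (w' : Ω) = w := by
      intro w hw
      induction hw using adjoin_induction with
      | mem w hw =>
        rcases hw with rfl | rfl | rfl | rfl
        exacts [⟨g'.x, subset_adjoin _ _ (by simp), rfl⟩, ⟨g'.y, subset_adjoin _ _ (by simp), rfl⟩,
          ⟨g'.z, subset_adjoin _ _ (by simp), rfl⟩, ⟨g'.θ, subset_adjoin _ _ (by simp), rfl⟩]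
      | algebraMap q => exact ⟨algebraMap ℚ M q, _root_.algebraMap_mem _ q, by simp⟩
      | add _ _ _ _ h1 h2 =>
        obtain ⟨u, hu, rfl⟩ := h1
        obtain ⟨v, hv, rfl⟩ := h2
        exact ⟨u + v, add_mem hu hv, rfl⟩
      | inv _ _ h1 =>
        obtain ⟨u, hu, rfl⟩ := h1
        exact ⟨u⁻¹, inv_mem hu, rfl⟩
      | mul _ _ _ _ h1 h2 =>
        obtain ⟨u, hu, rfl⟩ := h1
        obtain ⟨v, hv, rfl⟩ := h2
        exact ⟨u * v, mul_mem hu hv, rfl⟩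
    rw [eq_top_iff]
    rintro w -
    obtain ⟨w', hw', h⟩ := key w w.2
    exact Subtype.ext h ▸ hw'
  have hnormal : Normal ℚ M := by convert g.normal_adjoin
  have : IsGalois ℚ M := { to_normal := hnormal }
  have : IsGalois k M := IsGalois.tower_top_of_isGalois ℚ k M
  refine ⟨M, inferInstance, inferInstance, inferInstance,
    ⟨inferInstance, g'.nonempty_galois_mulEquiv h hk hκ hκM htop, fun Q _ ↦ ?_⟩, hnormal⟩
  rw [isUnramifiedAt_ringOfIntegers_iff, eq_bot_iff]
  intro σ hσ
  rw [Subgroup.mem_bot]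
  let V : HeightOneSpectrum (𝓞 M) :=
    ⟨Q, inferInstance, Ideal.IsMaximal.ne_bot_of_isIntegral_int Q⟩
  obtain ⟨p, hp, hV⟩ := HeightOneSpectrum.exists_prime_valuation_lt_one V
  have hσ' : ∀ w, V.valuation M w ≤ 1 → V.valuation M (σ w - w) < 1 := fun w hw ↦
    valuation_smul_sub_lt_one V hσ hw
  have hEM : E ≤ M := hE ▸ adjoin.mono _ _ _ (by
    rintro w (rfl | rfl) <;> simp)
  obtain ⟨h1, h2, h3, h4⟩ := g'.map_eq_self_of_inertia (v := V.valuation M) σ h hσ' hp hV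
    (by rw [← hκM, AlgEquiv.commutes]) (fun hpab hpc ↦ by
      -- Primariness holds in E = ℚ(x, y) at the prime below V and is carried up to M. The element s
      -- comes from E, so it is fixed as soon as x and y are.
      let f : E →+* M := (inclusion hEM : E →+* M)
      have hpV : (p : 𝓞 M) ∈ V.asIdeal := (HeightOneSpectrum.natCast_mem_iff V p).mpr hV
      have hpv : (p : 𝓞 E) ∈ V.asIdeal.comap (RingOfIntegers.mapRingHom f) := by
        simpa [Ideal.mem_comap] using hpV
      let v : HeightOneSpectrum (𝓞 E) :=
        ⟨V.asIdeal.comap (RingOfIntegers.mapRingHom f), inferInstance, fun hbot ↦ by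
          rw [hbot, Ideal.mem_bot, Nat.cast_eq_zero] at hpv
          exact hp.ne_zero hpv⟩
      have hf : ∀ r : 𝓞 E, r ∈ v.asIdeal ↔ RingOfIntegers.mapRingHom f r ∈ V.asIdeal :=
        fun r ↦ Ideal.mem_comap
      have hfix : σ g'.x = g'.x → σ g'.y = g'.y → ∀ s : E, σ (f s) = f s := by
        intro hσx hσy s
        have key : ∀ w ∈ adjoin ℚ {g.x, g.y}, ∃ w' : M, σ w' = w' ∧ (w' : Ω) = w := by
          intro w hw
          induction hw using adjoin_induction with
          | mem w hw =>
            rcases hw with rfl | rfl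
            exacts [⟨g'.x, hσx, rfl⟩, ⟨g'.y, hσy, rfl⟩]
          | algebraMap q => exact ⟨(q : M), map_ratCast σ q, by simp⟩
          | add _ _ _ _ h1 h2 =>
            obtain ⟨u, hu, rfl⟩ := h1
            obtain ⟨v, hv, rfl⟩ := h2
            exact ⟨u + v, by rw [map_add, hu, hv], rfl⟩
          | inv _ _ h1 =>
            obtain ⟨u, hu, rfl⟩ := h1
            exact ⟨u⁻¹, by rw [map_inv₀, hu], rfl⟩
          | mul _ _ _ _ h1 h2 =>
            obtain ⟨u, hu, rfl⟩ := h1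
            obtain ⟨v, hv, rfl⟩ := h2
            exact ⟨u * v, by rw [map_mul, hu, hv], rfl⟩
        obtain ⟨w', hw', h⟩ := key s (hE ▸ s.2)
        rwa [show f s = w' from Subtype.ext h.symm]
      have hfμ : f μ = g'.θ ^ 2 := Subtype.ext hμ
      rcases hprim v p hp ((HeightOneSpectrum.natCast_mem_iff v p).mp hpv) hpab hpc with hh | hh
      · obtain ⟨s, w, hs, hw, hw1, hsw⟩ := hh
        refine ⟨f s, f w, by simpa using hs, fun hx hy ↦ hfix hx hy s, valuation_map_le_one hf hw,
          ?_, Or.inl ?_⟩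
        · simpa [map_ofNat f 4] using valuation_map_eq_one hf hw1
        · rw [← hfμ, hsw]
          simp [map_ofNat f 4]
      · obtain ⟨s, w, hs, hw, hw1, hsw⟩ := hh
        refine ⟨f s, f w, by simpa using hs, fun hx hy ↦ hfix hx hy s, valuation_map_le_one hf hw,
          ?_, Or.inr ?_⟩
        · simpa [map_ofNat f 4] using valuation_map_eq_one hf hw1
        · rw [← hfμ, ← map_intCast f, ← map_mul, hsw]
          simp [map_ofNat f 4])
  exact g'.algEquiv_ext htop h1 h2 h3 h4

end Existence

/-! ### Generation by inertia, and quadratic characters. -/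

section InertiaGeneration

open NumberField IsDedekindDomain

/-- The square root of a nonsquare generates a quadratic field. -/
lemma finrank_adjoin_sqrt {L : Type*} [Field L] [CharZero L] {m : ℤ} (hm : ¬ IsSquare m) {x : L}
    (hx : x ^ 2 = m) : Module.finrank ℚ (IntermediateField.adjoin ℚ {x}) = 2 := by
  have hirr : Irreducible (Polynomial.X ^ 2 - Polynomial.C (m : ℚ)) :=
    X_pow_sub_C_irreducible_of_prime Nat.prime_two fun b hb ↦
      hm (Rat.isSquare_intCast_iff.mp ⟨b, by rw [← hb, sq]⟩)
  have hmonic : (Polynomial.X ^ 2 - Polynomial.C (m : ℚ)).Monic :=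
    Polynomial.monic_X_pow_sub_C _ two_ne_zero
  have heval : Polynomial.aeval x (Polynomial.X ^ 2 - Polynomial.C (m : ℚ)) = 0 := by simp [hx]
  have hint : IsIntegral ℚ x := ⟨_, hmonic, heval⟩
  rw [IntermediateField.adjoin.finrank hint, ← minpoly.eq_of_irreducible_of_monic hirr heval hmonic,
    Polynomial.natDegree_X_pow_sub_C]

variable {K M : Type*} [Field K] [NumberField K] [Field M] [NumberField M] [Algebra K M]
  [IsGalois ℚ M]

/-- A prime of `K` is unramified over `ℤ` if some inertia group above it fixes `K`. -/
lemma isUnramifiedAt_int_of_inertia (P : Ideal (𝓞 K)) [P.IsMaximal] (Q : Ideal (𝓞 M)) [Q.IsMaximal]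
    [Q.LiesOver P]
    (h : ∀ τ ∈ Q.inertia (M ≃ₐ[ℚ] M), ∀ w : K, τ (algebraMap K M w) = algebraMap K M w) :
    Algebra.IsUnramifiedAt ℤ P := by
  have : IsGalois K M := IsGalois.tower_top_of_isGalois ℚ K M
  have h1 := card_inertia_eq_ramificationIdx ℤ (k := ℚ) Q
  have h2 := card_inertia_eq_ramificationIdx (𝓞 K) (k := K) Q
  -- The whole inertia group over ℚ is K-linear, so the ramification index over ℤ is at most that
  -- over K, and multiplicativity leaves index 1 for P.
  have h3 : Nat.card (Q.inertia (M ≃ₐ[ℚ] M)) ≤ Nat.card (Q.inertia (M ≃ₐ[K] M)) := by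
    refine Nat.card_le_card_of_injective (fun τ ↦ ⟨AlgEquiv.ofRingEquiv (f := (τ : M ≃ₐ[ℚ] M))
      (h τ τ.2), fun r ↦ τ.2 r⟩) fun τ τ' hτ ↦ ?_
    ext w
    exact DFunLike.congr_fun (congrArg Subtype.val hτ) w
  have h4 := Ideal.ramificationIdx_tower (R := ℤ) P Q
  rw [← Ideal.ramificationIdx_eq_one_iff]
  have h5 : 0 < Q.ramificationIdx (𝓞 K) := by
    rw [← h2]; exact Nat.card_pos
  rw [h1, h2, h4] at h3
  have h6 : 0 < Q.ramificationIdx ℤ := by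
    rw [← h1]; exact Nat.card_pos
  rw [h4] at h6
  nlinarith [Nat.pos_of_mul_pos_right h6, Nat.pos_of_mul_pos_left h6]

/-- The inertia groups generate the Galois group over `ℚ`. -/
theorem closure_inertia_eq_top :
    Subgroup.closure {τ : M ≃ₐ[ℚ] M | ∃ Q : Ideal (𝓞 M), Q.IsMaximal ∧
      τ ∈ Q.inertia (M ≃ₐ[ℚ] M)} = ⊤ := by
  set H := Subgroup.closure {τ : M ≃ₐ[ℚ] M | ∃ Q : Ideal (𝓞 M), Q.IsMaximal ∧
      τ ∈ Q.inertia (M ≃ₐ[ℚ] M)} with hH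
  let K := IntermediateField.fixedField H
  -- Minkowski: the fixed field of all inertia groups is unramified over ℚ, hence equal to ℚ.
  have hK : Module.finrank ℚ K = 1 := by
    by_contra hne
    obtain ⟨P, hP, hram⟩ := NumberField.exists_not_isUnramifiedAt_int (K := K) (𝒪 := 𝓞 K) hne
    obtain ⟨Q, hQ, hQP⟩ := Ideal.exists_ideal_over_maximal_of_isIntegral (S := 𝓞 M) P (by simp)
    have : Q.LiesOver P := ⟨hQP.symm⟩
    refine hram (isUnramifiedAt_int_of_inertia P Q fun τ hτ w ↦ ?_)
    exact w.2 ⟨τ, Subgroup.subset_closure ⟨Q, hQ, hτ⟩⟩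
  rw [IntermediateField.finrank_eq_one_iff] at hK
  rw [← IntermediateField.fixingSubgroup_fixedField H, show IntermediateField.fixedField H = ⊥ from hK,
    IntermediateField.fixingSubgroup_bot]

/-- A prime dividing the discriminant of a quadratic subfield has an inertia group that acts
nontrivially on the subfield. -/
lemma exists_inertia_of_dvd_fundamentalDiscr {m : ℤ} (hm : Squarefree m) (hm1 : m ≠ 1) {x : M}
    (hx : x ^ 2 = m) {p : ℕ} (hp : p.Prime) (hpm : (p : ℤ) ∣ fundamentalDiscr m) :
    ∃ v : HeightOneSpectrum (𝓞 M), v.valuation M p < 1 ∧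
      ∃ τ ∈ v.asIdeal.inertia (M ≃ₐ[ℚ] M), τ x ≠ x := by
  have hns := not_isSquare_of_squarefree hm hm1
  let K : IntermediateField ℚ M := IntermediateField.adjoin ℚ {x}
  have hxK : x ∈ K := IntermediateField.mem_adjoin_simple_self ℚ x
  have hfin : Module.finrank ℚ K = 2 := by
    convert finrank_adjoin_sqrt hns hx
  have hdisc : discr K = fundamentalDiscr m :=
    discr_of_sq_eq (x := (⟨x, hxK⟩ : K)) hfin (Subtype.ext (by simpa using hx)) hm hm1
  rw [← hdisc] at hpm
  have h1 := mt (NumberField.not_dvd_discr_iff_forall_mem K (𝓞 K)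
    (Nat.prime_iff_prime_int.mp hp)).mpr (not_not.mpr hpm)
  push Not at h1
  obtain ⟨P, hP, hpP, hram⟩ := h1
  have hP0 : P ≠ ⊥ := by
    rintro rfl
    rw [Ideal.mem_bot] at hpP
    exact hp.ne_zero (by exact_mod_cast hpP)
  have : P.IsMaximal := hP.isMaximal hP0
  obtain ⟨Q, hQ, hQP⟩ := Ideal.exists_ideal_over_maximal_of_isIntegral (S := 𝓞 M) P (by simp)
  have : Q.LiesOver P := ⟨hQP.symm⟩
  refine ⟨⟨Q, inferInstance, Ideal.IsMaximal.ne_bot_of_isIntegral_int Q⟩, ?_, ?_⟩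
  · rw [← HeightOneSpectrum.natCast_mem_iff]
    have : algebraMap (𝓞 K) (𝓞 M) p ∈ Q := by rw [← Ideal.mem_comap, hQP]; exact_mod_cast hpP
    simpa using this
  · by_contra! hfix
    refine hram (isUnramifiedAt_int_of_inertia P Q fun τ hτ w ↦ ?_)
    obtain ⟨u, v, rfl⟩ := exists_ratCast_add_mul (x := (⟨x, hxK⟩ : K)) hfin
      (Subtype.ext (by simpa using hx)) hns w
    simp only [map_add, map_mul, map_ratCast]
    rw [show τ (algebraMap K M ⟨x, hxK⟩) = algebraMap K M ⟨x, hxK⟩ from hfix τ hτ]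

/-- Every quadratic character of the Galois group is realized by the square root of a squarefree
integer. -/
lemma exists_sqrt_of_character (χ : (M ≃ₐ[ℚ] M) →* ℤˣ) (hχ : ∃ σ, χ σ = -1) :
    ∃ (m : ℤ) (x : M), Squarefree m ∧ m ≠ 1 ∧ x ^ 2 = m ∧
      ∀ σ, σ x = ((χ σ : ℤ) : M) * x := by
  -- A Lagrange resolvent, nonzero for some w by the linear independence of automorphisms. It is an
  -- eigenvector for χ, so its square is rational.
  obtain ⟨w, hw⟩ : ∃ w : M, ∑ σ : M ≃ₐ[ℚ] M, ((χ σ : ℤ) : M) * σ w ≠ 0 := by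
    by_contra! h
    have hli := (linearIndependent_monoidHom M M).comp
      (fun σ : M ≃ₐ[ℚ] M ↦ ((σ : M →+* M) : M →* M)) (fun σ τ h ↦ by
        ext w; exact DFunLike.congr_fun h w)
    have := Fintype.linearIndependent_iff.mp hli (fun σ ↦ ((χ σ : ℤ) : M)) (by
      ext w; simpa using h w) 1
    simp at this
  set y := ∑ σ : M ≃ₐ[ℚ] M, ((χ σ : ℤ) : M) * σ w with hy
  have hχsq : ∀ σ, ((χ σ : ℤ) : M) * ((χ σ : ℤ) : M) = 1 := fun σ ↦ by
    rcases Int.units_eq_one_or (χ σ) with h | h <;> simp [h]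
  have hσy : ∀ σ, σ y = ((χ σ : ℤ) : M) * y := by
    intro σ
    rw [hy, map_sum, Finset.mul_sum]
    refine Fintype.sum_equiv (Equiv.mulLeft σ) _ _ fun τ ↦ ?_
    simp only [Equiv.coe_mulLeft, map_mul, map_intCast, Units.val_mul, Int.cast_mul,
      AlgEquiv.mul_apply]
    linear_combination -((χ τ : ℤ) : M) * σ (τ w) * hχsq σ
  have hsq : ∃ q : ℚ, y ^ 2 = q := by
    have : y ^ 2 ∈ (⊥ : IntermediateField ℚ M) := by
      rw [IsGalois.mem_bot_iff_fixed]
      intro σ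
      rw [map_pow, hσy, mul_pow, sq (((χ σ : ℤ) : M)), hχsq, one_mul]
    obtain ⟨q, hq⟩ := IntermediateField.mem_bot.mp this
    exact ⟨q, by simpa using hq.symm⟩
  obtain ⟨q, hq⟩ := hsq
  have hq0 : q ≠ 0 := by
    rintro rfl
    simp [hw] at hq
  obtain ⟨m, r, hm, hr, hmr⟩ := exists_squarefree_mul_sq (n := q.num * q.den)
    (mul_ne_zero (Rat.num_ne_zero.mpr hq0) (by exact_mod_cast q.den_ne_zero))
  have hden : (q.den : M) ≠ 0 := by exact_mod_cast q.den_ne_zero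
  have hrM : (r : M) ≠ 0 := by exact_mod_cast hr
  have e1 : (q : M) * q.den = q.num := by exact_mod_cast Rat.mul_den_eq_num q
  have e2 : (q.num : M) * q.den = m * r ^ 2 := by exact_mod_cast hmr
  have hx : (y * (q.den / r : ℚ)) ^ 2 = m := by
    push_cast
    rw [mul_pow, div_pow, hq, mul_div_assoc', div_eq_iff (pow_ne_zero 2 hrM)]
    linear_combination (q.den : M) * e1 + e2
  have hσx : ∀ σ, σ (y * (q.den / r : ℚ)) = ((χ σ : ℤ) : M) * (y * (q.den / r : ℚ)) := fun σ ↦ by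
    rw [map_mul, hσy, map_ratCast, mul_assoc]
  refine ⟨m, _, hm, ?_, hx, hσx⟩
  rintro rfl
  obtain ⟨σ, hσ⟩ := hχ
  have h1 : y * (q.den / r : ℚ) = 1 ∨ y * (q.den / r : ℚ) = -1 := by
    rw [← sq_eq_one_iff, hx, Int.cast_one]
  have h2 := hσx σ
  rw [hσ] at h2
  rcases h1 with h1 | h1 <;> rw [h1] at h2 <;> norm_num at h2

end InertiaGeneration

/-! ### Groups containing H₈ with index two and generated by involutions outside it. -/

section QuaternionCharacters

variable {G : Type*} [Group G]

open Classical in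
/-- The sign character of a subgroup of index at most two. -/
noncomputable def Subgroup.signHom (P : Subgroup G) (h : ∀ a b, a ∉ P → b ∉ P → a * b ∈ P) :
    G →* ℤˣ where
  toFun a := if a ∈ P then 1 else -1
  map_one' := by simp
  map_mul' a b := by
    by_cases ha : a ∈ P <;> by_cases hb : b ∈ P
    · simp [ha, hb, mul_mem ha hb]
    · simp [ha, hb, P.mul_mem_cancel_left ha]
    · simp [ha, hb, P.mul_mem_cancel_right hb]
    · simp [ha, hb, h a b ha hb]

lemma Subgroup.signHom_of_mem {P : Subgroup G} {h : ∀ a b, a ∉ P → b ∉ P → a * b ∈ P} {a : G}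
    (ha : a ∈ P) : P.signHom h a = 1 := if_pos ha

lemma Subgroup.signHom_of_notMem {P : Subgroup G} {h : ∀ a b, a ∉ P → b ∉ P → a * b ∈ P} {a : G}
    (ha : a ∉ P) : P.signHom h a = -1 := if_neg ha

namespace QuaternionGroup

/-- The subgroup `N` is a quaternion group of index two in `G`, with generators `i`, `j` and
central involution `z`, and `T` is a set of involutions outside `N` that generates `G`. -/
structure IsGeneratedByInvolutions (N : Subgroup G) (i j z : G) (T : Set G) : Prop where
  normal : N.Normal
  mul_mem_of_notMem : ∀ a b, a ∉ N → b ∉ N → a * b ∈ N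
  i_mem : i ∈ N
  j_mem : j ∈ N
  z_mem : z ∈ N
  z_ne_one : z ≠ 1
  z_mul_z : z * z = 1
  inv_eq : ∀ n ∈ N, n⁻¹ = n ∨ n⁻¹ = n * z
  eq_one_or_eq_z : ∀ n ∈ N, n * n = 1 → n = 1 ∨ n = z
  i_mul_j : j * i = i * j * z
  exists_eq : ∀ n ∈ N, ∃ u, (u = 1 ∨ u = i ∨ u = j ∨ u = i * j) ∧ (n = u ∨ n = u * z)
  closure_eq : Subgroup.closure T = ⊤
  notMem : ∀ t ∈ T, t ∉ N
  mul_self : ∀ t ∈ T, t * t = 1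

namespace IsGeneratedByInvolutions

variable {N : Subgroup G} {i j z : G} {T : Set G}

/-- z is the only involution of the normal subgroup N. -/
lemma commute_z (h : IsGeneratedByInvolutions N i j z T)
    (g : G) : g * z = z * g := by
  have key : g * z * g⁻¹ = z := by
    refine (h.eq_one_or_eq_z _ (h.normal.conj_mem z h.z_mem g) ?_).resolve_left ?_
    · rw [show g * z * g⁻¹ * (g * z * g⁻¹) = g * (z * z) * g⁻¹ by group, h.z_mul_z]; group
    · intro h1
      exact h.z_ne_one (by simpa using h1)
  rw [mul_inv_eq_iff_eq_mul] at key
  exact key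

/-- Conjugation by t inverts the products tx with x ∈ T, and inversion in N changes an element by 1
or z. The elements of N on which t acts in this way are closed under products, and as T generates G,
every g or tg is one of them. For n ∈ N the product tn is outside N, so n is one. Automorphisms of N
permuting i, j, ij are thereby excluded. -/
lemma conj_generator (h : IsGeneratedByInvolutions N i j z T)
    {t : G} (ht : t ∈ T) {n : G} (hn : n ∈ N) :
    t * n = n * t ∨ t * n = n * z * t := by
  have htt := h.mul_self t ht
  have htinv : t⁻¹ = t := inv_eq_of_mul_eq_one_left htt
  have hz := h.commute_z
  let good : G → Prop := fun n ↦ n ∈ N ∧ (t * n = n * t ∨ t * n = n * z * t)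
  have good_mul : ∀ a b, good a → good b → good (a * b) := by
    rintro a b ⟨ha, ha'⟩ ⟨hb, hb'⟩
    refine ⟨mul_mem ha hb, ?_⟩
    rcases ha' with ha' | ha' <;> rcases hb' with hb' | hb'
    · left; rw [← mul_assoc, ha', mul_assoc, hb', mul_assoc]
    · right; rw [← mul_assoc, ha', mul_assoc, hb']; group
    · right
      rw [← mul_assoc, ha', mul_assoc, hb', mul_assoc a z, ← mul_assoc z b t, ← hz b]; group
    · left
      rw [← mul_assoc, ha', mul_assoc, hb', mul_assoc a z, mul_assoc b z t, ← mul_assoc z b,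
        ← hz b, mul_assoc b z, ← mul_assoc z z, h.z_mul_z]; group
  have good_z : good z := ⟨h.z_mem, Or.inl (hz t)⟩
  have good_T : ∀ x ∈ T, good (t * x) := by
    intro x hx
    have hmem : t * x ∈ N := h.mul_mem_of_notMem t x (h.notMem t ht) (h.notMem x hx)
    have hxinv : x⁻¹ = x := inv_eq_of_mul_eq_one_left (h.mul_self x hx)
    have e : t * (t * x) = (t * x)⁻¹ * t := by
      rw [mul_inv_rev, htinv, hxinv, ← mul_assoc, htt, mul_assoc, htt]; group
    refine ⟨hmem, ?_⟩
    rw [e]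
    rcases h.inv_eq _ hmem with h1 | h1 <;> rw [h1]
    · exact Or.inl rfl
    · exact Or.inr rfl
  have good_conj : ∀ n, good n → good (t * n * t) := by
    rintro n ⟨hn, hn'⟩
    have e : t * n * t = n ∨ t * n * t = n * z := by
      rcases hn' with hn' | hn' <;> rw [hn', mul_assoc, htt] <;> simp
    rcases e with e | e <;> rw [e]
    · exact ⟨hn, hn'⟩
    · exact good_mul _ _ ⟨hn, hn'⟩ good_z
  have main : ∀ g : G, good g ∨ good (t * g) := by
    intro g
    have hg : g ∈ Subgroup.closure T := h.closure_eq ▸ Subgroup.mem_top g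
    have step : ∀ x ∈ T, ∀ y, good y ∨ good (t * y) → good (x * y) ∨ good (t * (x * y)) := by
      intro x hx y hy
      rcases hy with hy | hy
      · right; rw [← mul_assoc]; exact good_mul _ _ (good_T x hx) hy
      · left
        have := good_mul _ _ (good_conj _ (good_T x hx)) hy
        rwa [show t * (t * x) * t * (t * y) = (t * t) * x * (t * t) * y by group, htt, one_mul,
          mul_one] at this
    induction hg using Subgroup.closure_induction_left with
    | one => exact Or.inl ⟨one_mem _, Or.inl (by simp)⟩
    | mul_left x hx y _ hy => exact step x hx y hy
    | inv_mul_cancel x hx y _ hy =>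
      rw [inv_eq_of_mul_eq_one_left (h.mul_self x hx)]
      exact step x hx y hy
  rcases main n with h1 | h1
  · exact h1.2
  · exact absurd ((N.mul_mem_cancel_right hn).mp h1.1) (h.notMem t ht)

/-- Triviality on N modulo z passes from the generators to G. Hence, for u in N, commuting with u or
not is a quadratic character of G. -/
lemma conj_eq (h : IsGeneratedByInvolutions N i j z T)
    (g : G) {n : G} (hn : n ∈ N) : g * n = n * g ∨ g * n = n * z * g := by
  have hz := h.commute_z
  have hg : g ∈ Subgroup.closure T := h.closure_eq ▸ Subgroup.mem_top g
  have step : ∀ x ∈ T, ∀ y, (y * n = n * y ∨ y * n = n * z * y) →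
      (x * y * n = n * (x * y) ∨ x * y * n = n * z * (x * y)) := by
    intro x hx y hy
    rcases hy with hy | hy <;> rcases h.conj_generator hx hn with h1 | h1
    · left; rw [mul_assoc, hy, ← mul_assoc, h1, mul_assoc]
    · right; rw [mul_assoc, hy, ← mul_assoc, h1, mul_assoc]
    · right
      rw [mul_assoc, hy, mul_assoc n, ← mul_assoc x, h1, mul_assoc n x, ← mul_assoc x z, hz x]; group
    · left
      rw [mul_assoc, hy, mul_assoc n, ← mul_assoc x, h1, mul_assoc (n * z) x, ← mul_assoc x z, hz x,
        mul_assoc z x, mul_assoc n z, ← mul_assoc z z, h.z_mul_z]; group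
  induction hg using Subgroup.closure_induction_left with
  | one => exact Or.inl (by simp)
  | mul_left x hx y _ hy => exact step x hx y hy
  | inv_mul_cancel x hx y _ hy =>
    rw [inv_eq_of_mul_eq_one_left (h.mul_self x hx)]
    exact step x hx y hy

lemma mul_mem_centralizer (h : IsGeneratedByInvolutions N i j z T)
    {u : G} (hu : u ∈ N) (a b : G) (ha : a ∉ Subgroup.centralizer {u})
    (hb : b ∉ Subgroup.centralizer {u}) : a * b ∈ Subgroup.centralizer {u} := by
  rw [Subgroup.mem_centralizer_singleton_iff] at ha hb ⊢
  have h1 := (h.conj_eq a hu).resolve_left ha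
  have h2 := (h.conj_eq b hu).resolve_left hb
  have hz := h.commute_z
  rw [mul_assoc, h2, mul_assoc u, ← mul_assoc a, h1, mul_assoc (u * z) a, ← mul_assoc a z, hz a,
    mul_assoc z a, mul_assoc u z, ← mul_assoc z z, h.z_mul_z]
  group

lemma mul_mem (h : IsGeneratedByInvolutions N i j z T) : i * j ∈ N := N.mul_mem h.i_mem h.j_mem

/-- The sign of the conjugation action on an element of `N`. -/
noncomputable def conjSign (h : IsGeneratedByInvolutions N i j z T) {u : G} (hu : u ∈ N) :
    G →* ℤˣ :=
  (Subgroup.centralizer {u}).signHom (h.mul_mem_centralizer hu)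

/-- The character of `G` with kernel `N`. -/
noncomputable def sign (h : IsGeneratedByInvolutions N i j z T) : G →* ℤˣ :=
  N.signHom h.mul_mem_of_notMem

lemma conjSign_eq_one (h : IsGeneratedByInvolutions N i j z T) {u : G} (hu : u ∈ N) {g : G} :
    h.conjSign hu g = 1 ↔ g * u = u * g := by
  rw [← Subgroup.mem_centralizer_singleton_iff]
  refine ⟨fun h1 ↦ ?_, fun h1 ↦ Subgroup.signHom_of_mem h1⟩
  by_contra h2
  rw [conjSign, Subgroup.signHom_of_notMem h2] at h1
  exact absurd h1 (by decide)

lemma sign_eq_one (h : IsGeneratedByInvolutions N i j z T) {g : G} : h.sign g = 1 ↔ g ∈ N := by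
  refine ⟨fun h1 ↦ ?_, fun h1 ↦ Subgroup.signHom_of_mem h1⟩
  by_contra h2
  rw [sign, Subgroup.signHom_of_notMem h2] at h1
  exact absurd h1 (by decide)

lemma mul_eq_of_conjSign_ne_one (h : IsGeneratedByInvolutions N i j z T) {u : G} (hu : u ∈ N)
    {g : G} (h1 : h.conjSign hu g ≠ 1) : g * u = u * z * g :=
  (h.conj_eq g hu).resolve_left (mt (h.conjSign_eq_one hu).mpr h1)

lemma ne_mul_z (h : IsGeneratedByInvolutions N i j z T) (u g : G) : u * g ≠ u * z * g := by
  intro h1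
  rw [mul_assoc] at h1
  have h2 := mul_left_cancel h1
  exact h.z_ne_one (right_eq_mul.mp h2)

lemma conjSign_mul (h : IsGeneratedByInvolutions N i j z T) (g : G) :
    h.conjSign h.mul_mem g = h.conjSign h.i_mem g * h.conjSign h.j_mem g := by
  have hz := h.commute_z
  have hneg : ∀ {s : ℤˣ}, s ≠ 1 → s = -1 := fun hs ↦ (Int.units_eq_one_or _).resolve_left hs
  by_cases hi : h.conjSign h.i_mem g = 1 <;> by_cases hj : h.conjSign h.j_mem g = 1
  · rw [hi, hj, mul_one, conjSign_eq_one]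
    rw [conjSign_eq_one] at hi hj
    rw [← mul_assoc, hi, mul_assoc, hj, mul_assoc]
  · rw [hi, hneg hj, one_mul]
    refine hneg fun h1 ↦ ?_
    rw [conjSign_eq_one] at hi h1
    have hj' := h.mul_eq_of_conjSign_ne_one _ hj
    rw [← mul_assoc, hi, mul_assoc i g, hj'] at h1
    exact h.ne_mul_z (i * j) g (by rw [← h1]; group)
  · rw [hj, hneg hi, mul_one]
    refine hneg fun h1 ↦ ?_
    rw [conjSign_eq_one] at hj h1
    have hi' := h.mul_eq_of_conjSign_ne_one _ hi
    rw [← mul_assoc, hi', mul_assoc (i * z) g, hj, mul_assoc i z, ← mul_assoc z j, ← hz j] at h1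
    exact h.ne_mul_z (i * j) g (by rw [← h1]; group)
  · rw [hneg hi, hneg hj]
    rw [show (-1 : ℤˣ) * -1 = 1 by decide, conjSign_eq_one]
    have hi' := h.mul_eq_of_conjSign_ne_one _ hi
    have hj' := h.mul_eq_of_conjSign_ne_one _ hj
    rw [← mul_assoc, hi', mul_assoc (i * z) g, hj', mul_assoc j z, mul_assoc i z, ← mul_assoc z j,
      ← hz j, mul_assoc j z, ← mul_assoc z z, h.z_mul_z]
    group

lemma conjSign_i_j (h : IsGeneratedByInvolutions N i j z T) : h.conjSign h.i_mem j = -1 := by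
  refine (Int.units_eq_one_or _).resolve_left fun h1 ↦ ?_
  rw [conjSign_eq_one, h.i_mul_j] at h1
  exact h.z_ne_one (by simpa using h1)

lemma conjSign_j_i (h : IsGeneratedByInvolutions N i j z T) : h.conjSign h.j_mem i = -1 := by
  refine (Int.units_eq_one_or _).resolve_left fun h1 ↦ ?_
  rw [conjSign_eq_one, h.i_mul_j] at h1
  exact h.z_ne_one (by simpa using h1)

/-- No involution in `T` centralizes `N`. -/
lemma not_conjSign_eq_one (h : IsGeneratedByInvolutions N i j z T) {t : G} (ht : t ∈ T) :
    ¬ (h.conjSign h.i_mem t = 1 ∧ h.conjSign h.j_mem t = 1) := by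
  rintro ⟨hi, hj⟩
  have hk : h.conjSign h.mul_mem t = 1 := by rw [conjSign_mul, hi, hj, mul_one]
  rw [conjSign_eq_one] at hi hj hk
  have hz := h.commute_z
  have hN : ∀ n ∈ N, t * n = n * t := by
    intro n hn
    obtain ⟨u, hu, hnu⟩ := h.exists_eq n hn
    have h1 : t * u = u * t := by
      rcases hu with rfl | rfl | rfl | rfl
      exacts [by simp, hi, hj, hk]
    rcases hnu with rfl | rfl
    · exact h1
    · rw [← mul_assoc, h1, mul_assoc, hz, ← mul_assoc]
  have htt := h.mul_self t ht
  -- If t centralizes N, then (tx)² = 1 for x ∈ T, so tx is 1 or z and T ⊆ {t, tz}. Then G would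
  -- centralize i, which j does not.
  have hT : T ⊆ Subgroup.centralizer {i} := by
    intro x hx
    have hmem : t * x ∈ N := h.mul_mem_of_notMem t x (h.notMem t ht) (h.notMem x hx)
    have h1 : t * x * (t * x) = 1 := by
      rw [← mul_assoc, ← hN _ hmem, ← mul_assoc, htt, one_mul, h.mul_self x hx]
    rw [SetLike.mem_coe, Subgroup.mem_centralizer_singleton_iff]
    have hx' : x = t * (t * x) := by rw [← mul_assoc, htt, one_mul]
    rcases h.eq_one_or_eq_z _ hmem h1 with h2 | h2 <;> rw [h2] at hx' <;> rw [hx']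
    · simpa using hi
    · rw [mul_assoc, ← hz i, ← mul_assoc, hi, mul_assoc]
  have h2 : j ∈ Subgroup.centralizer {i} :=
    (Subgroup.closure_le _).mpr hT (h.closure_eq ▸ Subgroup.mem_top j)
  rw [Subgroup.mem_centralizer_singleton_iff, ← h.conjSign_eq_one h.i_mem, h.conjSign_i_j] at h2
  exact absurd h2 (by decide)

lemma conjSign_cases (h : IsGeneratedByInvolutions N i j z T) {t : G} (ht : t ∈ T) :
    (h.conjSign h.i_mem t = 1 ∧ h.conjSign h.j_mem t = -1 ∧ h.conjSign h.mul_mem t = -1) ∨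
    (h.conjSign h.i_mem t = -1 ∧ h.conjSign h.j_mem t = 1 ∧ h.conjSign h.mul_mem t = -1) ∨
    (h.conjSign h.i_mem t = -1 ∧ h.conjSign h.j_mem t = -1 ∧ h.conjSign h.mul_mem t = 1) := by
  have h1 := h.not_conjSign_eq_one ht
  rw [h.conjSign_mul]
  rcases Int.units_eq_one_or (h.conjSign h.i_mem t) with hi | hi <;>
    rcases Int.units_eq_one_or (h.conjSign h.j_mem t) with hj | hj <;> simp_all

/-- An element commuting with `t ∈ T` commutes with every basic element of `N` that commutes
with `t`. -/
lemma conjSign_of_commute (h : IsGeneratedByInvolutions N i j z T) {t g u : G} (ht : t ∈ T)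
    (hu : u = i ∨ u = j ∨ u = i * j) (huN : u ∈ N) (htu : h.conjSign huN t = 1)
    (hg : g * t = t * g) : h.conjSign huN g = 1 := by
  have hz := h.commute_z
  have key : ∀ g ∈ N, g * t = t * g → h.conjSign huN g = 1 := by
    intro g hgN hg
    obtain ⟨u', hu', hgu⟩ := h.exists_eq g hgN
    have h1 : t * u' = u' * t := by
      rcases hgu with rfl | rfl
      · exact hg.symm
      · rw [mul_assoc, ← hz t, ← mul_assoc, ← mul_assoc] at hg
        exact (mul_right_cancel hg).symm
    -- Exactly one of i, j, ij commutes with t, so up to z an element of N commuting with t is 1 or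
    -- u.
    have huu : u' = 1 ∨ u' = u := by
      have hc : (t * i = i * t ∧ ¬ t * j = j * t ∧ ¬ t * (i * j) = i * j * t) ∨
          (¬ t * i = i * t ∧ t * j = j * t ∧ ¬ t * (i * j) = i * j * t) ∨
          (¬ t * i = i * t ∧ ¬ t * j = j * t ∧ t * (i * j) = i * j * t) := by
        simp only [← h.conjSign_eq_one h.i_mem, ← h.conjSign_eq_one h.j_mem,
          ← h.conjSign_eq_one h.mul_mem]
        have := h.conjSign_cases ht
        rcases this with ⟨h1, h2, h3⟩ | ⟨h1, h2, h3⟩ | ⟨h1, h2, h3⟩ <;> rw [h1, h2, h3] <;> decide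
      rw [conjSign_eq_one] at htu
      rcases hu' with e' | e' | e' | e'
      · exact Or.inl e'
      all_goals
        right
        rw [e'] at h1
        rcases hu with e | e | e <;> rw [e] at htu <;>
          first | exact e'.trans e.symm | (exfalso; tauto)
    rw [conjSign_eq_one]
    rcases huu with e | e <;> rcases hgu with e' | e' <;> rw [e', e]
    · simp
    · rw [one_mul, hz u]
    · rw [mul_assoc, ← hz u]
  by_cases hgN : g ∈ N
  · exact key g hgN hg
  · have h1 := key (t * g) (h.mul_mem_of_notMem t g (h.notMem t ht) hgN) (by
      rw [mul_assoc, hg])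
    rwa [map_mul, htu, one_mul] at h1

/-- Three characters of `G` whose product has kernel `N`, such that every involution in `T` is
detected by exactly one of them. -/
theorem exists_characters (h : IsGeneratedByInvolutions N i j z T) : ∃ χ : Fin 3 → G →* ℤˣ,
    (∀ n, ∃ g, χ n g = -1) ∧ (∀ g, χ 0 g * χ 1 g * χ 2 g = 1 ↔ g ∈ N) ∧
    (∀ t ∈ T, ∀ n m, χ n t = -1 → χ m t = -1 → n = m) ∧
    (∀ t ∈ T, ∀ g, g * t = t * g → ∀ n, χ n t = -1 → χ (n + 1) g * χ (n + 2) g = 1) := by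
  have hsq : ∀ s : ℤˣ, s * s = 1 := by decide
  have hT : ∀ t ∈ T, h.sign t = -1 := fun t ht ↦
    (Int.units_eq_one_or _).resolve_left (mt h.sign_eq_one.mp (h.notMem t ht))
  have hneg : ∀ s : ℤˣ, -1 * s = -1 ↔ s = 1 := by decide
  -- The sign of t is −1, so the n-th character is −1 on t exactly if t commutes with the n-th of i,
  -- j, ij. In the product of two characters `sign` cancels and the third conjugation sign remains.
  refine ⟨![h.sign * h.conjSign h.i_mem, h.sign * h.conjSign h.j_mem,
    h.sign * h.conjSign h.mul_mem], ?_, ?_, ?_, ?_⟩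
  · have hi := h.sign_eq_one.mpr h.i_mem
    have hj := h.sign_eq_one.mpr h.j_mem
    intro n
    fin_cases n
    · exact ⟨j, by simp [hj, h.conjSign_i_j]⟩
    · exact ⟨i, by simp [hi, h.conjSign_j_i]⟩
    · refine ⟨i, ?_⟩
      have := (h.conjSign_eq_one h.i_mem (g := i)).mpr rfl
      simp [hi, h.conjSign_mul, h.conjSign_j_i, this]
  · intro g
    rw [← h.sign_eq_one]
    simp only [Matrix.cons_val, MonoidHom.mul_apply, h.conjSign_mul]
    generalize h.sign g = s, h.conjSign h.i_mem g = s₁, h.conjSign h.j_mem g = s₂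
    revert s s₁ s₂
    decide
  · intro t ht n m hn hm
    have hc := h.conjSign_cases ht
    fin_cases n <;> fin_cases m <;>
      simp only [Fin.zero_eta, Fin.mk_one, Fin.reduceFinMk, Matrix.cons_val, MonoidHom.mul_apply,
        hT t ht, hneg] at hn hm ⊢ <;>
      rcases hc with ⟨h1, h2, h3⟩ | ⟨h1, h2, h3⟩ | ⟨h1, h2, h3⟩ <;> simp_all
  · intro t ht g hg n hn
    have hmul := h.conjSign_mul g
    have e : ∀ s s₁ s₂ : ℤˣ, s * s₁ * (s * s₂) = s₁ * s₂ := by decide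
    fin_cases n <;>
      simp only [Fin.zero_eta, Fin.mk_one, Fin.reduceFinMk, Matrix.cons_val, MonoidHom.mul_apply,
        hT t ht, hneg, Fin.reduceAdd, zero_add] at hn ⊢ <;> rw [e]
    · have h1 := h.conjSign_of_commute ht (Or.inl rfl) h.i_mem hn hg
      rw [hmul, h1, one_mul, hsq]
    · have h1 := h.conjSign_of_commute ht (Or.inr (Or.inl rfl)) h.j_mem hn hg
      rw [hmul, h1, mul_one, hsq]
    · have h1 := h.conjSign_of_commute ht (Or.inr (Or.inr rfl)) h.mul_mem hn hg
      rw [← hmul, h1]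

/-- An embedded quaternion group of index two. -/
lemma of_injective {ι : QuaternionGroup 2 →* G} (hι : Function.Injective ι)
    (hN : ι.range.Normal) (hmul : ∀ a b, a ∉ ι.range → b ∉ ι.range → a * b ∈ ι.range)
    (hT : Subgroup.closure T = ⊤) (hTN : ∀ t ∈ T, t ∉ ι.range) (hT1 : ∀ t ∈ T, t * t = 1) :
    IsGeneratedByInvolutions ι.range (ι (.a 1)) (ι (.xa 0)) (ι (.a 2)) T where
  normal := hN
  mul_mem_of_notMem := hmul
  i_mem := ⟨_, rfl⟩
  j_mem := ⟨_, rfl⟩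
  z_mem := ⟨_, rfl⟩
  z_ne_one := by
    rw [← map_one ι]
    exact hι.ne (by decide)
  z_mul_z := by
    rw [← map_mul, ← map_one ι]
    exact congrArg ι (by decide)
  inv_eq := by
    rintro _ ⟨n, rfl⟩
    rw [← map_inv, ← map_mul, hι.eq_iff, hι.eq_iff]
    revert n; decide
  eq_one_or_eq_z := by
    rintro _ ⟨n, rfl⟩
    rw [← map_mul, ← map_one ι, hι.eq_iff, hι.eq_iff, hι.eq_iff]
    revert n; decide
  i_mul_j := by
    simp only [← map_mul]
    exact congrArg ι (by decide)
  exists_eq := by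
    rintro _ ⟨n, rfl⟩
    have key : ∀ n : QuaternionGroup 2, ∃ u : QuaternionGroup 2,
        (u = 1 ∨ u = .a 1 ∨ u = .xa 0 ∨ u = .a 1 * .xa 0) ∧ (n = u ∨ n = u * .a 2) := by decide
    obtain ⟨u, hu, hn⟩ := key n
    refine ⟨ι u, ?_, ?_⟩
    · rcases hu with rfl | rfl | rfl | rfl <;> simp only [map_one, map_mul, true_or, or_true]
    · rcases hn with rfl | rfl <;> simp
  closure_eq := hT
  notMem := hTN
  mul_self := hT1

end IsGeneratedByInvolutions

end QuaternionGroup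

end QuaternionCharacters

/-! ### Frobenius elements and Kronecker symbols. -/

section Symbols

open NumberField IsDedekindDomain

variable {M : Type*} [Field M] [NumberField M]

/-- If a Frobenius element at `p` fixes a square root of `D`, then the quadratic polynomial of
discriminant `D` has a root modulo `p`. -/
lemma exists_root_of_frobenius {v : HeightOneSpectrum (𝓞 M)} {p : ℕ} (hp : p.Prime)
    (hv : v.valuation M p < 1) {G : Type*} [Group G] [MulSemiringAction G M] {σ : G}
    (hσ : ∀ r : 𝓞 M, σ • r - r ^ p ∈ v.asIdeal) {D e : ℤ} (hD : D ^ 2 - D = 4 * e) {ω : M}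
    (hω : ω ^ 2 = D) (hfix : σ • ω = ω) : ∃ n : ℤ, (p : ℤ) ∣ n ^ 2 - D * n + e := by
  have hD' : (D : M) ^ 2 - D = 4 * e := by exact_mod_cast congrArg (Int.cast (R := M)) hD
  -- The polynomial X² − DX + e has discriminant D² − 4e = D; it serves p = 2 and odd p alike.
  have hr : ((D + ω) / 2) ^ 2 = D * ((D + ω) / 2) - e := by
    linear_combination (1 / 4 : M) * hω - (1 / 4 : M) * hD'
  have hint : IsIntegral ℤ ((D + ω) / 2) :=
    isIntegral_of_quadratic (isIntegral_algebraMap (R := ℤ) (x := D))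
      (isIntegral_algebraMap (R := ℤ) (x := e)) (by simpa using hr)
  let r : 𝓞 M := ⟨(D + ω) / 2, hint⟩
  have hr' : r ^ 2 = D * r - e := RingOfIntegers.ext hr
  have hσr : σ • r = r := by
    refine RingOfIntegers.ext ?_
    change σ • ((D + ω) / 2) = (D + ω) / 2
    have h2 : σ • (2 : M) = 2 := map_ofNat (MulSemiringAction.toRingHom G M σ) 2
    have h3 : σ • (D : M) = D := map_intCast (MulSemiringAction.toRingHom G M σ) D
    rw [div_eq_mul_inv, smul_mul', smul_add, smul_inv'', h2, h3, hfix]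
  have : v.asIdeal.IsMaximal := v.isMaximal
  let := Ideal.Quotient.field v.asIdeal
  have hp0 : ((p : ℕ) : 𝓞 M ⧸ v.asIdeal) = 0 := by
    have := (HeightOneSpectrum.natCast_mem_iff v p).mpr hv
    rw [← Ideal.Quotient.eq_zero_iff_mem] at this
    simpa using this
  have : Fact p.Prime := ⟨hp⟩
  have : CharP (𝓞 M ⧸ v.asIdeal) p := (CharP.charP_iff_prime_eq_zero hp).mpr hp0
  -- The root is fixed by Frobenius, so its residue equals its p-th power and lies in the prime
  -- field.
  have hpow : (Ideal.Quotient.mk v.asIdeal r) ^ p = Ideal.Quotient.mk v.asIdeal r := by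
    have h1 := hσ r
    rw [hσr, ← Ideal.Quotient.eq_zero_iff_mem, map_sub, map_pow, sub_eq_zero] at h1
    exact h1.symm
  obtain ⟨n, hn⟩ : ∃ n : ℤ, Ideal.Quotient.mk v.asIdeal r = n := by
    obtain ⟨n, hn⟩ := (mem_bot_iff_intCast p (𝓞 M ⧸ v.asIdeal)).mp
      ((Subfield.mem_bot_iff_pow_eq_self (𝓞 M ⧸ v.asIdeal) p).mpr hpow)
    exact ⟨n, hn.symm⟩
  refine ⟨n, ?_⟩
  rw [← CharP.intCast_eq_zero_iff (𝓞 M ⧸ v.asIdeal) p]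
  have := congrArg (Ideal.Quotient.mk v.asIdeal) hr'
  simp only [map_pow, map_sub, map_mul, map_intCast, hn] at this
  push_cast
  linear_combination this

/-- For odd p complete the square. For p = 2 the number n(n − D) is even since D is odd, so e is
even, and D(D − 1) = 4e gives D ≡ 1 mod 8. -/
lemma kroneckerSymbol_eq_one_of_root {p : ℕ} [hp : Fact p.Prime] {D e n : ℤ}
    (hD : D ^ 2 - D = 4 * e) (hpD : ¬ (p : ℤ) ∣ D) (hn : (p : ℤ) ∣ n ^ 2 - D * n + e) :
    kroneckerSymbol D p = 1 := by
  by_cases hp2 : p = 2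
  · subst hp2
    rw [kroneckerSymbol_two_eq_one_iff]
    have h2 : (2 : ℤ) ∣ e := by
      have h3 : Even (n * (n - D)) := by
        rw [Int.even_mul, Int.even_sub]
        have : ¬ Even D := fun h ↦ hpD (by exact_mod_cast h.two_dvd)
        tauto
      have h4 : e = (n ^ 2 - D * n + e) - n * (n - D) := by ring
      rw [h4]
      exact dvd_sub (by exact_mod_cast hn) h3.two_dvd
    obtain ⟨f, rfl⟩ := h2
    have h8 : (8 : ℤ) ∣ D - 1 := by
      refine IsCoprime.dvd_of_dvd_mul_left (y := D) ?_ ⟨f, by linear_combination hD⟩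
      rw [show (8 : ℤ) = 2 ^ 3 by norm_num]
      exact IsCoprime.pow_left ((Int.prime_two.coprime_iff_not_dvd).mpr (by exact_mod_cast hpD))
    omega
  · rw [kroneckerSymbol, if_neg hp2, legendreSym.eq_one_iff]
    · obtain ⟨c, hc⟩ := hn
      refine ⟨(2 * n - D : ℤ), ?_⟩
      have h1 : D = (2 * n - D) * (2 * n - D) - p * (4 * c) := by
        linear_combination -4 * hc - hD
      have h2 := congrArg (Int.cast (R := ZMod p)) h1
      push_cast at h2 ⊢
      rwa [ZMod.natCast_self, zero_mul, sub_zero] at h2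
    · rwa [Ne, ZMod.intCast_zmod_eq_zero_iff_dvd]

end Symbols

/-! ### Coprime discriminants and their symbols. -/

section Factorization

open NumberField IsDedekindDomain

lemma isQuadraticDiscriminant_fundamentalDiscr {m : ℤ} (hm : Squarefree m) (hm1 : m ≠ 1) :
    IsQuadraticDiscriminant (fundamentalDiscr m) := by
  obtain ⟨x, hx⟩ := IsAlgClosed.exists_pow_nat_eq (m : AlgebraicClosure ℚ) two_pos
  have hfin := finrank_adjoin_sqrt (not_isSquare_of_squarefree hm hm1) hx
  let K : IntermediateField ℚ (AlgebraicClosure ℚ) := IntermediateField.adjoin ℚ {x}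
  have : FiniteDimensional ℚ K := Module.finite_of_finrank_eq_succ (n := 1) hfin
  have hxK : x ∈ K := IntermediateField.mem_adjoin_simple_self ℚ x
  have : NumberField K := { to_charZero := inferInstance, to_finiteDimensional := by convert this }
  have hfin' : Module.finrank ℚ K = 2 := by convert hfin
  exact ⟨K, inferInstance, this, hfin',
    discr_of_sq_eq (x := (⟨x, hxK⟩ : K)) hfin' (Subtype.ext (by simpa using hx)) hm hm1⟩

lemma exists_sq_mul_eq_fundamentalDiscr (m : ℤ) : ∃ c : ℤ, fundamentalDiscr m = c ^ 2 * m := by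
  rw [fundamentalDiscr]
  split_ifs
  · exact ⟨1, by ring⟩
  · exact ⟨2, by ring⟩

/-- Discriminants are 0 or 1 modulo 4, hence so are products of them; `e` is the constant term of
the quadratic polynomial with that discriminant. -/
lemma four_dvd_fundamentalDiscr_mul (m n : ℤ) : ∃ e : ℤ,
    (fundamentalDiscr m * fundamentalDiscr n) ^ 2 - fundamentalDiscr m * fundamentalDiscr n =
      4 * e := by
  have key : ∀ m, fundamentalDiscr m % 4 = 0 ∨ fundamentalDiscr m % 4 = 1 := fun m ↦ by
    rw [fundamentalDiscr]
    split_ifs <;> omega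
  change (4 : ℤ) ∣ _
  rw [← Int.modEq_zero_iff_dvd]
  have h : fundamentalDiscr m * fundamentalDiscr n ≡ 0 [ZMOD 4] ∨
      fundamentalDiscr m * fundamentalDiscr n ≡ 1 [ZMOD 4] := by
    simp only [Int.ModEq, Int.mul_emod (fundamentalDiscr m)]
    rcases key m with h | h <;> rcases key n with h' | h' <;> simp [h, h']
  rcases h with h | h
  · simpa using (h.pow 2).sub h
  · simpa using (h.pow 2).sub h

variable {M : Type*} [Field M] [NumberField M]

lemma conj_mem_inertia {Q Q' : Ideal (𝓞 M)} {g τ : M ≃ₐ[ℚ] M}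
    (hg : ∀ r, r ∈ Q ↔ g • r ∈ Q') (hτ : τ ∈ Q.inertia (M ≃ₐ[ℚ] M)) :
    g * τ * g⁻¹ ∈ Q'.inertia (M ≃ₐ[ℚ] M) := by
  intro r
  have h : τ • (g⁻¹ • r) - g⁻¹ • r ∈ Q := hτ (g⁻¹ • r)
  rw [hg, smul_sub, smul_inv_smul, smul_smul, smul_smul] at h
  exact h

/-- Since σ • r ≡ r ^ p, a Frobenius element stabilizes its prime, and so normalizes the inertia
group. -/
lemma mem_iff_smul_mem_of_frobenius {Q : Ideal (𝓞 M)} [Q.IsPrime] {p : ℕ} (hp : p ≠ 0)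
    {σ : M ≃ₐ[ℚ] M} (hσ : ∀ r : 𝓞 M, σ • r - r ^ p ∈ Q) (r : 𝓞 M) : r ∈ Q ↔ σ • r ∈ Q := by
  rw [← Ideal.IsPrime.pow_mem_iff_mem ‹Q.IsPrime› p (Nat.pos_of_ne_zero hp)]
  constructor
  · intro h
    simpa using add_mem (hσ r) h
  · intro h
    simpa using sub_mem h (hσ r)

lemma eq_neg_one_of_ne {χ : (M ≃ₐ[ℚ] M) →* ℤˣ} {x : M} (hx : ∀ σ, σ x = ((χ σ : ℤ) : M) * x)
    {τ : M ≃ₐ[ℚ] M} (h : τ x ≠ x) : χ τ = -1 := by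
  refine (Int.units_eq_one_or (χ τ)).resolve_left fun h1 ↦ h ?_
  rw [hx, h1, Units.val_one, Int.cast_one, one_mul]

variable [IsGalois ℚ M]

/-- A common prime divisor p would give inertia elements above p moving x and x'. The primes above p
are conjugate, and an inertia group has only one nontrivial element, so the two are conjugate.
Characters are constant on conjugacy classes, so both would be −1 on the same involution. -/
lemma isCoprime_fundamentalDiscr
    (hI : ∀ Q : Ideal (𝓞 M), Q.IsMaximal → ∀ τ ∈ Q.inertia (M ≃ₐ[ℚ] M),
      ∀ τ' ∈ Q.inertia (M ≃ₐ[ℚ] M), τ ≠ 1 → τ' ≠ 1 → τ = τ')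
    {χ χ' : (M ≃ₐ[ℚ] M) →* ℤˣ} {m m' : ℤ} {x x' : M} (hm : Squarefree m) (hm1 : m ≠ 1)
    (hx : x ^ 2 = m) (hχ : ∀ σ, σ x = ((χ σ : ℤ) : M) * x) (hm' : Squarefree m') (hm1' : m' ≠ 1)
    (hx' : x' ^ 2 = m') (hχ' : ∀ σ, σ x' = ((χ' σ : ℤ) : M) * x')
    (h : ∀ Q : Ideal (𝓞 M), Q.IsMaximal → ∀ τ ∈ Q.inertia (M ≃ₐ[ℚ] M), τ ≠ 1 → χ τ = -1 →
      χ' τ ≠ -1) : IsCoprime (fundamentalDiscr m) (fundamentalDiscr m') := by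
  rw [Int.isCoprime_iff_gcd_eq_one]
  by_contra hgcd
  obtain ⟨p, hp, hpd⟩ := Nat.exists_prime_and_dvd hgcd
  have hpd' := Int.natCast_dvd_natCast.mpr hpd
  obtain ⟨v, hv, τ, hτ, hτx⟩ := exists_inertia_of_dvd_fundamentalDiscr hm hm1 hx hp
    (hpd'.trans (Int.gcd_dvd_left ..))
  obtain ⟨v', hv', τ', hτ', hτx'⟩ := exists_inertia_of_dvd_fundamentalDiscr hm' hm1' hx' hp
    (hpd'.trans (Int.gcd_dvd_right ..))
  obtain ⟨ρ, hρ⟩ := HeightOneSpectrum.exists_algEquiv v v' hp hv hv'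
  have hconj : ρ * τ * ρ⁻¹ = τ' := by
    refine hI v'.asIdeal v'.isMaximal _ (conj_mem_inertia hρ hτ) _ hτ' ?_ ?_
    · rw [Ne, conj_eq_one_iff]
      rintro rfl
      exact hτx rfl
    · rintro rfl
      exact hτx' rfl
  refine h v'.asIdeal v'.isMaximal τ' hτ' ?_ ?_ (eq_neg_one_of_ne hχ' hτx')
  · rintro rfl
    exact hτx' rfl
  · rw [← hconj, map_mul, map_mul, map_inv, mul_inv_cancel_comm, eq_neg_one_of_ne hχ hτx]

/-- Frobenius normalizes an inertia group with a single nontrivial element τ, so it commutes with τ.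
By hypothesis it then fixes x₁x₂, so the polynomial whose discriminant is the product of the two
discriminants has a root modulo p. -/
lemma kroneckerSymbol_fundamentalDiscr
    (hI : ∀ Q : Ideal (𝓞 M), Q.IsMaximal → ∀ τ ∈ Q.inertia (M ≃ₐ[ℚ] M),
      ∀ τ' ∈ Q.inertia (M ≃ₐ[ℚ] M), τ ≠ 1 → τ' ≠ 1 → τ = τ')
    {χ χ₁ χ₂ : (M ≃ₐ[ℚ] M) →* ℤˣ} {m m₁ m₂ : ℤ} {x x₁ x₂ : M} (hm : Squarefree m) (hm1 : m ≠ 1)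
    (hx : x ^ 2 = m) (hχ : ∀ σ, σ x = ((χ σ : ℤ) : M) * x)
    (hx₁ : x₁ ^ 2 = m₁) (hχ₁ : ∀ σ, σ x₁ = ((χ₁ σ : ℤ) : M) * x₁)
    (hx₂ : x₂ ^ 2 = m₂) (hχ₂ : ∀ σ, σ x₂ = ((χ₂ σ : ℤ) : M) * x₂)
    (hc₁ : IsCoprime (fundamentalDiscr m) (fundamentalDiscr m₁))
    (hc₂ : IsCoprime (fundamentalDiscr m) (fundamentalDiscr m₂))
    (h : ∀ Q : Ideal (𝓞 M), Q.IsMaximal → ∀ τ ∈ Q.inertia (M ≃ₐ[ℚ] M), τ ≠ 1 → χ τ = -1 →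
      ∀ σ, σ * τ = τ * σ → χ₁ σ * χ₂ σ = 1)
    {p : ℕ} [hp : Fact p.Prime] (hpm : (p : ℤ) ∣ fundamentalDiscr m) :
    kroneckerSymbol (fundamentalDiscr m₁ * fundamentalDiscr m₂) p = 1 := by
  obtain ⟨v, hv, τ, hτ, hτx⟩ := exists_inertia_of_dvd_fundamentalDiscr hm hm1 hx hp.out hpm
  have hτ1 : τ ≠ 1 := by
    rintro rfl
    exact hτx rfl
  obtain ⟨σ, hσ⟩ := HeightOneSpectrum.exists_frobenius v hp.out hv
  have hconj : σ * τ * σ⁻¹ = τ :=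
    hI v.asIdeal v.isMaximal _
      (conj_mem_inertia (mem_iff_smul_mem_of_frobenius hp.out.ne_zero hσ) hτ) _ hτ
      (mt conj_eq_one_iff.mp hτ1) hτ1
  have hχσ := h v.asIdeal v.isMaximal τ hτ hτ1 (eq_neg_one_of_ne hχ hτx) σ
    (mul_inv_eq_iff_eq_mul.mp hconj)
  obtain ⟨c₁, hc₁'⟩ := exists_sq_mul_eq_fundamentalDiscr m₁
  obtain ⟨c₂, hc₂'⟩ := exists_sq_mul_eq_fundamentalDiscr m₂
  obtain ⟨e, he⟩ := four_dvd_fundamentalDiscr_mul m₁ m₂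
  obtain ⟨n, hn⟩ := exists_root_of_frobenius hp.out hv hσ he (ω := c₁ * c₂ * (x₁ * x₂)) (by
    rw [hc₁', hc₂']
    push_cast
    rw [← hx₁, ← hx₂]
    ring) (by
    have hM : (((χ₁ σ : ℤ) : M)) * ((χ₂ σ : ℤ) : M) = 1 := by
      rw [← Int.cast_mul, ← Units.val_mul, hχσ, Units.val_one, Int.cast_one]
    rw [AlgEquiv.smul_def, map_mul, map_mul, map_mul, map_intCast, map_intCast, hχ₁, hχ₂]
    linear_combination (c₁ * c₂ * (x₁ * x₂) : M) * hM)
  refine kroneckerSymbol_eq_one_of_root he (fun hdvd ↦ ?_) hn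
  have hpZ := Nat.prime_iff_prime_int.mp hp.out
  rcases hpZ.dvd_or_dvd hdvd with h' | h'
  · exact hpZ.not_isUnit (hc₁.isUnit_of_dvd' hpm h')
  · exact hpZ.not_isUnit (hc₂.isUnit_of_dvd' hpm h')

/-- Squarefree integers whose square roots differ by a rational factor are equal. -/
lemma eq_of_squarefree_of_mul_sq_eq {m n : ℤ} (hm : Squarefree m) (hn : Squarefree n) {q : ℚ}
    (h : (m : ℚ) = q ^ 2 * n) : m = n := by
  obtain ⟨z, rfl⟩ := isInteger_of_mul_sq hn (r := q) (n := m) (by rw [h, mul_comm])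
  have hz : m = z ^ 2 * n := by exact_mod_cast h
  have : IsUnit z := hm z ⟨n, by rw [hz, sq]⟩
  rw [hz, sq, Int.isUnit_mul_self this, one_mul]

lemma fundamentalDiscr_mul_mul {a b c : ℤ}
    (hab : IsCoprime (fundamentalDiscr a) (fundamentalDiscr b))
    (hbc : IsCoprime (fundamentalDiscr b) (fundamentalDiscr c))
    (hca : IsCoprime (fundamentalDiscr c) (fundamentalDiscr a)) :
    fundamentalDiscr (a * b * c) = fundamentalDiscr a * fundamentalDiscr b * fundamentalDiscr c := by
  have hpair : ∀ {x y : ℤ}, IsCoprime x y → 2 ∣ x → ¬ 2 ∣ y := fun hxy hx hy ↦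
    Int.prime_two.not_isUnit (hxy.isUnit_of_dvd' hx hy)
  have key : ∀ a b c : ℤ, ¬ 2 ∣ fundamentalDiscr a → ¬ 2 ∣ fundamentalDiscr b →
      fundamentalDiscr (a * b * c) =
        fundamentalDiscr a * fundamentalDiscr b * fundamentalDiscr c := by
    intro a b c ha hb
    obtain ⟨ha1, ha4⟩ := fundamentalDiscr_of_odd ha
    obtain ⟨hb1, hb4⟩ := fundamentalDiscr_of_odd hb
    rw [mul_assoc, fundamentalDiscr_mul ha4, fundamentalDiscr_mul hb4, ha1, hb1, mul_assoc]
  by_cases h₁ : 2 ∣ fundamentalDiscr a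
  · rw [mul_assoc, mul_comm a, key b c a (hpair hab h₁) (hpair hca.symm h₁)]
    ring
  by_cases h₂ : 2 ∣ fundamentalDiscr b
  · rw [mul_comm, ← mul_assoc, key c a b (hpair hbc h₂) h₁]
    ring
  · exact key a b c h₁ h₂

end Factorization

/-! ### The factorization attached to an unramified quaternion extension. -/

section Necessity

open NumberField IsDedekindDomain

variable {k M : Type*} [Field k] [NumberField k] [Field M] [NumberField M] [Algebra k M]

/-- An automorphism that fixes a generator of the quadratic field `k` is `k`-linear. -/
lemma mem_range_restrictScalars_iff (hk : Module.finrank ℚ k = 2) {m : ℤ} (hm : Squarefree m)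
    (hm1 : m ≠ 1) {x : k} (hx : x ^ 2 = m) (σ : M ≃ₐ[ℚ] M) :
    (∃ τ : M ≃ₐ[k] M, τ.restrictScalars ℚ = σ) ↔ σ (algebraMap k M x) = algebraMap k M x := by
  constructor
  · rintro ⟨τ, rfl⟩
    exact τ.commutes x
  · intro h
    refine ⟨AlgEquiv.ofRingEquiv (f := (σ : M ≃+* M)) fun w ↦ ?_, by ext; rfl⟩
    obtain ⟨u, v, rfl⟩ := exists_ratCast_add_mul hk hx (not_isSquare_of_squarefree hm hm1) w
    change σ _ = _
    simp only [map_add, map_mul, map_ratCast, h]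

/-- An automorphism of `M` lying in an inertia group of an extension unramified over `k` is trivial
as soon as it is `k`-linear. -/
lemma IsUnramifiedAtFinitePrimes.eq_one_of_mem_inertia [IsGalois k M]
    (h : IsUnramifiedAtFinitePrimes k M) {Q : Ideal (𝓞 M)} (hQ : Q.IsMaximal) {τ : M ≃ₐ[k] M}
    (hτ : τ.restrictScalars ℚ ∈ Q.inertia (M ≃ₐ[ℚ] M)) : τ = 1 := by
  rw [← Subgroup.mem_bot, ← (isUnramifiedAt_ringOfIntegers_iff Q).mp (h Q)]
  exact fun r ↦ hτ r

/-- Inertia meets N = Gal(M/k) trivially and N has index two, so the product of any two nontrivial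
elements of an inertia group is 1. They are therefore a single involution outside N, and the group
theory of `IsGeneratedByInvolutions` applies. -/
theorem IsUnramifiedH8Extension.exists_factorization (hk : Module.finrank ℚ k = 2)
    (h : IsUnramifiedH8Extension k M) [Normal ℚ M] :
    ∃ d₁ d₂ d₃ : ℤ, IsH8Factorization (discr k) d₁ d₂ d₃ := by
  have := h.isGalois
  have : IsGalois ℚ M := {}
  obtain ⟨e⟩ := h.galoisGroup
  obtain ⟨m₀, x₀, hm₀, hm₀1, hx₀, hdisc⟩ := exists_discr_eq hk
  set y := algebraMap k M x₀ with hy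
  have hysq : y ^ 2 = m₀ := by rw [hy, ← map_pow, hx₀, map_intCast]
  have hy0 : y ≠ 0 := by
    rintro h0
    rw [h0, zero_pow two_ne_zero, eq_comm, Int.cast_eq_zero] at hysq
    exact hm₀.ne_zero hysq
  have hyσ : ∀ σ : M ≃ₐ[ℚ] M, σ y = y ∨ σ y = -y := fun σ ↦ by
    rw [← sq_eq_sq_iff_eq_or_eq_neg, ← map_pow, hysq, map_intCast]
  let ι : QuaternionGroup 2 →* (M ≃ₐ[ℚ] M) :=
    (MonoidHom.mk' (AlgEquiv.restrictScalars ℚ : (M ≃ₐ[k] M) → _) fun _ _ ↦ rfl).comp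
      e.symm.toMonoidHom
  have hι : Function.Injective ι :=
    (AlgEquiv.restrictScalars_injective ℚ).comp e.symm.injective
  have hmem : ∀ σ, σ ∈ ι.range ↔ σ y = y := fun σ ↦ by
    rw [← mem_range_restrictScalars_iff hk hm₀ hm₀1 hx₀]
    exact (e.symm.surjective.exists (p := fun τ ↦ τ.restrictScalars ℚ = σ)).symm
  have hnotMem : ∀ σ, σ ∉ ι.range ↔ σ y = -y := fun σ ↦ by
    rw [hmem]
    constructor
    · exact (hyσ σ).resolve_left
    · intro h1 h2
      exact hy0 (self_eq_neg.mp (h2.symm.trans h1))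
  have hmul : ∀ a b, a ∉ ι.range → b ∉ ι.range → a * b ∈ ι.range := by
    intro a b ha hb
    rw [hnotMem] at ha hb
    rw [hmem, AlgEquiv.mul_apply, hb, map_neg, ha, neg_neg]
  have hN : ι.range.Normal := ⟨fun n hn g ↦ by
    rw [hmem] at hn ⊢
    rw [AlgEquiv.mul_apply, AlgEquiv.mul_apply]
    have : n (g⁻¹ y) = g⁻¹ y := by
      rcases hyσ g⁻¹ with h1 | h1 <;> simp only [h1, map_neg, hn]
    rw [this, ← AlgEquiv.mul_apply, mul_inv_cancel, AlgEquiv.one_apply]⟩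
  have hIN : ∀ Q : Ideal (𝓞 M), Q.IsMaximal → ∀ τ ∈ Q.inertia (M ≃ₐ[ℚ] M), τ ∈ ι.range →
      τ = 1 := by
    intro Q hQ τ hτ hτN
    obtain ⟨τ', rfl⟩ := (mem_range_restrictScalars_iff hk hm₀ hm₀1 hx₀ τ).mpr ((hmem τ).mp hτN)
    rw [h.unramified.eq_one_of_mem_inertia hQ hτ]
    rfl
  have hmul1 : ∀ Q : Ideal (𝓞 M), Q.IsMaximal → ∀ τ ∈ Q.inertia (M ≃ₐ[ℚ] M),
      ∀ τ' ∈ Q.inertia (M ≃ₐ[ℚ] M), τ ≠ 1 → τ' ≠ 1 → τ * τ' = 1 :=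
    fun Q hQ τ hτ τ' hτ' h1 h1' ↦ hIN Q hQ _ (mul_mem hτ hτ')
      (hmul _ _ (mt (hIN Q hQ τ hτ) h1) (mt (hIN Q hQ τ' hτ') h1'))
  have hI : ∀ Q : Ideal (𝓞 M), Q.IsMaximal → ∀ τ ∈ Q.inertia (M ≃ₐ[ℚ] M),
      ∀ τ' ∈ Q.inertia (M ≃ₐ[ℚ] M), τ ≠ 1 → τ' ≠ 1 → τ = τ' :=
    fun Q hQ τ hτ τ' hτ' h1 h1' ↦ mul_right_cancel (b := τ')
      ((hmul1 Q hQ τ hτ τ' hτ' h1 h1').trans (hmul1 Q hQ τ' hτ' τ' hτ' h1' h1').symm)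
  let T : Set (M ≃ₐ[ℚ] M) :=
    {τ | τ ≠ 1 ∧ ∃ Q : Ideal (𝓞 M), Q.IsMaximal ∧ τ ∈ Q.inertia (M ≃ₐ[ℚ] M)}
  have hT : Subgroup.closure T = ⊤ := by
    rw [eq_top_iff, ← closure_inertia_eq_top, Subgroup.closure_le]
    intro τ hτ
    by_cases h1 : τ = 1
    · exact h1 ▸ one_mem _
    · exact Subgroup.subset_closure ⟨h1, hτ⟩
  obtain ⟨χ, hχ1, hχN, hχT, hχc⟩ := (QuaternionGroup.IsGeneratedByInvolutions.of_injective hι hN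
    hmul hT (fun τ ⟨h1, Q, hQ, hτ⟩ ↦ mt (hIN Q hQ τ hτ) h1)
    (fun τ ⟨h1, Q, hQ, hτ⟩ ↦ hmul1 Q hQ τ hτ τ hτ h1 h1)).exists_characters
  choose m x hm hm1 hx hχx using fun n ↦ exists_sqrt_of_character (χ n) (hχ1 n)
  have hcop : ∀ n n', n ≠ n' → IsCoprime (fundamentalDiscr (m n)) (fundamentalDiscr (m n')) :=
    fun n n' hne ↦ isCoprime_fundamentalDiscr hI (hm n) (hm1 n) (hx n) (hχx n) (hm n') (hm1 n')
      (hx n') (hχx n') fun Q hQ τ hτ h1 h2 h3 ↦ hne (hχT τ ⟨h1, Q, hQ, hτ⟩ n n' h2 h3)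
  have hsymb : ∀ (n : Fin 3) (p : ℕ) [Fact p.Prime], (p : ℤ) ∣ fundamentalDiscr (m n) →
      kroneckerSymbol (fundamentalDiscr (m (n + 1)) * fundamentalDiscr (m (n + 2))) p = 1 :=
    fun n p _ hp ↦ kroneckerSymbol_fundamentalDiscr hI (hm n) (hm1 n) (hx n) (hχx n) (hx _) (hχx _)
      (hx _) (hχx _) (hcop _ _ (by clear hp; revert n; decide))
      (hcop _ _ (by clear hp; revert n; decide))
      (fun Q hQ τ hτ h1 h2 σ hσ ↦ hχc τ ⟨h1, Q, hQ, hτ⟩ σ hσ n h2) hp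
  -- The product of the three characters is the character of k, so the product of the three square
  -- roots is a rational multiple of √m₀; both radicands are squarefree.
  have hprod : m 0 * m 1 * m 2 = m₀ := by
    have hcop' : ∀ n n', n ≠ n' → IsCoprime (m n) (m n') := fun n n' hne ↦
      ((hcop n n' hne).of_isCoprime_of_dvd_left (dvd_fundamentalDiscr _)).of_isCoprime_of_dvd_right
        (dvd_fundamentalDiscr _)
    have hsf : Squarefree (m 0 * m 1 * m 2) := by
      rw [squarefree_mul_iff, squarefree_mul_iff]
      exact ⟨((hcop' 0 2 (by decide)).mul_left (hcop' 1 2 (by decide))).isRelPrime,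
        ⟨(hcop' 0 1 (by decide)).isRelPrime, hm 0, hm 1⟩, hm 2⟩
    have hbot : x 0 * x 1 * x 2 / y ∈ (⊥ : IntermediateField ℚ M) := by
      rw [IsGalois.mem_bot_iff_fixed]
      intro σ
      rw [map_div₀, map_mul, map_mul, hχx, hχx, hχx]
      by_cases hσ : σ ∈ ι.range
      · have h1 : ((χ 0 σ : ℤ) : M) * ((χ 1 σ : ℤ) : M) * ((χ 2 σ : ℤ) : M) = 1 := by
          simpa using congrArg (fun s : ℤˣ ↦ ((s : ℤ) : M)) ((hχN σ).mpr hσ)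
        rw [(hmem σ).mp hσ]
        linear_combination (x 0 * x 1 * x 2 / y) * h1
      · have h1 : ((χ 0 σ : ℤ) : M) * ((χ 1 σ : ℤ) : M) * ((χ 2 σ : ℤ) : M) = -1 := by
          simpa using congrArg (fun s : ℤˣ ↦ ((s : ℤ) : M))
            ((Int.units_eq_one_or _).resolve_left (mt (hχN σ).mp hσ))
        rw [(hnotMem σ).mp hσ, div_neg]
        linear_combination -(x 0 * x 1 * x 2 / y) * h1
    obtain ⟨q, hq⟩ := IntermediateField.mem_bot.mp hbot
    rw [eq_ratCast, eq_div_iff hy0] at hq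
    refine eq_of_squarefree_of_mul_sq_eq hsf hm₀ (q := q) ?_
    have : ((m 0 * m 1 * m 2 : ℤ) : M) = q ^ 2 * m₀ := by
      push_cast
      rw [← hx, ← hx, ← hx, ← hysq, ← mul_pow, ← mul_pow, ← mul_pow, hq]
    exact_mod_cast this
  exact ⟨fundamentalDiscr (m 0), fundamentalDiscr (m 1), fundamentalDiscr (m 2),
    { prod_eq := by
        rw [hdisc, ← hprod]
        exact fundamentalDiscr_mul_mul (hcop _ _ (by decide)) (hcop _ _ (by decide))
          (hcop _ _ (by decide))
      discr₁ := isQuadraticDiscriminant_fundamentalDiscr (hm 0) (hm1 0)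
      discr₂ := isQuadraticDiscriminant_fundamentalDiscr (hm 1) (hm1 1)
      discr₃ := isQuadraticDiscriminant_fundamentalDiscr (hm 2) (hm1 2)
      coprime₁₂ := hcop _ _ (by decide)
      coprime₂₃ := hcop _ _ (by decide)
      coprime₃₁ := hcop _ _ (by decide)
      symbol₃ := hsymb 2
      symbol₁ := hsymb 0
      symbol₂ := hsymb 1 }⟩

end Necessity

theorem mainTheorem1 (k : Type u) [Field k] [NumberField k]
    (hk : Module.finrank ℚ k = 2) :
    (∃ (M : Type u) (_ : Field M) (_ : NumberField M) (_ : Algebra k M),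
        IsUnramifiedH8Extension k M ∧ Normal ℚ M) ↔
      ∃ d₁ d₂ d₃ : ℤ, IsH8Factorization (NumberField.discr k) d₁ d₂ d₃ := by
  constructor
  · rintro ⟨M, _, _, _, h, _⟩
    exact h.exists_factorization hk
  · rintro ⟨d₁, d₂, d₃, h⟩
    obtain ⟨a, b, c, habc, hd⟩ := h.exists_radicands
    exact habc.exists_unramifiedH8Extension k hk hd
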